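/- Let $X$ be a compact complex manifold of dimension $n$ with a Kähler metric $g$ and Kähler form $\omega=\sqrt{-1}\sum g_{\alpha\bar\beta}\,dz^\alpha\wedge d\bar z^\beta$, and let $\mathfrak{E}=(E,\phi)$ be a Higgs bundle on $X$: $E$ is a holomorphic vector bundle of rank $r$ and $\phi$ is a holomorphic $\mathrm{End}\,E$-valued $(1,0)$-form with $\phi\wedge\phi=0$. For a (smooth) Hermitian metric $h$ on $E$, let $D_h$ be the Chern connection, $\phi^*_h$ the $h$-adjoint of $\phi$, $\mathcal{D}_h=D_h+\phi+\phi_h^*$ the Hitchin--Simpson connection (with the same notation for the induced connection on $\mathrm{End}\,E$), $\mathcal{R}_h=\mathcal{D}_h\circ\mathcal{D}_h$ its curvature, $\mathcal{K}_h=\sqrt{-1}\,\Lambda\mathcal{R}_h$ the Hitchin--Simpson mean curvature, where $\Lambda$ is the adjoint of $\omega\wedge\cdot$, and $$\mathcal{J}(h)=\frac12\int_X|\mathcal{K}_h|^2\,\omega^n,\qquad |\mathcal{K}_h|^2=\mathrm{tr}\bigl(\mathcal{K}_h\circ(\mathcal{K}_h)^*_h\bigr).$$ Theorem. Let $h$ be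 a Hermitian metric on $E$. For every smooth one-parameter family $h_t$ ($-\varepsilon<t<\varepsilon$) of Hermitian metrics on $E$ with $h_0=h$, the function $t\mapsto\mathcal{J}(h_t)$ is differentiable at $t=0$. The Euler--Lagrange equation of $\mathcal{J}$ is $\mathcal{D}_h\mathcal{K}_h=0$; that is, $\frac{d}{dt}\big|_{t=0}\mathcal{J}(h+tk)=0$ for every smooth Hermitian form $k$ on $E$ if and only if $\mathcal{D}_h\mathcal{K}_h=0$. Consequently $h$ is a critical point of $\mathcal{J}$ (that is, $\frac{d}{dt}\big|_{t=0}\mathcal{J}(h_t)=0$ for every smooth one-parameter family $h_t$ of Hermitian metrics with $h_0=h$) if and only if $\mathcal{K}_h$ is parallel with respect to the Hitchin--Simpson connection. -/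

import Mathlib

open Set Topology Bundle
open scoped Manifold ContDiff Matrix ComplexConjugate

/-- The model space `ℂⁿ` (both for charts of the base and for fibres of bundles). -/
abbrev Cn (n : ℕ) : Type := Fin n → ℂ

/-- A complex manifold is, with the same charts, a smooth real manifold. -/
theorem isManifold_real_of_complex (n : ℕ) (X : Type*) [TopologicalSpace X]
    [ChartedSpace (Cn n) X] [IsManifold 𝓘(ℂ, Cn n) ω X] : IsManifold 𝓘(ℝ, Cn n) ∞ X := by
  apply isManifold_of_contDiffOn
  intro e e' he he'
  have h : e.symm ≫ₕ e' ∈ contDiffGroupoid ω 𝓘(ℂ, Cn n) :=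
    HasGroupoid.compatible he he'
  rw [contDiffGroupoid, mem_groupoid_of_pregroupoid, contDiffPregroupoid] at h
  have h3 : ContDiffOn ℂ ω (e.symm ≫ₕ e') (e.symm ≫ₕ e').source := by
    simpa using h.1
  have h4 : ContDiffOn ℝ ∞ (e.symm ≫ₕ e') (e.symm ≫ₕ e').source :=
    (h3.restrict_scalars ℝ).of_le le_top
  simpa using h4

noncomputable section

namespace HiggsKobayashi

/-! ### Local holomorphic coordinates and frames

Around every point `x₀` of `X` we use the holomorphic chart `chartAt x₀` and the holomorphic
frame `e₁, …, e_r` of the bundle given by the trivialization at `x₀`. -/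

section Local

variable {n : ℕ} {X : Type*} [TopologicalSpace X] [ChartedSpace (Cn n) X]
variable {r : ℕ} {V : X → Type*} [TopologicalSpace (TotalSpace (Cn r) V)]
  [∀ x, AddCommGroup (V x)] [∀ x, Module ℂ (V x)] [∀ x, TopologicalSpace (V x)]
  [FiberBundle (Cn r) V] [VectorBundle ℂ (Cn r) V]

variable (n X) in
/-- The point of `X` with coordinates `z` in the chart around `x₀`. -/
def pt (x₀ : X) (z : Cn n) : X := (chartAt (Cn n) x₀).symm z

variable (n r V) in
/-- The open set of coordinate vectors at which both the chart and the frame around `x₀` are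
defined. -/
def coordDomain (x₀ : X) : Set (Cn n) :=
  (chartAt (Cn n) x₀).target ∩ (pt n X x₀) ⁻¹' (trivializationAt (Cn r) V x₀).baseSet

variable (r V) in
/-- The holomorphic frame around `x₀`, as a linear map `ℂʳ → V y`. -/
def frameMap (x₀ y : X) : Cn r →L[ℂ] V y := (trivializationAt (Cn r) V x₀).symmL ℂ y

variable (r V) in
/-- Components of a vector of `V y` in the frame around `x₀`. -/
def coframeMap (x₀ y : X) : V y →L[ℂ] Cn r :=
  (trivializationAt (Cn r) V x₀).continuousLinearMapAt ℂ y

variable (r V) in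
/-- The frame vector `e_i`. -/
def frameVec (x₀ y : X) (i : Fin r) : V y := frameMap r V x₀ y (Pi.single i 1)

variable (r) in
/-- The matrix `A^i_j` of an endomorphism `A` of `V y` in the frame around `x₀`. -/
def endMatrix (x₀ y : X) (A : Module.End ℂ (V y)) : Matrix (Fin r) (Fin r) ℂ :=
  LinearMap.toMatrix' ((coframeMap r V x₀ y).toLinearMap ∘ₗ A ∘ₗ (frameMap r V x₀ y).toLinearMap)

variable (V) in
/-- The endomorphism of `V y` with a given matrix in the frame around `x₀`. -/
def endOfMatrix (x₀ y : X) (M : Matrix (Fin r) (Fin r) ℂ) : Module.End ℂ (V y) :=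
  (frameMap r V x₀ y).toLinearMap ∘ₗ Matrix.toLin' M ∘ₗ (coframeMap r V x₀ y).toLinearMap

end Local

/-! ### Hermitian forms, Kähler metrics, Higgs fields -/

section Structures

variable (n : ℕ) {X : Type*} [TopologicalSpace X] [ChartedSpace (Cn n) X]
variable (r : ℕ) (V : X → Type*) [TopologicalSpace (TotalSpace (Cn r) V)]
  [∀ x, AddCommGroup (V x)] [∀ x, Module ℂ (V x)] [∀ x, TopologicalSpace (V x)]
  [FiberBundle (Cn r) V] [VectorBundle ℂ (Cn r) V]

/-- A smooth Hermitian form on the bundle `V`; following Mathlib's convention it is conjugate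
linear in the first variable. Smoothness is in the real sense, in local coordinates. -/
structure HermitianForm where
  form : ∀ x, V x →ₗ⋆[ℂ] V x →ₗ[ℂ] ℂ
  conj_symm : ∀ x u v, conj (form x u v) = form x v u
  smooth : ∀ (x₀ : X) (i j : Fin r), ContDiffOn ℝ ∞
    (fun z : Cn n => form (pt n X x₀ z) (frameVec r V x₀ (pt n X x₀ z) i)
      (frameVec r V x₀ (pt n X x₀ z) j)) (coordDomain n r V x₀)

/-- A (smooth) Hermitian metric on the bundle `V`. -/
structure HermitianMetric extends HermitianForm n r V where
  pos : ∀ x (u : V x), u ≠ 0 → 0 < (form x u u).re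

variable {n r V} in
/-- The matrix `H_{ij} = h(e_i, e_j)` in the frame around `x₀`, as a function of the
coordinates. -/
def HermitianForm.mat (h : HermitianForm n r V) (x₀ : X) (z : Cn n) :
    Matrix (Fin r) (Fin r) ℂ :=
  Matrix.of fun i j => h.form (pt n X x₀ z) (frameVec r V x₀ (pt n X x₀ z) i)
    (frameVec r V x₀ (pt n X x₀ z) j)

variable (X) in
/-- The value at `z`, on two constant vector fields `u`, `v`, of the real `2`-form
`√-1 ∑ g_{αβ̄} dz^α ∧ dz̄^β` of a Hermitian form `g` on the holomorphic tangent bundle,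
where `g_{αβ̄} = g(∂_β, ∂_α)` because `g` is conjugate linear in the first variable. -/
def fundamentalForm [IsManifold 𝓘(ℂ, Cn n) ω X]
    (g : HermitianForm n n (fun x : X => TangentSpace 𝓘(ℂ, Cn n) x))
    (x₀ : X) (z u v : Cn n) : ℂ :=
  Complex.I * ∑ α, ∑ β, g.mat x₀ z β α * (u α * conj (v β) - v α * conj (u β))

variable (X) in
/-- A Kähler metric on the complex manifold `X`: a Hermitian metric on the holomorphic tangent
bundle whose fundamental form `ω` is closed; `dω` is evaluated on constant coordinate fields. -/
structure KahlerMetric [IsManifold 𝓘(ℂ, Cn n) ω X] extends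
    HermitianMetric n n (fun x : X => TangentSpace 𝓘(ℂ, Cn n) x) where
  closed : ∀ (x₀ : X), ∀ z ∈ (chartAt (Cn n) x₀).target, ∀ u v w : Cn n,
    fderiv ℝ (fun z' => fundamentalForm n X toHermitianForm x₀ z' v w) z u
    - fderiv ℝ (fun z' => fundamentalForm n X toHermitianForm x₀ z' u w) z v
    + fderiv ℝ (fun z' => fundamentalForm n X toHermitianForm x₀ z' u v) z w = 0

/-- A Higgs field on `V`: a holomorphic `End V`-valued `(1,0)`-form `φ` with `φ ∧ φ = 0`.
Holomorphy is holomorphy of all local components of `φ`. -/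
structure HiggsField [IsManifold 𝓘(ℂ, Cn n) ω X] where
  field : ∀ x : X, TangentSpace 𝓘(ℂ, Cn n) x →ₗ[ℂ] Module.End ℂ (V x)
  holomorphic : ∀ (x₀ : X) (α : Fin n) (i j : Fin r), DifferentiableOn ℂ
    (fun z : Cn n => endMatrix r x₀ (pt n X x₀ z) (field (pt n X x₀ z)
      (frameVec n (fun x : X => TangentSpace 𝓘(ℂ, Cn n) x) x₀ (pt n X x₀ z) α)) i j)
    (coordDomain n r V x₀)
  wedge_self : ∀ x u v, field x u * field x v - field x v * field x u = 0

end Structures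

/-! ### The Hitchin–Simpson connection, its curvature and its mean curvature -/

section Connection

variable {n : ℕ} {X : Type*} [TopologicalSpace X] [ChartedSpace (Cn n) X]
  [IsManifold 𝓘(ℂ, Cn n) ω X]
variable {r : ℕ} {V : X → Type*} [TopologicalSpace (TotalSpace (Cn r) V)]
  [∀ x, AddCommGroup (V x)] [∀ x, Module ℂ (V x)] [∀ x, TopologicalSpace (V x)]
  [FiberBundle (Cn r) V] [VectorBundle ℂ (Cn r) V]

/-- Entrywise directional derivative of a matrix valued function of the coordinates in the real
direction `u`. -/
def matDeriv (A : Cn n → Matrix (Fin r) (Fin r) ℂ) (z u : Cn n) : Matrix (Fin r) (Fin r) ℂ :=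
  Matrix.of fun i j => fderiv ℝ (fun z' => A z' i j) z u

/-- The `(1,0)`-part `∂A` of the differential of a matrix valued function, evaluated at `u`. -/
def matDel (A : Cn n → Matrix (Fin r) (Fin r) ℂ) (z u : Cn n) : Matrix (Fin r) (Fin r) ℂ :=
  (1 / 2 : ℂ) • (matDeriv A z u - Complex.I • matDeriv A z (Complex.I • u))

/-- The matrix of the Higgs field `φ(u)` in local coordinates and frame. -/
def HiggsField.mat (φ : HiggsField n r V) (x₀ : X) (z u : Cn n) : Matrix (Fin r) (Fin r) ℂ :=
  endMatrix r x₀ (pt n X x₀ z) (φ.field (pt n X x₀ z)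
    (frameMap n (fun x : X => TangentSpace 𝓘(ℂ, Cn n) x) x₀ (pt n X x₀ z) u))

/-- The matrix of the `h`-adjoint `M^*_h` of the endomorphism with matrix `M`, where `H` is the
matrix of `h`: it is determined by `h(M^*_h s, s') = h(s, M s')`. -/
def matAdjoint (H M : Matrix (Fin r) (Fin r) ℂ) : Matrix (Fin r) (Fin r) ℂ := H⁻¹ * Mᴴ * H

/-- The connection form `H⁻¹ ∂H` of the Chern connection `D_h` in a holomorphic frame. -/
def chernForm (h : HermitianMetric n r V) (x₀ : X) (z u : Cn n) : Matrix (Fin r) (Fin r) ℂ :=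
  (h.mat x₀ z)⁻¹ * matDel (h.mat x₀) z u

/-- The connection form of the Hitchin–Simpson connection `𝒟_h = D_h + φ + φ^*_h`. -/
def hsForm (φ : HiggsField n r V) (h : HermitianMetric n r V) (x₀ : X) (z u : Cn n) :
    Matrix (Fin r) (Fin r) ℂ :=
  chernForm h x₀ z u + φ.mat x₀ z u + matAdjoint (h.mat x₀ z) (φ.mat x₀ z u)

/-- The Hitchin–Simpson curvature `𝓡_h = 𝒟_h ∘ 𝒟_h`, i.e. the `End V`-valued `2`-form
`dΘ + Θ ∧ Θ` with `Θ` the connection form of `𝒟_h`, evaluated on constant fields `u`, `v`. -/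
def hsCurvature (φ : HiggsField n r V) (h : HermitianMetric n r V) (x₀ : X) (z u v : Cn n) :
    Matrix (Fin r) (Fin r) ℂ :=
  matDeriv (fun z' => hsForm φ h x₀ z' v) z u - matDeriv (fun z' => hsForm φ h x₀ z' u) z v
    + (hsForm φ h x₀ z u * hsForm φ h x₀ z v - hsForm φ h x₀ z v * hsForm φ h x₀ z u)

/-- The coefficient `ψ_{αβ̄} = ψ(∂/∂z^α, ∂/∂z̄^β)` of a matrix valued real-bilinear alternating
form `ψ`, with `∂/∂z = (∂_x - √-1 ∂_y)/2` and `∂/∂z̄ = (∂_x + √-1 ∂_y)/2`. -/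
def coeff11 (ψ : Cn n → Cn n → Matrix (Fin r) (Fin r) ℂ) (α β : Fin n) :
    Matrix (Fin r) (Fin r) ℂ :=
  let e : Fin n → Cn n := fun γ => Pi.single γ 1
  let f : Fin n → Cn n := fun γ => Pi.single γ Complex.I
  (1 / 4 : ℂ) • (ψ (e α) (e β) + Complex.I • ψ (e α) (f β)
    - Complex.I • ψ (f α) (e β) + ψ (f α) (f β))

/-- The contraction `Λψ = -√-1 ∑ g^{αβ̄} ψ_{αβ̄}` of a matrix valued `2`-form `ψ` with the Kähler
form, where `∑_β g^{αβ̄} g_{γβ̄} = δ^α_γ`; `G` is the matrix of `g`, i.e. `G β α = g_{αβ̄}`. -/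
def lefschetzLambda (G : Matrix (Fin n) (Fin n) ℂ)
    (ψ : Cn n → Cn n → Matrix (Fin r) (Fin r) ℂ) : Matrix (Fin r) (Fin r) ℂ :=
  -Complex.I • ∑ α, ∑ β, G⁻¹ α β • coeff11 ψ α β

/-- The Hitchin–Simpson mean curvature `𝒦_h = √-1 Λ 𝓡_h`, an endomorphism of `V`. At the point
`x` it is computed in the coordinates and the frame around `x`. -/
def hsMeanCurvature (g : KahlerMetric n X) (φ : HiggsField n r V) (h : HermitianMetric n r V)
    (x : X) : Module.End ℂ (V x) :=
  let z : Cn n := chartAt (Cn n) x x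
  endOfMatrix V x x (Complex.I • lefschetzLambda (g.mat x z) (hsCurvature φ h x z))

/-- The covariant derivative `(𝒟_h S)(u)` at `x` of a section `S` of `End V` for the connection
induced by the Hitchin–Simpson connection, in the direction of the real tangent vector `u`:
`dS + [Θ, S]` in the coordinates and the frame around `x`. -/
def hsCovDeriv (φ : HiggsField n r V) (h : HermitianMetric n r V)
    (S : ∀ x : X, Module.End ℂ (V x)) (x : X) (u : TangentSpace 𝓘(ℂ, Cn n) x) :
    Module.End ℂ (V x) :=
  let z : Cn n := chartAt (Cn n) x x
  let M : Cn n → Matrix (Fin r) (Fin r) ℂ := fun z' => endMatrix r x (pt n X x z') (S (pt n X x z'))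
  let ux : Cn n := coframeMap n (fun y : X => TangentSpace 𝓘(ℂ, Cn n) y) x x u
  endOfMatrix V x x
    (matDeriv M z ux + (hsForm φ h x z ux * M z - M z * hsForm φ h x z ux))

/-- The section `S` of `End V` is parallel for the Hitchin–Simpson connection: `𝒟_h S = 0`. -/
def IsHSParallel (φ : HiggsField n r V) (h : HermitianMetric n r V)
    (S : ∀ x : X, Module.End ℂ (V x)) : Prop :=
  ∀ (x : X) (u : TangentSpace 𝓘(ℂ, Cn n) x), hsCovDeriv φ h S x u = 0

/-- The pointwise squared norm `|A|² = tr (A ∘ A^*_h)` of an endomorphism of `V x`. -/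
def endNormSq (h : HermitianMetric n r V) (x : X) (A : Module.End ℂ (V x)) : ℝ :=
  (endMatrix r x x A * matAdjoint (h.mat x (chartAt (Cn n) x x)) (endMatrix r x x A)).trace.re

end Connection

/-! ### Integration and the Kobayashi functional -/

section Functional

variable {n : ℕ} {X : Type*} [TopologicalSpace X] [ChartedSpace (Cn n) X]
  [IsManifold 𝓘(ℂ, Cn n) ω X] [T2Space X] [CompactSpace X]

variable (n X) in
/-- A smooth partition of unity on `X` subordinate to the domains of the charts. -/
def chartPartition : SmoothPartitionOfUnity X 𝓘(ℝ, Cn n) X univ :=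
  haveI : IsManifold 𝓘(ℝ, Cn n) ∞ X := isManifold_real_of_complex n X
  (SmoothPartitionOfUnity.exists_isSubordinate_chartAt_source (H := Cn n) 𝓘(ℝ, Cn n) X).choose

theorem chartPartition_isSubordinate :
    (chartPartition n X).IsSubordinate fun x => (chartAt (Cn n) x).source :=
  haveI : IsManifold 𝓘(ℝ, Cn n) ∞ X := isManifold_real_of_complex n X
  (SmoothPartitionOfUnity.exists_isSubordinate_chartAt_source (H := Cn n)
    𝓘(ℝ, Cn n) X).choose_spec

/-- The integral `∫_X f ωⁿ` with respect to the Kähler form `ω`, through a partition of unity; in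
local coordinates `ωⁿ = n! det(g_{αβ̄}) ∏ (√-1 dz^α ∧ dz̄^α) = n! 2ⁿ det(g_{αβ̄}) dλ` with `λ` the
Lebesgue measure of `ℂⁿ`. -/
def kahlerIntegral (g : KahlerMetric n X) (f : X → ℝ) : ℝ :=
  ∑ᶠ x₀ : X, ∫ z in (chartAt (Cn n) x₀).target,
    chartPartition n X x₀ (pt n X x₀ z) * f (pt n X x₀ z)
      * ((n.factorial : ℝ) * 2 ^ n * (g.mat x₀ z).det.re)

variable {r : ℕ} {V : X → Type*} [TopologicalSpace (TotalSpace (Cn r) V)]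
  [∀ x, AddCommGroup (V x)] [∀ x, Module ℂ (V x)] [∀ x, TopologicalSpace (V x)]
  [FiberBundle (Cn r) V] [VectorBundle ℂ (Cn r) V]

/-- The Kobayashi functional `𝒥(h) = ½ ∫_X |𝒦_h|² ωⁿ`. -/
def kobayashiFunctional (g : KahlerMetric n X) (φ : HiggsField n r V)
    (h : HermitianMetric n r V) : ℝ :=
  (1 / 2) * kahlerIntegral g (fun x => endNormSq h x (hsMeanCurvature g φ h x))

end Functional

/-! ### One-parameter families, critical points, Euler–Lagrange equation -/

section Variation

variable {n : ℕ} {X : Type*} [TopologicalSpace X] [ChartedSpace (Cn n) X]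
variable {r : ℕ} {V : X → Type*} [TopologicalSpace (TotalSpace (Cn r) V)]
  [∀ x, AddCommGroup (V x)] [∀ x, Module ℂ (V x)] [∀ x, TopologicalSpace (V x)]
  [FiberBundle (Cn r) V] [VectorBundle ℂ (Cn r) V]

/-- `h_t`, `-ε < t < ε`, is a smooth one-parameter family of Hermitian metrics with `h_0 = h`
(jointly smooth in `t` and the point; the values for other `t` are irrelevant). -/
structure IsFamilyThrough (h : HermitianMetric n r V) (ε : ℝ)
    (ht : ℝ → HermitianMetric n r V) : Prop where
  pos : 0 < ε
  zero : ht 0 = h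
  smooth : ∀ (x₀ : X) (i j : Fin r), ContDiffOn ℝ ∞
    (fun p : ℝ × Cn n => (ht p.1).mat x₀ p.2 i j) (Ioo (-ε) ε ×ˢ coordDomain n r V x₀)

/-- `h_t = h + t k` for `-ε < t < ε`. -/
def IsLinearFamily (h : HermitianMetric n r V) (k : HermitianForm n r V) (ε : ℝ)
    (ht : ℝ → HermitianMetric n r V) : Prop :=
  0 < ε ∧ ∀ t ∈ Ioo (-ε) ε, ∀ (x : X) (u v : V x),
    (ht t).form x u v = h.form x u v + (t : ℂ) * k.form x u v

/-- `h` is a critical point of the functional `J` on the space of Hermitian metrics: the derivative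
of `J` at `h` along every smooth one-parameter family through `h` is zero. -/
def IsCriticalPoint (J : HermitianMetric n r V → ℝ) (h : HermitianMetric n r V) : Prop :=
  ∀ (ε : ℝ) (ht : ℝ → HermitianMetric n r V), IsFamilyThrough h ε ht →
    HasDerivAt (fun t => J (ht t)) 0 0

/-- The first variation of `J` at `h` in the direction of every Hermitian form `k`, i.e. every
tangent vector at `h` of the space of Hermitian metrics, is zero. -/
def FirstVariationVanishes (J : HermitianMetric n r V → ℝ) (h : HermitianMetric n r V) : Prop :=
  ∀ (k : HermitianForm n r V) (ε : ℝ) (ht : ℝ → HermitianMetric n r V),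
    IsLinearFamily h k ε ht → HasDerivAt (fun t => J (ht t)) 0 0

end Variation

end HiggsKobayashi

end

/-!
The mean curvature `𝒦` is self-adjoint, so `|𝒦|² = tr 𝒦²` (`endNormSq_hsMeanCurvature`), and in a
chart and a holomorphic frame `𝒦 = ∑ g^{αβ̄} (F_{αβ̄} + [φ_α, φ^*_β̄])`. Differentiating under the
integral sign gives the first variation `∫ tr (𝒦 ∂𝒦/∂t) ωⁿ` of the functional
(`IsFamilyThrough.hasDerivAt_kobayashiFunctional`). If the family has velocity `h W`, with `W` a
self-adjoint endomorphism, then `∂𝒦/∂t = ∑ g^{αβ̄} (-∂_β̄ D'_α W + [φ_α, [φ^*_β̄, W]])`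
(`hasDerivAt_higgsCurv`).

Two integrations by parts give the theorem. Both rest on the vanishing of the integral of
`□ f = ∑ g^{αβ̄} ∂_β̄ ∂_α f` on a compact Kähler manifold (`kahlerIntegral_box`): the Kähler
condition makes the coefficients `det (g) g^{αβ̄}` divergence free
(`KahlerMetric.sum_delbar_det_mul_inv`), so that `□ f` is a divergence with respect to the density of `ωⁿ`.

* If `𝒦` is parallel, then `tr (𝒦 ∂𝒦/∂t) = -□ tr (𝒦 W)`
  (`trace_mul_higgsCurvVar_of_parallel`), so the first variation vanishes along every family.
* Conversely, the metric is varied in the direction `k(u, v) = h(u, 𝒦 v)` (`curvatureForm`), for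
  which `W = 𝒦`. Then `tr (𝒦 ∂𝒦/∂t) = -½ □ tr 𝒦² + |D'𝒦|² + |[φ, 𝒦]|²` (`trace_mul_higgsCurvVar_self`,
  `contract_trace_mul_adjoint`). If the first variation vanishes, so do `D'𝒦` and `[φ, 𝒦]`, and, by
  self-adjointness, also `D''𝒦` and `[φ^*, 𝒦]`, so `𝒟𝒦 = 0`.

The equation `𝒟𝒦 = 0` is equivalent to the vanishing of both `D'𝒦` and `[φ, 𝒦]`
(`FrameData.parallel_iff`, `hsCovDeriv_eq_zero_iff`): its two types are `D'𝒦 = -[φ, 𝒦]` and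
`D''𝒦 = -[φ^*, 𝒦]`, while the adjoint of the first is `D''𝒦 = [φ^*, 𝒦]`.

The local computations take place in a normed star algebra, with matrix functions on open subsets of
`ℂⁿ` (`FrameData`); they are transported to the bundle by the tensoriality of the curvature and of
the covariant derivative (`FrameData.higgsCurv_transform`, `FrameData.covDel_transform`).
-/

noncomputable section

namespace HiggsKobayashi

set_option linter.unusedSectionVars false

/-! ### Wirtinger derivatives -/

section Wirtinger

variable {n m : ℕ} {F F' : Type*} [NormedAddCommGroup F] [NormedSpace ℝ F] [NormedSpace ℂ F]
  [NormedAddCommGroup F'] [NormedSpace ℝ F'] [NormedSpace ℂ F']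

/-- The derivative `∂f/∂a` of type `(1,0)` of a function on `ℂⁿ` at `z`, complex linear in the
vector `a`. -/
def del (f : Cn n → F) (a z : Cn n) : F :=
  (1 / 2 : ℂ) • (fderiv ℝ f z a - Complex.I • fderiv ℝ f z (Complex.I • a))

/-- The derivative `∂f/∂ā` of type `(0,1)` of a function on `ℂⁿ` at `z`, conjugate linear in the
vector `a`. -/
def delbar (f : Cn n → F) (a z : Cn n) : F :=
  (1 / 2 : ℂ) • (fderiv ℝ f z a + Complex.I • fderiv ℝ f z (Complex.I • a))

theorem fderiv_eq_del_add_delbar (f : Cn n → F) (a z : Cn n) :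
    fderiv ℝ f z a = del f a z + delbar f a z := by
  simp only [del, delbar]; module

theorem del_congr {f g : Cn n → F} {z : Cn n} (h : f =ᶠ[𝓝 z] g) (a : Cn n) :
    del f a z = del g a z := by
  simp only [del, h.fderiv_eq]

theorem delbar_congr {f g : Cn n → F} {z : Cn n} (h : f =ᶠ[𝓝 z] g) (a : Cn n) :
    delbar f a z = delbar g a z := by
  simp only [delbar, h.fderiv_eq]

theorem delbar_add {f g : Cn n → F} {z : Cn n} (hf : DifferentiableAt ℝ f z)
    (hg : DifferentiableAt ℝ g z) (a : Cn n) :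
    delbar (fun z' => f z' + g z') a z = delbar f a z + delbar g a z := by
  simp only [delbar, fderiv_fun_add hf hg, _root_.add_apply]; module

theorem del_sum {ι : Type*} (s : Finset ι) {f : ι → Cn n → F} {z : Cn n}
    (hf : ∀ i ∈ s, DifferentiableAt ℝ (f i) z) (a : Cn n) :
    del (fun z' => ∑ i ∈ s, f i z') a z = ∑ i ∈ s, del (f i) a z := by
  simp only [del, fderiv_fun_sum hf, _root_.sum_apply]
  rw [← Finset.smul_sum, Finset.sum_sub_distrib, Finset.smul_sum]

theorem delbar_sum {ι : Type*} (s : Finset ι) {f : ι → Cn n → F} {z : Cn n}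
    (hf : ∀ i ∈ s, DifferentiableAt ℝ (f i) z) (a : Cn n) :
    delbar (fun z' => ∑ i ∈ s, f i z') a z = ∑ i ∈ s, delbar (f i) a z := by
  simp only [delbar, fderiv_fun_sum hf, _root_.sum_apply]
  rw [← Finset.smul_sum, Finset.sum_add_distrib, Finset.smul_sum]

variable [IsScalarTower ℝ ℂ F] [IsScalarTower ℝ ℂ F']

theorem del_clm (L : F →L[ℂ] F') {f : Cn n → F} {z : Cn n} (hf : DifferentiableAt ℝ f z)
    (a : Cn n) : del (fun z' => L (f z')) a z = L (del f a z) := by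
  have h : fderiv ℝ (fun z' => L (f z')) z = (L.restrictScalars ℝ).comp (fderiv ℝ f z) :=
    ((L.restrictScalars ℝ).hasFDerivAt.comp z hf.hasFDerivAt).fderiv
  simp [del, h]

theorem delbar_clm (L : F →L[ℂ] F') {f : Cn n → F} {z : Cn n} (hf : DifferentiableAt ℝ f z)
    (a : Cn n) : delbar (fun z' => L (f z')) a z = L (delbar f a z) := by
  have h : fderiv ℝ (fun z' => L (f z')) z = (L.restrictScalars ℝ).comp (fderiv ℝ f z) :=
    ((L.restrictScalars ℝ).hasFDerivAt.comp z hf.hasFDerivAt).fderiv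
  simp [delbar, h]

theorem delbar_smul {c : Cn n → ℂ} {f : Cn n → F} {z : Cn n} (hc : DifferentiableAt ℝ c z)
    (hf : DifferentiableAt ℝ f z) (a : Cn n) :
    delbar (fun z' => c z' • f z') a z = delbar c a z • f z + c z • delbar f a z := by
  simp only [delbar, fderiv_fun_smul hc hf, _root_.add_apply,
    _root_.smul_apply, ContinuousLinearMap.smulRight_apply, smul_eq_mul]
  module

theorem delbar_const_smul (c : ℂ) {f : Cn n → F} {z : Cn n} (hf : DifferentiableAt ℝ f z)
    (a : Cn n) : delbar (fun z' => c • f z') a z = c • delbar f a z := by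
  rw [delbar_smul (differentiableAt_const c) hf]
  simp [delbar]

theorem fderiv_real_of_holomorphic {f : Cn n → F} {z : Cn n} (hf : DifferentiableAt ℂ f z)
    (a : Cn n) : fderiv ℝ f z a = fderiv ℂ f z a := by
  rw [(hf.hasFDerivAt.restrictScalars ℝ).fderiv]; rfl

theorem del_of_holomorphic {f : Cn n → F} {z : Cn n} (hf : DifferentiableAt ℂ f z)
    (a : Cn n) : del f a z = fderiv ℂ f z a := by
  simp only [del, fderiv_real_of_holomorphic hf, map_smul, smul_smul, Complex.I_mul_I]; module

theorem delbar_of_holomorphic {f : Cn n → F} {z : Cn n} (hf : DifferentiableAt ℂ f z)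
    (a : Cn n) : delbar f a z = 0 := by
  simp only [delbar, fderiv_real_of_holomorphic hf, map_smul, smul_smul, Complex.I_mul_I]; module

theorem del_add_right (f : Cn n → F) (a b z : Cn n) : del f (a + b) z = del f a z + del f b z := by
  simp only [del, smul_add, map_add]; module

theorem delbar_add_right (f : Cn n → F) (a b z : Cn n) :
    delbar f (a + b) z = delbar f a z + delbar f b z := by
  simp only [delbar, smul_add, map_add]; module

theorem fderiv_smul_complex (f : Cn n → F) (c : ℂ) (a z : Cn n) :
    fderiv ℝ f z (c • a) = (c.re : ℂ) • fderiv ℝ f z a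
      + (c.im : ℂ) • fderiv ℝ f z (Complex.I • a) := by
  have h : c • a = c.re • a + c.im • (Complex.I • a) := by
    ext i
    simp only [Pi.smul_apply, Pi.add_apply, smul_eq_mul, Complex.real_smul]
    conv_lhs => rw [← Complex.re_add_im c]
    ring
  rw [h, map_add, map_smul, map_smul]
  rw [← algebraMap_smul ℂ c.re, ← algebraMap_smul ℂ c.im]; rfl

theorem del_smul_right (f : Cn n → F) (c : ℂ) (a z : Cn n) : del f (c • a) z = c • del f a z := by
  have h2 := fderiv_smul_complex f (Complex.I * c) a z
  simp only [Complex.mul_re, Complex.mul_im, Complex.I_re, Complex.I_im] at h2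
  simp only [del, smul_smul, fderiv_smul_complex f c, h2]
  have hc := Complex.re_add_im c
  generalize fderiv ℝ f z a = x
  generalize fderiv ℝ f z (Complex.I • a) = y
  push_cast
  conv_rhs => rw [← hc]
  match_scalars <;> ring_nf <;> simp <;> ring

theorem delbar_smul_right (f : Cn n → F) (c : ℂ) (a z : Cn n) :
    delbar f (c • a) z = conj c • delbar f a z := by
  have h2 := fderiv_smul_complex f (Complex.I * c) a z
  simp only [Complex.mul_re, Complex.mul_im, Complex.I_re, Complex.I_im] at h2
  simp only [delbar, smul_smul, fderiv_smul_complex f c, h2]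
  have hc : conj c = c.re - c.im * Complex.I := by
    rw [Complex.ext_iff]; simp
  generalize fderiv ℝ f z a = x
  generalize fderiv ℝ f z (Complex.I • a) = y
  push_cast
  rw [hc]
  match_scalars <;> ring_nf <;> simp <;> ring

theorem del_eq_sum (f : Cn n → F) (a z : Cn n) :
    del f a z = ∑ γ, a γ • del f (Pi.single γ 1) z := by
  have h (s : Finset (Fin n)) : del f (∑ γ ∈ s, a γ • Pi.single γ (1 : ℂ)) z
      = ∑ γ ∈ s, a γ • del f (Pi.single γ 1) z := by
    classical
    induction s using Finset.induction_on with
    | empty => simp [del]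
    | insert i s hi ih => rw [Finset.sum_insert hi, Finset.sum_insert hi, del_add_right, ih,
        del_smul_right]
  rw [← h]
  congr 1
  exact pi_eq_sum_univ' a

theorem delbar_eq_sum (f : Cn n → F) (a z : Cn n) :
    delbar f a z = ∑ γ, conj (a γ) • delbar f (Pi.single γ 1) z := by
  have h (s : Finset (Fin n)) : delbar f (∑ γ ∈ s, a γ • Pi.single γ (1 : ℂ)) z
      = ∑ γ ∈ s, conj (a γ) • delbar f (Pi.single γ 1) z := by
    classical
    induction s using Finset.induction_on with
    | empty => simp [delbar]
    | insert i s hi ih => rw [Finset.sum_insert hi, Finset.sum_insert hi, delbar_add_right, ih,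
        delbar_smul_right]
  rw [← h]
  congr 1
  exact pi_eq_sum_univ' a

theorem del_comp {f : Cn m → F} {τ : Cn n → Cn m} {z : Cn n} (hf : DifferentiableAt ℝ f (τ z))
    (hτ : DifferentiableAt ℂ τ z) (a : Cn n) :
    del (fun z' => f (τ z')) a z = del f (fderiv ℂ τ z a) (τ z) := by
  have h : fderiv ℝ (fun z' => f (τ z')) z
      = (fderiv ℝ f (τ z)).comp ((fderiv ℂ τ z).restrictScalars ℝ) :=
    (hf.hasFDerivAt.comp z (hτ.hasFDerivAt.restrictScalars ℝ)).fderiv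
  simp [del, h]

theorem delbar_comp {f : Cn m → F} {τ : Cn n → Cn m} {z : Cn n} (hf : DifferentiableAt ℝ f (τ z))
    (hτ : DifferentiableAt ℂ τ z) (a : Cn n) :
    delbar (fun z' => f (τ z')) a z = delbar f (fderiv ℂ τ z a) (τ z) := by
  have h : fderiv ℝ (fun z' => f (τ z')) z
      = (fderiv ℝ f (τ z)).comp ((fderiv ℂ τ z).restrictScalars ℝ) :=
    (hf.hasFDerivAt.comp z (hτ.hasFDerivAt.restrictScalars ℝ)).fderiv
  simp [delbar, h]

theorem contDiffOn_fderiv_apply {E : Type*} [NormedAddCommGroup E] [NormedSpace ℝ E]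
    {f : E → F} {U : Set E} (hU : IsOpen U)
    (hf : ContDiffOn ℝ ∞ f U) (a : E) : ContDiffOn ℝ ∞ (fun z => fderiv ℝ f z a) U :=
  (hf.fderiv_of_isOpen hU (m := ∞) (by exact le_rfl)).clm_apply contDiffOn_const

theorem ContDiffOn.del {f : Cn n → F} {U : Set (Cn n)} (hf : ContDiffOn ℝ ∞ f U) (hU : IsOpen U)
    (a : Cn n) : ContDiffOn ℝ ∞ (del f a) U := by
  unfold HiggsKobayashi.del
  exact ((contDiffOn_fderiv_apply hU hf a).sub
    ((contDiffOn_fderiv_apply hU hf _).const_smul Complex.I)).const_smul _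

theorem ContDiffOn.delbar {f : Cn n → F} {U : Set (Cn n)} (hf : ContDiffOn ℝ ∞ f U)
    (hU : IsOpen U) (a : Cn n) : ContDiffOn ℝ ∞ (delbar f a) U := by
  unfold HiggsKobayashi.delbar
  exact ((contDiffOn_fderiv_apply hU hf a).add
    ((contDiffOn_fderiv_apply hU hf _).const_smul Complex.I)).const_smul _

theorem fderiv_fderiv_comm {E : Type*} [NormedAddCommGroup E] [NormedSpace ℝ E]
    {f : E → F} {U : Set E} (hU : IsOpen U)
    (hf : ContDiffOn ℝ ∞ f U) {z : E} (hz : z ∈ U) (a b : E) :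
    fderiv ℝ (fun z' => fderiv ℝ f z' a) z b = fderiv ℝ (fun z' => fderiv ℝ f z' b) z a := by
  have hs : IsSymmSndFDerivAt ℝ f z :=
    ((hf.contDiffAt (hU.mem_nhds hz))).isSymmSndFDerivAt (by
      rw [minSmoothness_of_isRCLikeNormedField]; exact WithTop.coe_le_coe.2 le_top)
  have hd : DifferentiableAt ℝ (fderiv ℝ f) z :=
    ((hf.fderiv_of_isOpen hU (m := ∞) (by exact le_rfl)).contDiffAt
      (hU.mem_nhds hz)).differentiableAt (by simp)
  rw [fderiv_clm_apply hd (differentiableAt_const _),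
    fderiv_clm_apply hd (differentiableAt_const _)]
  simpa using hs b a

theorem ContDiffOn.diffAt {E : Type*} [NormedAddCommGroup E] [NormedSpace ℝ E]
    {f : E → F} {U : Set E} (hf : ContDiffOn ℝ ∞ f U)
    (hU : IsOpen U) {z : E} (hz : z ∈ U) : DifferentiableAt ℝ f z :=
  (hf.contDiffAt (hU.mem_nhds hz)).differentiableAt (by simp)

theorem fderiv_fun_smul_complex {E : Type*} [NormedAddCommGroup E] [NormedSpace ℝ E]
    {f : E → F} {z : E} (hf : DifferentiableAt ℝ f z) (c : ℂ) (a : E) :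
    fderiv ℝ (fun z' => c • f z') z a = c • fderiv ℝ f z a := by
  rw [fderiv_fun_const_smul hf]; rfl

theorem del_delbar_comm {f : Cn n → F} {U : Set (Cn n)} (hU : IsOpen U)
    (hf : ContDiffOn ℝ ∞ f U) {z : Cn n} (hz : z ∈ U) (a b : Cn n) :
    delbar (del f a) b z = del (delbar f b) a z := by
  have hd : ∀ c, DifferentiableAt ℝ (fun z' => fderiv ℝ f z' c) z := fun c =>
    ContDiffOn.diffAt (contDiffOn_fderiv_apply hU hf c) hU hz
  have h1 : ∀ c, fderiv ℝ (del f a) z c = (1 / 2 : ℂ) • (fderiv ℝ (fun z' => fderiv ℝ f z' a) z c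
      - Complex.I • fderiv ℝ (fun z' => fderiv ℝ f z' (Complex.I • a)) z c) := by
    intro c
    unfold del
    rw [fderiv_fun_smul_complex ((hd a).fun_sub ((hd _).fun_const_smul Complex.I)),
      fderiv_fun_sub (hd a) ((hd _).fun_const_smul Complex.I), _root_.sub_apply,
      fderiv_fun_smul_complex (hd _)]
  have h2 : ∀ c, fderiv ℝ (delbar f b) z c = (1 / 2 : ℂ) •
      (fderiv ℝ (fun z' => fderiv ℝ f z' b) z c
      + Complex.I • fderiv ℝ (fun z' => fderiv ℝ f z' (Complex.I • b)) z c) := by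
    intro c
    unfold delbar
    rw [fderiv_fun_smul_complex ((hd b).fun_add ((hd _).fun_const_smul Complex.I)),
      fderiv_fun_add (hd b) ((hd _).fun_const_smul Complex.I), _root_.add_apply,
      fderiv_fun_smul_complex (hd _)]
  rw [delbar, del, h1, h1, h2, h2, fderiv_fderiv_comm hU hf hz a b,
    fderiv_fderiv_comm hU hf hz a (Complex.I • b), fderiv_fderiv_comm hU hf hz (Complex.I • a) b,
    fderiv_fderiv_comm hU hf hz (Complex.I • a) (Complex.I • b)]
  module

end Wirtinger

/-! ### Wirtinger calculus in normed star algebras -/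

section Algebra

variable {n m : ℕ} {𝔸 : Type*} [NormedRing 𝔸] [NormedAlgebra ℂ 𝔸]

theorem del_mul {f g : Cn n → 𝔸} {z : Cn n} (hf : DifferentiableAt ℝ f z)
    (hg : DifferentiableAt ℝ g z) (a : Cn n) :
    del (fun z' => f z' * g z') a z = del f a z * g z + f z * del g a z := by
  simp only [del, fderiv_fun_mul' hf hg, _root_.add_apply,
    _root_.smul_apply, smul_eq_mul, MulOpposite.smul_eq_mul_unop,
    MulOpposite.unop_op, smul_mul_assoc, mul_smul_comm, sub_mul, mul_sub]
  module

theorem delbar_mul {f g : Cn n → 𝔸} {z : Cn n} (hf : DifferentiableAt ℝ f z)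
    (hg : DifferentiableAt ℝ g z) (a : Cn n) :
    delbar (fun z' => f z' * g z') a z = delbar f a z * g z + f z * delbar g a z := by
  simp only [delbar, fderiv_fun_mul' hf hg, _root_.add_apply,
    _root_.smul_apply, smul_eq_mul, MulOpposite.smul_eq_mul_unop,
    MulOpposite.unop_op, smul_mul_assoc, mul_smul_comm, add_mul, mul_add]
  module

variable [StarRing 𝔸] [ContinuousStar 𝔸] [StarModule ℂ 𝔸]

theorem fderiv_star_apply (f : Cn n → 𝔸) (a z : Cn n) :
    fderiv ℝ (fun z' => star (f z')) z a = star (fderiv ℝ f z a) := by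
  have h : fderiv ℝ (fun z' => star (f z')) z
      = ((starL' ℝ : 𝔸 ≃L[ℝ] 𝔸) : 𝔸 →L[ℝ] 𝔸).comp (fderiv ℝ f z) := by
    exact fderiv_star
  rw [h]; rfl

theorem delbar_star (f : Cn n → 𝔸) (a z : Cn n) :
    delbar (fun z' => star (f z')) a z = star (del f a z) := by
  simp only [delbar, del, fderiv_star_apply, star_smul, star_sub]
  simp

theorem del_star (f : Cn n → 𝔸) (a z : Cn n) :
    del (fun z' => star (f z')) a z = star (delbar f a z) := by
  simp only [delbar, del, fderiv_star_apply, star_smul, star_add]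
  simp [sub_eq_add_neg]

end Algebra

/-! ### Smoothness of holomorphic functions of several variables -/

section SeveralVariables

/-- A directional derivative of a holomorphic function of several variables is holomorphic: it is
given by Cauchy's integral over a small circle in the direction `a`, which is differentiated under
the integral sign; the Schwarz lemma bounds the derivative of `f` locally. -/
theorem differentiableOn_fderiv_apply {n : ℕ} {f : Cn n → ℂ} {U : Set (Cn n)} (hU : IsOpen U)
    (hf : DifferentiableOn ℂ f U) (a : Cn n) :
    DifferentiableOn ℂ (fun z => fderiv ℂ f z a) U := by
  intro z₀ hz₀
  apply DifferentiableAt.differentiableWithinAt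
  obtain ⟨ε, hε, hεU⟩ := Metric.isOpen_iff.1 hU z₀ hz₀
  have hc : ContinuousAt f z₀ := (hf.differentiableAt (hU.mem_nhds hz₀)).continuousAt
  obtain ⟨ε', hε', hb⟩ := Metric.continuousAt_iff.1 hc 1 one_pos
  obtain ⟨δ, hδ, h1, h2⟩ : ∃ δ > 0, 3 * δ ≤ ε ∧ 3 * δ ≤ ε' :=
    ⟨min ε ε' / 3, by positivity, by linarith [min_le_left ε ε'], by linarith [min_le_right ε ε']⟩
  have hball : ∀ w ∈ Metric.ball z₀ (3 * δ), w ∈ U := fun w hw =>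
    hεU (Metric.ball_subset_ball h1 hw)
  have hfd : ∀ w ∈ Metric.ball z₀ (2 * δ), ‖fderiv ℂ f w‖ ≤ 2 / δ := by
    intro w hw
    have hsub : Metric.ball w δ ⊆ Metric.ball z₀ (3 * δ) :=
      Metric.ball_subset_ball' (by have := Metric.mem_ball.1 hw; linarith)
    refine Complex.norm_fderiv_le_div_of_mapsTo_ball (hf.mono fun y hy => hball y (hsub hy)) ?_ hδ
    intro y hy
    have e1 := hb (lt_of_lt_of_le (Metric.mem_ball.1 (hsub hy)) h2)
    have e2 := hb (lt_of_lt_of_le (Metric.mem_ball.1 (hsub (Metric.mem_ball_self hδ))) h2)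
    rw [Metric.mem_closedBall]
    linarith [dist_triangle_right (f y) (f w) (f z₀)]
  obtain ⟨R, hR, hRa⟩ : ∃ R > 0, R * ‖a‖ < δ := by
    refine ⟨δ / (‖a‖ + 1), by positivity, ?_⟩
    rw [div_mul_eq_mul_div, div_lt_iff₀ (by positivity)]
    nlinarith [norm_nonneg a]
  have hmem : ∀ z ∈ Metric.ball z₀ δ, ∀ ζ : ℂ, ‖ζ‖ ≤ R → z + ζ • a ∈ Metric.ball z₀ (2 * δ) := by
    intro z hz ζ hζ
    rw [Metric.mem_ball, dist_eq_norm] at hz ⊢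
    calc ‖z + ζ • a - z₀‖ = ‖(z - z₀) + ζ • a‖ := by congr 1; abel
      _ ≤ ‖z - z₀‖ + ‖ζ‖ * ‖a‖ := (norm_add_le _ _).trans (by rw [norm_smul])
      _ < 2 * δ := by nlinarith [norm_nonneg a, mul_le_mul_of_nonneg_right hζ (norm_nonneg a)]
  have hcm : ∀ θ, ‖circleMap 0 R θ‖ ≤ R := fun θ => by simp [abs_of_pos hR]
  have hne : ∀ θ, circleMap 0 R θ ≠ 0 := fun θ => circleMap_ne_center hR.ne'
  have hsub2 : Metric.ball z₀ (2 * δ) ⊆ Metric.ball z₀ (3 * δ) :=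
    Metric.ball_subset_ball (by linarith)
  -- Cauchy's formula for the derivative at `0` of `ζ ↦ f (z + ζ a)`
  have hcauchy : ∀ z ∈ Metric.ball z₀ δ, fderiv ℂ f z a = (2 * Real.pi * Complex.I)⁻¹ •
      ∫ θ in (0 : ℝ)..(2 * Real.pi), deriv (circleMap 0 R) θ •
        ((circleMap 0 R θ - 0) ^ 2)⁻¹ • f (z + circleMap 0 R θ • a) := by
    intro z hz
    have hz' : DifferentiableAt ℂ f z := hf.differentiableAt (hU.mem_nhds (hball z
      (Metric.ball_subset_ball (by linarith) hz)))
    have hd : HasDerivAt (fun ζ : ℂ => f (z + ζ • a)) (fderiv ℂ f z a) 0 := by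
      have h3 : HasDerivAt (fun ζ : ℂ => z + ζ • a) a 0 := by
        simpa using ((hasDerivAt_id (0 : ℂ)).smul_const a).const_add z
      have h4 : HasFDerivAt f (fderiv ℂ f z) (z + (0 : ℂ) • a) := by
        simpa using hz'.hasFDerivAt
      exact h4.comp_hasDerivAt 0 h3
    have hO : IsOpen ((fun ζ : ℂ => z + ζ • a) ⁻¹' U) := hU.preimage (by fun_prop)
    have := Complex.two_pi_I_inv_smul_circleIntegral_sub_sq_inv_smul_of_differentiable (R := R)
      (c := 0) (w₀ := 0) (f := fun ζ : ℂ => f (z + ζ • a)) hO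
      (fun ζ hζ => hball _ (hsub2 (hmem z hz ζ (by simpa using hζ))))
      (hf.comp (by fun_prop) fun ζ hζ => hζ) (Metric.mem_ball_self hR)
    rw [← hd.deriv, ← this]
    rfl
  have hev : (fun z => fderiv ℂ f z a) =ᶠ[𝓝 z₀] fun z => (2 * Real.pi * Complex.I)⁻¹ •
      ∫ θ in (0 : ℝ)..(2 * Real.pi), deriv (circleMap 0 R) θ •
        ((circleMap 0 R θ - 0) ^ 2)⁻¹ • f (z + circleMap 0 R θ • a) := by
    filter_upwards [Metric.ball_mem_nhds z₀ hδ] with z hz using hcauchy z hz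
  refine DifferentiableAt.congr_of_eventuallyEq ?_ hev
  apply DifferentiableAt.fun_const_smul
  have hpt : ∀ z ∈ Metric.ball z₀ δ, ∀ θ, DifferentiableAt ℂ f (z + circleMap 0 R θ • a) :=
    fun z hz θ => hf.differentiableAt (hU.mem_nhds (hball _ (hsub2 (hmem z hz _ (hcm θ)))))
  have hcont : ∀ z ∈ Metric.ball z₀ δ, Continuous fun θ => deriv (circleMap 0 R) θ •
        ((circleMap 0 R θ - 0) ^ 2)⁻¹ • f (z + circleMap 0 R θ • a) := by
    intro z hz
    have h5 : Continuous fun θ => f (z + circleMap 0 R θ • a) := by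
      rw [continuous_iff_continuousAt]
      intro θ
      exact ContinuousAt.comp (f := fun θ => z + circleMap 0 R θ • a) (hpt z hz θ).continuousAt
        (by fun_prop)
    simp only [deriv_circleMap, sub_zero]
    have h6 : Continuous fun θ => circleMap 0 R θ * Complex.I := by fun_prop
    refine Continuous.fun_smul h6 (Continuous.fun_smul ?_ h5)
    exact Continuous.inv₀ (by fun_prop) fun θ => pow_ne_zero 2 (hne θ)
  refine (intervalIntegral.hasFDerivAt_integral_of_dominated_of_fderiv_le (𝕜 := ℂ)
    (s := Metric.ball z₀ δ) (bound := fun _ => R * ((R ^ 2)⁻¹ * (2 / δ)))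
    (F' := fun z θ => deriv (circleMap 0 R) θ • ((circleMap 0 R θ - 0) ^ 2)⁻¹ •
      fderiv ℂ f (z + circleMap 0 R θ • a)) (Metric.ball_mem_nhds z₀ hδ) ?_ ?_ ?_ ?_ ?_
      ?_).differentiableAt
  · filter_upwards [Metric.ball_mem_nhds z₀ hδ] with z hz
    exact (hcont z hz).aestronglyMeasurable
  · exact (hcont z₀ (Metric.mem_ball_self hδ)).intervalIntegrable _ _
  · have hm : Measurable fun θ => fderiv ℂ f (z₀ + circleMap 0 R θ • a) :=
      (measurable_fderiv ℂ f).comp (by fun_prop : Continuous fun θ =>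
        z₀ + circleMap 0 R θ • a).measurable
    have h6 : Continuous fun θ => deriv (circleMap 0 R) θ := by
      simp only [deriv_circleMap]; fun_prop
    have h7 : Continuous fun θ => ((circleMap 0 R θ - 0) ^ 2)⁻¹ := by
      simp only [sub_zero]
      exact Continuous.inv₀ (by fun_prop) fun θ => pow_ne_zero 2 (hne θ)
    exact (h6.aestronglyMeasurable).smul
      (h7.aestronglyMeasurable.smul hm.stronglyMeasurable.aestronglyMeasurable)
  · refine Filter.Eventually.of_forall fun θ _ z hz => ?_
    rw [norm_smul, norm_smul]
    have e1 : ‖deriv (circleMap 0 R) θ‖ = R := by simp [abs_of_pos hR]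
    have e2 : ‖((circleMap 0 R θ - 0) ^ 2)⁻¹‖ = (R ^ 2)⁻¹ := by simp
    rw [e1, e2]
    have := hfd _ (hmem z hz _ (hcm θ))
    gcongr
  · exact intervalIntegrable_const
  · refine Filter.Eventually.of_forall fun θ _ z hz => ?_
    have h8 : HasFDerivAt (fun z => f (z + circleMap 0 R θ • a))
        (fderiv ℂ f (z + circleMap 0 R θ • a)) z := by
      have h9 := (hpt z hz θ).hasFDerivAt.comp z ((hasFDerivAt_id z).add_const _)
      exact h9
    exact (h8.fun_const_smul _).fun_const_smul _

/-- Holomorphic functions of several variables are smooth. -/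
theorem contDiffOn_of_differentiableOn_complex {n : ℕ} {U : Set (Cn n)} (hU : IsOpen U)
    {f : Cn n → ℂ} (hf : DifferentiableOn ℂ f U) : ContDiffOn ℂ ∞ f U := by
  rw [contDiffOn_infty]
  intro k
  induction k generalizing f with
  | zero => exact contDiffOn_zero.2 hf.continuousOn
  | succ k ih =>
    push_cast
    rw [contDiffOn_succ_iff_fderiv_of_isOpen hU]
    refine ⟨hf, fun h => absurd h (by simp), ?_⟩
    rw [contDiffOn_clm_apply]
    exact fun a => ih (differentiableOn_fderiv_apply hU hf a)

end SeveralVariables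

/-! ### The Hitchin–Simpson curvature in a holomorphic frame -/

section HiggsCurvature

variable {n : ℕ} {𝔸 : Type*} [NormedRing 𝔸] [NormedAlgebra ℂ 𝔸]
  [StarRing 𝔸] [ContinuousStar 𝔸] [StarModule ℂ 𝔸]

/-- The coefficient `F_{ab̄} + [φ_a, φ^*_b̄]` of the `(1,1)`-part of the Hitchin–Simpson curvature,
for a metric with matrix `H`, inverse matrix `B`, and a Higgs field `Φ`. -/
def higgsCurv (H B : Cn n → 𝔸) (Φ : Cn n → Cn n → 𝔸) (a b z : Cn n) : 𝔸 :=
  -(delbar (fun z' => B z' * del H a z') b z)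
    + (Φ z a * (B z * star (Φ z b) * H z) - B z * star (Φ z b) * H z * Φ z a)

/-- The derivative `∂_a V + [H⁻¹ ∂_a H, V]`, the `(1,0)`-part of the Chern connection on
endomorphisms. -/
def covDel (H B V : Cn n → 𝔸) (a z : Cn n) : 𝔸 :=
  del V a z + (B z * del H a z * V z - V z * (B z * del H a z))

/-- The first variation of `higgsCurv` when the metric `H` varies with velocity `H V`. -/
def higgsCurvVar (H B : Cn n → 𝔸) (Φ : Cn n → Cn n → 𝔸) (V : Cn n → 𝔸) (a b z : Cn n) : 𝔸 :=
  -(delbar (covDel H B V a) b z)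
    + (Φ z a * (B z * star (Φ z b) * H z * V z - V z * (B z * star (Φ z b) * H z))
      - (B z * star (Φ z b) * H z * V z - V z * (B z * star (Φ z b) * H z)) * Φ z a)

/-- Local data of a Hermitian Higgs bundle in a holomorphic frame over `U`: the metric `H`, its
inverse `B`, and the Higgs field `Φ`. -/
structure FrameData (U : Set (Cn n)) (H B : Cn n → 𝔸) (Φ : Cn n → Cn n → 𝔸) : Prop where
  isOpen : IsOpen U
  smooth_H : ContDiffOn ℝ ∞ H U
  smooth_B : ContDiffOn ℝ ∞ B U
  mul_inv : ∀ z ∈ U, H z * B z = 1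
  inv_mul : ∀ z ∈ U, B z * H z = 1
  star_H : ∀ z ∈ U, star (H z) = H z
  holo : ∀ a, ContDiffOn ℂ ∞ (fun z => Φ z a) U
  map_add : ∀ z a b, Φ z (a + b) = Φ z a + Φ z b
  map_smul : ∀ z (c : ℂ) a, Φ z (c • a) = c • Φ z a

theorem contDiffOn_star {f : Cn n → 𝔸} {U : Set (Cn n)} (hf : ContDiffOn ℝ ∞ f U) :
    ContDiffOn ℝ ∞ (fun z => star (f z)) U :=
  ((starL' ℝ : 𝔸 ≃L[ℝ] 𝔸) : 𝔸 →L[ℝ] 𝔸).contDiff.comp_contDiffOn hf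

namespace FrameData

variable {U : Set (Cn n)} {H B : Cn n → 𝔸} {Φ : Cn n → Cn n → 𝔸}

theorem dH (D : FrameData U H B Φ) {z : Cn n} (hz : z ∈ U) : DifferentiableAt ℝ H z :=
  ContDiffOn.diffAt D.smooth_H D.isOpen hz

theorem dB (D : FrameData U H B Φ) {z : Cn n} (hz : z ∈ U) : DifferentiableAt ℝ B z :=
  ContDiffOn.diffAt D.smooth_B D.isOpen hz

theorem cdPhi (D : FrameData U H B Φ) {z : Cn n} (hz : z ∈ U) {a : Cn n} :
    DifferentiableAt ℂ (fun z => Φ z a) z :=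
  ((D.holo a).contDiffAt (D.isOpen.mem_nhds hz)).differentiableAt (by simp)

theorem dPhi (D : FrameData U H B Φ) {z : Cn n} (hz : z ∈ U) (a : Cn n) :
    DifferentiableAt ℝ (fun z => Φ z a) z :=
  ContDiffOn.diffAt ((D.holo a).restrict_scalars ℝ) D.isOpen hz

theorem smooth_delH (D : FrameData U H B Φ) (a : Cn n) : ContDiffOn ℝ ∞ (del H a) U :=
  ContDiffOn.del D.smooth_H D.isOpen a

theorem smooth_A (D : FrameData U H B Φ) (a : Cn n) :
    ContDiffOn ℝ ∞ (fun z => B z * del H a z) U :=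
  D.smooth_B.mul (D.smooth_delH a)

theorem smooth_adj (D : FrameData U H B Φ) (a : Cn n) :
    ContDiffOn ℝ ∞ (fun z => B z * star (Φ z a) * H z) U :=
  (D.smooth_B.mul (contDiffOn_star ((D.holo a).restrict_scalars ℝ))).mul D.smooth_H

theorem smooth_covDel (D : FrameData U H B Φ) {V : Cn n → 𝔸} (hV : ContDiffOn ℝ ∞ V U) (a : Cn n) :
    ContDiffOn ℝ ∞ (covDel H B V a) U :=
  (ContDiffOn.del hV D.isOpen a).add (((D.smooth_A a).mul hV).sub (hV.mul (D.smooth_A a)))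

theorem smooth_higgsCurv (D : FrameData U H B Φ) (a b : Cn n) :
    ContDiffOn ℝ ∞ (higgsCurv H B Φ a b) U :=
  (ContDiffOn.delbar (D.smooth_A a) D.isOpen b).neg.add
    ((((D.holo a).restrict_scalars ℝ).mul (D.smooth_adj b)).sub
      ((D.smooth_adj b).mul ((D.holo a).restrict_scalars ℝ)))

theorem star_B (D : FrameData U H B Φ) {z : Cn n} (hz : z ∈ U) : star (B z) = B z := by
  have h1 : star (B z) * H z = 1 := by
    rw [← D.star_H z hz, ← star_mul, D.mul_inv z hz, star_one]
  calc star (B z) = star (B z) * (H z * B z) := by rw [D.mul_inv z hz, mul_one]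
    _ = B z := by rw [← mul_assoc, h1, one_mul]

theorem HBx (D : FrameData U H B Φ) {z : Cn n} (hz : z ∈ U) (x : 𝔸) : H z * (B z * x) = x := by
  rw [← mul_assoc, D.mul_inv z hz, one_mul]

theorem BHx (D : FrameData U H B Φ) {z : Cn n} (hz : z ∈ U) (x : 𝔸) : B z * (H z * x) = x := by
  rw [← mul_assoc, D.inv_mul z hz, one_mul]

theorem del_B (D : FrameData U H B Φ) {z : Cn n} (hz : z ∈ U) (a : Cn n) :
    del B a z = -(B z * del H a z * B z) := by
  have h1 : del (fun z' => B z' * H z') a z = 0 := by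
    rw [del_congr (g := fun _ => (1 : 𝔸))]
    · simp [del]
    · filter_upwards [D.isOpen.mem_nhds hz] with z' hz' using D.inv_mul z' hz'
  rw [del_mul (D.dB hz) (D.dH hz)] at h1
  have h2 := congrArg (· * B z) h1
  simp only [add_mul, mul_assoc, D.mul_inv z hz, mul_one, zero_mul] at h2
  rw [mul_assoc]
  exact eq_neg_of_add_eq_zero_left h2

theorem delbar_B (D : FrameData U H B Φ) {z : Cn n} (hz : z ∈ U) (a : Cn n) :
    delbar B a z = -(B z * delbar H a z * B z) := by
  have h1 : delbar (fun z' => B z' * H z') a z = 0 := by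
    rw [delbar_congr (g := fun _ => (1 : 𝔸))]
    · simp [delbar]
    · filter_upwards [D.isOpen.mem_nhds hz] with z' hz' using D.inv_mul z' hz'
  rw [delbar_mul (D.dB hz) (D.dH hz)] at h1
  have h2 := congrArg (· * B z) h1
  simp only [add_mul, mul_assoc, D.mul_inv z hz, mul_one, zero_mul] at h2
  rw [mul_assoc]
  exact eq_neg_of_add_eq_zero_left h2

theorem star_del_H (D : FrameData U H B Φ) {z : Cn n} (hz : z ∈ U) (a : Cn n) :
    star (del H a z) = delbar H a z := by
  rw [← delbar_star]
  refine delbar_congr ?_ a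
  filter_upwards [D.isOpen.mem_nhds hz] with z' hz' using D.star_H z' hz'

/-- The adjoint `φ^*` is `D'`-closed, since `φ` is holomorphic. -/
theorem del_adj (D : FrameData U H B Φ) {z : Cn n} (hz : z ∈ U) (a b : Cn n) :
    del (fun z' => B z' * star (Φ z' b) * H z') a z
      = B z * star (Φ z b) * H z * (B z * del H a z)
        - B z * del H a z * (B z * star (Φ z b) * H z) := by
  have h1 : DifferentiableAt ℝ (fun z' => star (Φ z' b)) z :=
    ContDiffOn.diffAt (contDiffOn_star ((D.holo b).restrict_scalars ℝ)) D.isOpen hz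
  rw [del_mul ((D.dB hz).fun_mul h1) (D.dH hz), del_mul (D.dB hz) h1, D.del_B hz, del_star,
    delbar_of_holomorphic (D.cdPhi hz)]
  simp only [mul_assoc, D.HBx hz, star_zero, mul_zero, add_zero, neg_mul]
  abel

theorem map_smul_star (D : FrameData U H B Φ) (z : Cn n) (c : ℂ) (a : Cn n) :
    B z * star (Φ z (c • a)) * H z = conj c • (B z * star (Φ z a) * H z) := by
  rw [D.map_smul, star_smul, mul_smul_comm, smul_mul_assoc]; rfl

/-- The `(1,1)`-coefficients of `dΘ + Θ ∧ Θ`, for `Θ` the Hitchin–Simpson connection form. -/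
theorem coeff_curvature (D : FrameData U H B Φ) {z : Cn n} (hz : z ∈ U) {Θ : Cn n → Cn n → 𝔸}
    (hΘ : Θ = fun u z => B z * del H u z + Φ z u + B z * star (Φ z u) * H z)
    {ψ : Cn n → Cn n → 𝔸} (hψ : ψ = fun u v => fderiv ℝ (Θ v) z u - fderiv ℝ (Θ u) z v
      + (Θ u z * Θ v z - Θ v z * Θ u z)) (a b : Cn n) :
    (1 / 4 : ℂ) • (ψ a b + Complex.I • ψ a (Complex.I • b) - Complex.I • ψ (Complex.I • a) b
      + ψ (Complex.I • a) (Complex.I • b)) = higgsCurv H B Φ a b z := by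
  let S : Cn n → Cn n → 𝔸 := fun u z => B z * del H u z + Φ z u
  let T : Cn n → Cn n → 𝔸 := fun u z => B z * star (Φ z u) * H z
  have hS : ∀ u, DifferentiableAt ℝ (S u) z := fun u =>
    (ContDiffOn.diffAt (D.smooth_A u) D.isOpen hz).fun_add (D.dPhi hz u)
  have hT : ∀ u, DifferentiableAt ℝ (T u) z := fun u =>
    ContDiffOn.diffAt (D.smooth_adj u) D.isOpen hz
  have hSI : ∀ u, S (Complex.I • u) = fun z => Complex.I • S u z := fun u => by
    funext z'; simp only [S, del_smul_right, D.map_smul, mul_smul_comm, smul_add]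
  have hTI : ∀ u, T (Complex.I • u) = fun z => (-Complex.I) • T u z := fun u => by
    funext z'; simp only [T, D.map_smul_star]; simp
  have hΘ' : ∀ u, Θ u = fun z' => S u z' + T u z' := fun u => by rw [hΘ]
  have hd : ∀ u v, fderiv ℝ (Θ u) z v = fderiv ℝ (S u) z v + fderiv ℝ (T u) z v := fun u v => by
    rw [hΘ', fderiv_fun_add (hS u) (hT u)]; rfl
  have hdS : ∀ u v, fderiv ℝ (S (Complex.I • u)) z v = Complex.I • fderiv ℝ (S u) z v :=
    fun u v => by rw [hSI, fderiv_fun_smul_complex (hS u)]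
  have hdT : ∀ u v, fderiv ℝ (T (Complex.I • u)) z v = (-Complex.I) • fderiv ℝ (T u) z v :=
    fun u v => by rw [hTI, fderiv_fun_smul_complex (hT u)]
  have key : (1 / 4 : ℂ) • (ψ a b + Complex.I • ψ a (Complex.I • b)
      - Complex.I • ψ (Complex.I • a) b + ψ (Complex.I • a) (Complex.I • b))
      = del (T b) a z - delbar (S a) b z + (S a z * T b z - T b z * S a z) := by
    simp only [hψ, hd, hdS, hdT, del, delbar]
    simp only [hΘ', hSI, hTI, mul_add, add_mul, smul_mul_assoc, mul_smul_comm, smul_smul,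
      smul_add, smul_sub, mul_neg, neg_mul, Complex.I_mul_I, neg_smul, smul_neg, one_smul,
      neg_neg]
    module
  rw [key, D.del_adj hz, delbar_add (ContDiffOn.diffAt (D.smooth_A a) D.isOpen hz) (D.dPhi hz a),
    delbar_of_holomorphic (D.cdPhi hz), higgsCurv]
  simp only [S, T]
  noncomm_ring

/-- The curvature coefficients are Hermitian: the adjoint of `R_{ab̄}` is `R_{bā}`. -/
theorem higgsCurv_adj (D : FrameData U H B Φ) {z : Cn n} (hz : z ∈ U) (a b : Cn n) :
    B z * star (higgsCurv H B Φ a b z) * H z = higgsCurv H B Φ b a z := by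
  have h2 : star (delbar (del H a) b z) = delbar (del H b) a z := by
    rw [del_delbar_comm D.isOpen D.smooth_H hz b a, ← del_star]
    refine del_congr ?_ b
    filter_upwards [D.isOpen.mem_nhds hz] with z' hz' using D.star_del_H hz' a
  have e : ∀ a b, delbar (fun z' => B z' * del H a z') b z
      = -(B z * delbar H b z * B z) * del H a z + B z * delbar (del H a) b z := fun a b => by
    rw [delbar_mul (D.dB hz) (ContDiffOn.diffAt (D.smooth_delH a) D.isOpen hz), D.delbar_B hz]
  have hstar : ∀ a, star (delbar H a z) = del H a z := fun a => by
    rw [← D.star_del_H hz, star_star]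
  simp only [higgsCurv, e, star_add, star_sub, star_neg, star_mul, star_star, D.star_B hz,
    D.star_H z hz, h2, D.star_del_H hz, hstar, mul_add, add_mul, mul_sub, sub_mul, neg_mul,
    mul_neg, mul_assoc, D.BHx hz, D.inv_mul z hz, mul_one]

theorem B_transform {m : ℕ} {U' : Set (Cn m)} {H' B' : Cn m → 𝔸} {Φ' : Cn m → Cn m → 𝔸}
    (D : FrameData U H B Φ) (D' : FrameData U' H' B' Φ') {z : Cn n} {w : Cn m} (hz : z ∈ U)
    (hw : w ∈ U') {p q : 𝔸} (hpq : p * q = 1) (hqp : q * p = 1)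
    (hH : H z = star p * H' w * p) : B z = q * B' w * star q := by
  have h1 : H z * (q * B' w * star q) = 1 := by
    rw [hH]
    have h3 : star p * star q = 1 := by rw [← star_mul, hqp, star_one]
    calc star p * H' w * p * (q * B' w * star q)
        = star p * (H' w * ((p * q) * B' w)) * star q := by noncomm_ring
      _ = 1 := by rw [hpq, one_mul, D'.mul_inv _ hw, mul_one, h3]
  calc B z = B z * (H z * (q * B' w * star q)) := by rw [h1, mul_one]
    _ = _ := D.BHx hz _

/-- Transformation of the Chern connection form under a holomorphic change of frame `P` and of
coordinates `τ`. -/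
theorem chern_transform {m : ℕ} {U' : Set (Cn m)} {H' B' : Cn m → 𝔸} {Φ' : Cn m → Cn m → 𝔸}
    (D : FrameData U H B Φ) (D' : FrameData U' H' B' Φ') {W : Set (Cn n)} (hW : IsOpen W)
    (hWU : W ⊆ U) {τ : Cn n → Cn m} (hτ : ContDiffOn ℂ ∞ τ W) (hτU : MapsTo τ W U')
    {P Q : Cn n → 𝔸} (hP : ContDiffOn ℂ ∞ P W)
    (hPQ : ∀ z ∈ W, P z * Q z = 1) (hQP : ∀ z ∈ W, Q z * P z = 1)
    (hH : ∀ z ∈ W, H z = star (P z) * H' (τ z) * P z) {z : Cn n} (hz : z ∈ W) (a : Cn n) :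
    B z * del H a z = Q z * (B' (τ z) * del H' (fderiv ℂ τ z a) (τ z)) * P z
      + Q z * del P a z := by
  have dτ : DifferentiableAt ℂ τ z :=
    (hτ.contDiffAt (hW.mem_nhds hz)).differentiableAt (by simp)
  have dP : DifferentiableAt ℂ P z :=
    (hP.contDiffAt (hW.mem_nhds hz)).differentiableAt (by simp)
  have dH' : DifferentiableAt ℝ (fun z => H' (τ z)) z :=
    (D'.dH (hτU hz)).comp z (dτ.restrictScalars ℝ)
  have dPs : DifferentiableAt ℝ (fun z => star (P z)) z :=
    ContDiffOn.diffAt (contDiffOn_star (hP.restrict_scalars ℝ)) hW hz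
  have h1 : del H a z = star (P z) * del H' (fderiv ℂ τ z a) (τ z) * P z
      + star (P z) * H' (τ z) * del P a z := by
    rw [del_congr (g := fun z => star (P z) * H' (τ z) * P z)
      (by filter_upwards [hW.mem_nhds hz] with z' hz' using hH z' hz'),
      del_mul (dPs.fun_mul dH') (dP.restrictScalars ℝ), del_mul dPs dH',
      del_comp (D'.dH (hτU hz)) dτ, del_star, delbar_of_holomorphic dP]
    simp
  have h3 : star (Q z) * star (P z) = 1 := by rw [← star_mul, hPQ z hz, star_one]
  have h4 : ∀ x, star (Q z) * (star (P z) * x) = x := fun x => by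
    rw [← mul_assoc, h3, one_mul]
  rw [h1, D.B_transform D' (hWU hz) (hτU hz) (hPQ z hz) (hQP z hz) (hH z hz)]
  simp only [mul_add, mul_assoc, h4, D'.BHx (hτU hz)]

/-- The curvature is tensorial under a holomorphic change of frame `P` and of coordinates `τ`, since
the inhomogeneous term of the Chern connection form is holomorphic. -/
theorem higgsCurv_transform {m : ℕ} {U' : Set (Cn m)} {H' B' : Cn m → 𝔸} {Φ' : Cn m → Cn m → 𝔸}
    (D : FrameData U H B Φ) (D' : FrameData U' H' B' Φ') {W : Set (Cn n)} (hW : IsOpen W)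
    (hWU : W ⊆ U) {τ : Cn n → Cn m} (hτ : ContDiffOn ℂ ∞ τ W) (hτU : MapsTo τ W U')
    {P Q : Cn n → 𝔸} (hP : ContDiffOn ℂ ∞ P W) (hQ : ContDiffOn ℂ ∞ Q W)
    (hPQ : ∀ z ∈ W, P z * Q z = 1) (hQP : ∀ z ∈ W, Q z * P z = 1)
    (hH : ∀ z ∈ W, H z = star (P z) * H' (τ z) * P z)
    (hΦ : ∀ z ∈ W, ∀ a, Φ z a = Q z * Φ' (τ z) (fderiv ℂ τ z a) * P z)
    {z : Cn n} (hz : z ∈ W) (a b : Cn n) :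
    higgsCurv H B Φ a b z
      = Q z * higgsCurv H' B' Φ' (fderiv ℂ τ z a) (fderiv ℂ τ z b) (τ z) * P z := by
  have hB : ∀ z ∈ W, B z = Q z * B' (τ z) * star (Q z) := fun z hz =>
    D.B_transform D' (hWU hz) (hτU hz) (hPQ z hz) (hQP z hz) (hH z hz)
  have dτ : ∀ z ∈ W, DifferentiableAt ℂ τ z := fun z hz =>
    (hτ.contDiffAt (hW.mem_nhds hz)).differentiableAt (by simp)
  have dP : ∀ z ∈ W, DifferentiableAt ℂ P z := fun z hz =>
    (hP.contDiffAt (hW.mem_nhds hz)).differentiableAt (by simp)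
  have dPr : ∀ z ∈ W, DifferentiableAt ℝ P z := fun z hz => (dP z hz).restrictScalars ℝ
  have dQ : ∀ z ∈ W, DifferentiableAt ℂ Q z := fun z hz =>
    (hQ.contDiffAt (hW.mem_nhds hz)).differentiableAt (by simp)
  have hA : ∀ z ∈ W, B z * del H a z = Q z *
      (∑ γ, fderiv ℂ τ z a γ • (B' (τ z) * del H' (Pi.single γ 1) (τ z))) * P z
        + Q z * del P a z := by
    intro z hz
    rw [D.chern_transform D' hW hWU hτ hτU hP hPQ hQP hH hz]
    simp only [← mul_smul_comm]
    rw [← Finset.mul_sum, ← del_eq_sum]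
  have hdP : DifferentiableAt ℂ (fun z => Q z * del P a z) z := by
    have h1 : ContDiffOn ℂ ∞ (fun z => fderiv ℂ P z a) W :=
      (hP.fderiv_of_isOpen hW (m := ∞) (by exact le_rfl)).clm_apply contDiffOn_const
    have h2 : DifferentiableAt ℂ (fun z => fderiv ℂ P z a) z :=
      (h1.contDiffAt (hW.mem_nhds hz)).differentiableAt (by simp)
    refine (dQ z hz).fun_mul (h2.congr_of_eventuallyEq ?_)
    filter_upwards [hW.mem_nhds hz] with z' hz' using del_of_holomorphic (dP z' hz') a
  have dA' : ∀ γ, DifferentiableAt ℝ (fun w => B' w * del H' (Pi.single γ 1) w) (τ z) := fun γ =>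
    ContDiffOn.diffAt (D'.smooth_A _) D'.isOpen (hτU hz)
  have dA'τ : ∀ γ, DifferentiableAt ℝ
      (fun z => B' (τ z) * del H' (Pi.single γ 1) (τ z)) z := fun γ =>
    (dA' γ).comp (f := τ) z ((dτ z hz).restrictScalars ℝ)
  have dc : ∀ γ, DifferentiableAt ℂ (fun z => fderiv ℂ τ z a γ) z := fun γ => by
    have h1 : ContDiffOn ℂ ∞ (fun z => fderiv ℂ τ z a) W :=
      (hτ.fderiv_of_isOpen hW (m := ∞) (by exact le_rfl)).clm_apply contDiffOn_const
    exact differentiableAt_pi.1 ((h1.contDiffAt (hW.mem_nhds hz)).differentiableAt (by simp)) γ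
  have dcA : ∀ γ, DifferentiableAt ℝ (fun z => fderiv ℂ τ z a γ •
      (B' (τ z) * del H' (Pi.single γ 1) (τ z))) z := fun γ =>
    ((dc γ).restrictScalars ℝ).fun_smul (dA'τ γ)
  have dsum : DifferentiableAt ℝ (fun z => ∑ γ, fderiv ℂ τ z a γ •
      (B' (τ z) * del H' (Pi.single γ 1) (τ z))) z :=
    DifferentiableAt.fun_sum fun γ _ => dcA γ
  have hcurv : delbar (fun z => B z * del H a z) b z = Q z *
      delbar (fun w => B' w * del H' (fderiv ℂ τ z a) w) (fderiv ℂ τ z b) (τ z) * P z := by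
    rw [delbar_congr (g := fun z => Q z *
      (∑ γ, fderiv ℂ τ z a γ • (B' (τ z) * del H' (Pi.single γ 1) (τ z))) * P z
        + Q z * del P a z) (by filter_upwards [hW.mem_nhds hz] with z' hz' using hA z' hz')]
    have dQr := (dQ z hz).restrictScalars ℝ
    rw [delbar_add ((dQr.fun_mul dsum).fun_mul (dPr z hz)) (hdP.restrictScalars ℝ),
      delbar_of_holomorphic hdP, delbar_mul (dQr.fun_mul dsum) (dPr z hz),
      delbar_of_holomorphic (dP z hz), delbar_mul dQr dsum, delbar_of_holomorphic (dQ z hz),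
      delbar_sum _ (fun γ _ => dcA γ)]
    have h5 : ∀ γ, delbar (fun z => fderiv ℂ τ z a γ •
        (B' (τ z) * del H' (Pi.single γ 1) (τ z))) b z = fderiv ℂ τ z a γ •
        delbar (fun w => B' w * del H' (Pi.single γ 1) w) (fderiv ℂ τ z b) (τ z) := fun γ => by
      rw [delbar_smul ((dc γ).restrictScalars ℝ) (dA'τ γ), delbar_of_holomorphic (dc γ),
        delbar_comp (f := fun w => B' w * del H' (Pi.single γ 1) w) (dA' γ) (dτ z hz)]
      simp
    have h6 : delbar (fun w => B' w * del H' (fderiv ℂ τ z a) w) (fderiv ℂ τ z b) (τ z)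
        = ∑ γ, fderiv ℂ τ z a γ •
        delbar (fun w => B' w * del H' (Pi.single γ 1) w) (fderiv ℂ τ z b) (τ z) := by
      have h7 : (fun w => B' w * del H' (fderiv ℂ τ z a) w)
          = fun w => ∑ γ, fderiv ℂ τ z a γ • (B' w * del H' (Pi.single γ 1) w) := by
        funext w
        simp only [← mul_smul_comm]
        rw [← Finset.mul_sum, ← del_eq_sum]
      rw [h7, delbar_sum _ (fun γ _ => (dA' γ).fun_const_smul (fderiv ℂ τ z a γ))]
      refine Finset.sum_congr rfl fun γ _ => ?_
      rw [delbar_smul (differentiableAt_const _) (dA' γ)]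
      simp [delbar]
    simp only [h5, ← h6]
    simp
  have hadj : B z * star (Φ z b) * H z
      = Q z * (B' (τ z) * star (Φ' (τ z) (fderiv ℂ τ z b)) * H' (τ z)) * P z := by
    rw [hB z hz, hΦ z hz, hH z hz]
    have h3 : star (Q z) * star (P z) = 1 := by rw [← star_mul, hPQ z hz, star_one]
    have h4 : ∀ x, star (Q z) * (star (P z) * x) = x := fun x => by
      rw [← mul_assoc, h3, one_mul]
    simp only [star_mul, mul_assoc, h4]
  rw [higgsCurv, higgsCurv, hcurv, hadj, hΦ z hz a]
  have h4 : ∀ x, P z * (Q z * x) = x := fun x => by rw [← mul_assoc, hPQ z hz, one_mul]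
  simp only [mul_add, add_mul, mul_sub, sub_mul, mul_neg, neg_mul, mul_assoc, h4]

/-- The covariant derivative `D'` of endomorphisms is tensorial. -/
theorem covDel_transform {m : ℕ} {U' : Set (Cn m)} {H' B' : Cn m → 𝔸} {Φ' : Cn m → Cn m → 𝔸}
    (D : FrameData U H B Φ) (D' : FrameData U' H' B' Φ') {W : Set (Cn n)} (hW : IsOpen W)
    (hWU : W ⊆ U) {τ : Cn n → Cn m} (hτ : ContDiffOn ℂ ∞ τ W) (hτU : MapsTo τ W U')
    {P Q : Cn n → 𝔸} (hP : ContDiffOn ℂ ∞ P W) (hQ : ContDiffOn ℂ ∞ Q W)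
    (hPQ : ∀ z ∈ W, P z * Q z = 1) (hQP : ∀ z ∈ W, Q z * P z = 1)
    (hH : ∀ z ∈ W, H z = star (P z) * H' (τ z) * P z) {K : Cn n → 𝔸} {K' : Cn m → 𝔸}
    (hK' : ContDiffOn ℝ ∞ K' U') (hK : ∀ z ∈ W, K z = Q z * K' (τ z) * P z)
    {z : Cn n} (hz : z ∈ W) (a : Cn n) :
    covDel H B K a z = Q z * covDel H' B' K' (fderiv ℂ τ z a) (τ z) * P z := by
  have dτ : DifferentiableAt ℂ τ z :=
    (hτ.contDiffAt (hW.mem_nhds hz)).differentiableAt (by simp)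
  have dP : DifferentiableAt ℝ P z := ContDiffOn.diffAt (hP.restrict_scalars ℝ) hW hz
  have dQ : DifferentiableAt ℝ Q z := ContDiffOn.diffAt (hQ.restrict_scalars ℝ) hW hz
  have dK' : DifferentiableAt ℝ (fun z => K' (τ z)) z :=
    (ContDiffOn.diffAt hK' D'.isOpen (hτU hz)).comp z (dτ.restrictScalars ℝ)
  have h4 : ∀ x, P z * (Q z * x) = x := fun x => by rw [← mul_assoc, hPQ z hz, one_mul]
  have hdQ : del Q a z = -(Q z * del P a z * Q z) := by
    have h1 : del (fun z' => Q z' * P z') a z = 0 := by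
      rw [del_congr (g := fun _ => (1 : 𝔸))]
      · simp [del]
      · filter_upwards [hW.mem_nhds hz] with z' hz' using hQP z' hz'
    rw [del_mul dQ dP] at h1
    have h2 := congrArg (· * Q z) h1
    simp only [add_mul, mul_assoc, hPQ z hz, mul_one, zero_mul] at h2
    rw [mul_assoc]
    exact eq_neg_of_add_eq_zero_left h2
  have h1 : del K a z = -(Q z * del P a z * Q z) * K' (τ z) * P z
      + Q z * del K' (fderiv ℂ τ z a) (τ z) * P z + Q z * K' (τ z) * del P a z := by
    rw [del_congr (g := fun z => Q z * K' (τ z) * P z)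
      (by filter_upwards [hW.mem_nhds hz] with z' hz' using hK z' hz'),
      del_mul (dQ.fun_mul dK') dP, del_mul dQ dK', hdQ,
      del_comp (ContDiffOn.diffAt hK' D'.isOpen (hτU hz)) dτ]
    simp only [add_mul, mul_assoc]
  rw [covDel, covDel, h1, D.chern_transform D' hW hWU hτ hτU hP hPQ hQP hH hz, hK z hz]
  simp only [mul_add, add_mul, mul_sub, sub_mul, mul_assoc, h4, neg_mul]
  abel

end FrameData

end HiggsCurvature

/-! ### Functions depending on a parameter -/

section TimeDerivative

variable {n : ℕ} {F : Type*} [NormedAddCommGroup F] [NormedSpace ℝ F] [NormedSpace ℂ F]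
  [IsScalarTower ℝ ℂ F]

/-- The time derivative of a time dependent function. -/
def timeDeriv {E : Type*} [NormedAddCommGroup E] [NormedSpace ℝ E] (f : ℝ × E → F) (p : ℝ × E) :
    F := fderiv ℝ f p (1, 0)

variable {E : Type*} [NormedAddCommGroup E] [NormedSpace ℝ E]

theorem fderiv_slice {f : ℝ × E → F} {p : ℝ × E} (hf : DifferentiableAt ℝ f p) (a : E) :
    fderiv ℝ (fun z => f (p.1, z)) p.2 a = fderiv ℝ f p (0, a) := by
  have h : HasFDerivAt (fun z : E => (p.1, z)) (ContinuousLinearMap.inr ℝ ℝ E) p.2 :=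
    hasFDerivAt_prodMk_right p.1 p.2
  have h2 : HasFDerivAt f (fderiv ℝ f p) (p.1, p.2) := hf.hasFDerivAt
  have h3 := (h2.comp p.2 h).fderiv
  have h4 : fderiv ℝ (fun z => f (p.1, z)) p.2
      = (fderiv ℝ f p).comp (ContinuousLinearMap.inr ℝ ℝ E) := h3
  rw [h4]; rfl

theorem hasDerivAt_slice {f : ℝ × E → F} {p : ℝ × E} (hf : DifferentiableAt ℝ f p) :
    HasDerivAt (fun t => f (t, p.2)) (timeDeriv f p) p.1 := by
  have h : HasFDerivAt (fun t : ℝ => (t, p.2)) (ContinuousLinearMap.inl ℝ ℝ E) p.1 :=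
    hasFDerivAt_prodMk_left p.1 p.2
  have h2 : HasFDerivAt f (fderiv ℝ f p) (p.1, p.2) := hf.hasFDerivAt
  exact (h2.comp p.1 h).hasDerivAt

theorem ContDiffOn.timeDeriv {f : ℝ × E → F} {W : Set (ℝ × E)} (hf : ContDiffOn ℝ ∞ f W)
    (hW : IsOpen W) : ContDiffOn ℝ ∞ (timeDeriv f) W :=
  contDiffOn_fderiv_apply hW hf _

/-- Time and space derivatives commute. -/
theorem timeDeriv_fderiv_comm {f : ℝ × E → F} {W : Set (ℝ × E)} (hf : ContDiffOn ℝ ∞ f W)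
    (hW : IsOpen W) {p : ℝ × E} (hp : p ∈ W) (a : E) :
    HasDerivAt (fun t => fderiv ℝ (fun z => f (t, z)) p.2 a)
      (fderiv ℝ (fun z => timeDeriv f (p.1, z)) p.2 a) p.1 := by
  have h1 : ContDiffOn ℝ ∞ (fun q => fderiv ℝ f q (0, a)) W := contDiffOn_fderiv_apply hW hf _
  have h2 := hasDerivAt_slice (ContDiffOn.diffAt h1 hW hp)
  have h3 : fderiv ℝ (fun z => timeDeriv f (p.1, z)) p.2 a
      = timeDeriv (fun q => fderiv ℝ f q (0, a)) p := by
    rw [fderiv_slice (ContDiffOn.diffAt (ContDiffOn.timeDeriv hf hW) hW hp)]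
    exact fderiv_fderiv_comm hW hf hp _ _
  rw [h3]
  refine h2.congr_of_eventuallyEq ?_
  have h4 : ∀ᶠ t in 𝓝 p.1, (t, p.2) ∈ W :=
    (by fun_prop : Continuous fun t : ℝ => (t, p.2)).continuousAt.eventually_mem (hW.mem_nhds hp)
  filter_upwards [h4] with t ht using fderiv_slice (p := (t, p.2)) (ContDiffOn.diffAt hf hW ht) a

theorem contDiffOn_fderiv_slice {f : ℝ × E → F} {W : Set (ℝ × E)} (hf : ContDiffOn ℝ ∞ f W)
    (hW : IsOpen W) (a : E) :
    ContDiffOn ℝ ∞ (fun p : ℝ × E => fderiv ℝ (fun z => f (p.1, z)) p.2 a) W :=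
  (contDiffOn_fderiv_apply hW hf (0, a)).congr fun _ hp =>
    fderiv_slice (ContDiffOn.diffAt hf hW hp) a

theorem contDiffOn_del_slice {f : ℝ × Cn n → F} {W : Set (ℝ × Cn n)} (hf : ContDiffOn ℝ ∞ f W)
    (hW : IsOpen W) (a : Cn n) :
    ContDiffOn ℝ ∞ (fun p : ℝ × Cn n => del (fun z => f (p.1, z)) a p.2) W :=
  ((contDiffOn_fderiv_slice hf hW a).sub
    ((contDiffOn_fderiv_slice hf hW _).const_smul Complex.I)).const_smul _

theorem contDiffOn_delbar_slice {f : ℝ × Cn n → F} {W : Set (ℝ × Cn n)}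
    (hf : ContDiffOn ℝ ∞ f W) (hW : IsOpen W) (a : Cn n) :
    ContDiffOn ℝ ∞ (fun p : ℝ × Cn n => delbar (fun z => f (p.1, z)) a p.2) W :=
  ((contDiffOn_fderiv_slice hf hW a).add
    ((contDiffOn_fderiv_slice hf hW _).const_smul Complex.I)).const_smul _

theorem hasDerivAt_del {f : ℝ × Cn n → F} {W : Set (ℝ × Cn n)} (hf : ContDiffOn ℝ ∞ f W)
    (hW : IsOpen W) {p : ℝ × Cn n} (hp : p ∈ W) (a : Cn n) :
    HasDerivAt (fun t => del (fun z => f (t, z)) a p.2)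
      (del (fun z => timeDeriv f (p.1, z)) a p.2) p.1 :=
  ((timeDeriv_fderiv_comm hf hW hp a).sub
    ((timeDeriv_fderiv_comm hf hW hp _).const_smul Complex.I)).const_smul _

theorem hasDerivAt_delbar {f : ℝ × Cn n → F} {W : Set (ℝ × Cn n)} (hf : ContDiffOn ℝ ∞ f W)
    (hW : IsOpen W) {p : ℝ × Cn n} (hp : p ∈ W) (a : Cn n) :
    HasDerivAt (fun t => delbar (fun z => f (t, z)) a p.2)
      (delbar (fun z => timeDeriv f (p.1, z)) a p.2) p.1 :=
  ((timeDeriv_fderiv_comm hf hW hp a).add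
    ((timeDeriv_fderiv_comm hf hW hp _).const_smul Complex.I)).const_smul _

end TimeDerivative

/-! ### The first variation of the curvature -/

section Variation

variable {n : ℕ} {𝔸 : Type*} [NormedRing 𝔸] [NormedAlgebra ℂ 𝔸]
  [StarRing 𝔸] [ContinuousStar 𝔸] [StarModule ℂ 𝔸]

/-- Joint smoothness of the curvature coefficients of a smooth family of metrics. -/
theorem contDiffOn_higgsCurv_family {U : Set (Cn n)} {I : Set ℝ} (hI : IsOpen I) (hU : IsOpen U)
    {H B : ℝ × Cn n → 𝔸}
    {Φ : Cn n → Cn n → 𝔸} (hH : ContDiffOn ℝ ∞ H (I ×ˢ U)) (hB : ContDiffOn ℝ ∞ B (I ×ˢ U))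
    (hΦ : ∀ a, ContDiffOn ℝ ∞ (fun z => Φ z a) U) (a b : Cn n) :
    ContDiffOn ℝ ∞ (fun p : ℝ × Cn n => higgsCurv (fun z => H (p.1, z)) (fun z => B (p.1, z)) Φ
      a b p.2) (I ×ˢ U) := by
  have hW := hI.prod hU
  have hΦ' : ∀ a, ContDiffOn ℝ ∞ (fun p : ℝ × Cn n => Φ p.2 a) (I ×ˢ U) := fun a =>
    (hΦ a).comp contDiff_snd.contDiffOn fun p hp => hp.2
  have hs : ContDiffOn ℝ ∞ (fun p : ℝ × Cn n => star (Φ p.2 b)) (I ×ˢ U) :=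
    (contDiffOn_star (hΦ b)).comp contDiff_snd.contDiffOn fun p hp => hp.2
  have hadj := (hB.mul hs).mul hH
  refine ContDiffOn.add (ContDiffOn.neg ?_) (((hΦ' a).mul hadj).sub (hadj.mul (hΦ' a)))
  exact contDiffOn_delbar_slice (f := fun p : ℝ × Cn n =>
    B p * del (fun z => H (p.1, z)) a p.2) (hB.mul (contDiffOn_del_slice hH hW a)) hW b

/-- The first variation of the curvature along a smooth family of metrics with initial velocity
`H V`. -/
theorem hasDerivAt_higgsCurv {U : Set (Cn n)} {I : Set ℝ} (hI : IsOpen I)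
    {H B : ℝ × Cn n → 𝔸}
    {Φ : Cn n → Cn n → 𝔸} (hH : ContDiffOn ℝ ∞ H (I ×ˢ U)) (hB : ContDiffOn ℝ ∞ B (I ×ˢ U))
    (D : ∀ t ∈ I, FrameData U (fun z => H (t, z)) (fun z => B (t, z)) Φ)
    {t : ℝ} (ht : t ∈ I) {z : Cn n} (hz : z ∈ U) (a b : Cn n) :
    HasDerivAt (fun s => higgsCurv (fun z => H (s, z)) (fun z => B (s, z)) Φ a b z)
      (higgsCurvVar (fun z => H (t, z)) (fun z => B (t, z)) Φ
        (fun z => B (t, z) * timeDeriv H (t, z)) a b z) t := by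
  have hU : IsOpen U := (D t ht).isOpen
  have hW := hI.prod hU
  have hd : ∀ {f : ℝ × Cn n → 𝔸}, ContDiffOn ℝ ∞ f (I ×ˢ U) → ∀ z ∈ U,
      HasDerivAt (fun s => f (s, z)) (timeDeriv f (t, z)) t := fun hf z hz =>
    hasDerivAt_slice (p := (t, z)) (ContDiffOn.diffAt hf hW ⟨ht, hz⟩)
  -- the derivative of the inverse metric
  have hdB : ∀ z ∈ U, timeDeriv B (t, z) = -(B (t, z) * timeDeriv H (t, z) * B (t, z)) := by
    intro z hz
    have h1 := (hd hB z hz).fun_mul (hd hH z hz)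
    have h2 : HasDerivAt (fun s => B (s, z) * H (s, z)) 0 t := by
      refine (hasDerivAt_const t (1 : 𝔸)).congr_of_eventuallyEq ?_
      filter_upwards [hI.mem_nhds ht] with s hs using (D s hs).inv_mul z hz
    have h3 := congrArg (· * B (t, z)) (h1.unique h2)
    simp only [add_mul, mul_assoc, (D t ht).mul_inv z hz, mul_one, zero_mul] at h3
    rw [mul_assoc]
    exact eq_neg_of_add_eq_zero_left h3
  have hV : ContDiffOn ℝ ∞ (fun z => B (t, z) * timeDeriv H (t, z)) U := by
    have h1 : ContDiffOn ℝ ∞ (fun p => B p * timeDeriv H p) (I ×ˢ U) :=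
      hB.mul (ContDiffOn.timeDeriv hH hW)
    exact h1.comp (contDiff_prodMk_right t).contDiffOn fun z hz => ⟨ht, hz⟩
  let V : Cn n → 𝔸 := fun z => B (t, z) * timeDeriv H (t, z)
  have hHV : ∀ z ∈ U, timeDeriv H (t, z) = H (t, z) * V z := fun z hz =>
    ((D t ht).HBx hz _).symm
  -- the derivative of the Chern form
  let A : ℝ × Cn n → 𝔸 := fun p => B p * del (fun z => H (p.1, z)) a p.2
  have hA : ContDiffOn ℝ ∞ A (I ×ˢ U) := hB.mul (contDiffOn_del_slice hH hW a)
  have hdA : ∀ z ∈ U, timeDeriv A (t, z)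
      = covDel (fun z => H (t, z)) (fun z => B (t, z)) V a z := by
    intro z hz
    have h1 := (hd hB z hz).fun_mul (hasDerivAt_del hH hW (p := (t, z)) ⟨ht, hz⟩ a)
    rw [(hd hA z hz).unique h1, hdB z hz]
    have h2 : del (fun z => timeDeriv H (t, z)) a z
        = del (fun z => H (t, z)) a z * V z + H (t, z) * del V a z := by
      rw [del_congr (g := fun z => H (t, z) * V z)
        (by filter_upwards [hU.mem_nhds hz] with z' hz' using hHV z' hz'),
        del_mul ((D t ht).dH hz) (ContDiffOn.diffAt hV hU hz)]
    simp only [h2, hHV z hz, covDel, mul_add, mul_assoc, neg_mul, (D t ht).BHx hz]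
    abel
  have hcurv : HasDerivAt (fun s => delbar (fun z => A (s, z)) b z)
      (delbar (covDel (fun z => H (t, z)) (fun z => B (t, z)) V a) b z) t := by
    have h1 := hasDerivAt_delbar hA hW (p := (t, z)) ⟨ht, hz⟩ b
    rwa [delbar_congr (by filter_upwards [hU.mem_nhds hz] with z' hz' using hdA z' hz')] at h1
  have hadj : HasDerivAt (fun s => B (s, z) * star (Φ z b) * H (s, z))
      (B (t, z) * star (Φ z b) * H (t, z) * V z
        - V z * (B (t, z) * star (Φ z b) * H (t, z))) t := by
    refine (((hd hB z hz).mul_const _).fun_mul (hd hH z hz)).congr_deriv ?_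
    rw [hdB z hz, hHV z hz]
    simp only [mul_assoc, neg_mul, (D t ht).BHx hz]
    abel
  exact hcurv.fun_neg.fun_add ((hadj.const_mul _).fun_sub (hadj.mul_const _))

end Variation

/-! ### Trace formulas for the first variation -/

section TraceFormulas

variable {n : ℕ} {𝔸 : Type*} [NormedRing 𝔸] [NormedAlgebra ℂ 𝔸]
  [StarRing 𝔸] [ContinuousStar 𝔸] [StarModule ℂ 𝔸]
  {U : Set (Cn n)} {H B : Cn n → 𝔸} {Φ : Cn n → Cn n → 𝔸}

/-- If `K` is parallel, the pairing of `K` with the variation of the curvature is a divergence. -/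
theorem trace_mul_higgsCurvVar_of_parallel (D : FrameData U H B Φ) {K V : Cn n → 𝔸}
    (hK : ContDiffOn ℝ ∞ K U) (hV : ContDiffOn ℝ ∞ V U) (tr : 𝔸 →L[ℂ] ℂ)
    (htr : ∀ x y, tr (x * y) = tr (y * x))
    (h1 : ∀ z ∈ U, ∀ a, covDel H B K a z = 0) (h2 : ∀ z ∈ U, ∀ a, delbar K a z = 0)
    (h3 : ∀ z ∈ U, ∀ a, Φ z a * K z - K z * Φ z a = 0) {z : Cn n} (hz : z ∈ U) (a b : Cn n) :
    tr (K z * higgsCurvVar H B Φ V a b z)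
      = -delbar (del (fun z => tr (K z * V z)) a) b z := by
  have hdV : ∀ z ∈ U, DifferentiableAt ℝ V z := fun z hz => ContDiffOn.diffAt hV D.isOpen hz
  have hdK : ∀ z ∈ U, DifferentiableAt ℝ K z := fun z hz => ContDiffOn.diffAt hK D.isOpen hz
  have e1 : ∀ z ∈ U, del (fun z => tr (K z * V z)) a z = tr (K z * covDel H B V a z) := by
    intro z hz
    rw [del_clm tr ((hdK z hz).fun_mul (hdV z hz)), del_mul (hdK z hz) (hdV z hz)]
    have h4 := h1 z hz a
    rw [covDel] at h4
    rw [eq_neg_of_add_eq_zero_left h4, covDel]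
    simp only [neg_sub, sub_mul, mul_add, mul_sub, map_add, map_sub, mul_assoc]
    have h7 := htr (B z * del H a z) (K z * V z)
    simp only [mul_assoc] at h7
    linear_combination -h7
  have e2 : delbar (del (fun z => tr (K z * V z)) a) b z
      = tr (K z * delbar (covDel H B V a) b z) := by
    rw [delbar_congr (by filter_upwards [D.isOpen.mem_nhds hz] with z' hz' using e1 z' hz')]
    have hc := ContDiffOn.diffAt (D.smooth_covDel hV a) D.isOpen hz
    rw [delbar_clm tr ((hdK z hz).fun_mul hc), delbar_mul (hdK z hz) hc, h2 z hz, zero_mul,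
      zero_add]
  rw [e2, higgsCurvVar]
  generalize B z * star (Φ z b) * H z * V z - V z * (B z * star (Φ z b) * H z) = Y
  have h4 : tr (K z * (Φ z a * Y - Y * Φ z a)) = 0 := by
    have h5 := sub_eq_zero.1 (h3 z hz a)
    have h6 := htr (K z * Y) (Φ z a)
    rw [← mul_assoc, h5] at h6
    rw [mul_sub, map_sub, ← mul_assoc, ← mul_assoc, h6, mul_assoc, sub_self]
  rw [mul_add, map_add, h4, mul_neg, map_neg, add_zero]

theorem FrameData.star_mul_H (D : FrameData U H B Φ) {z : Cn n} (hz : z ∈ U) {k : 𝔸}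
    (hk : B z * star k * H z = k) : star k * H z = H z * k := by
  calc star k * H z = H z * (B z * star k * H z) := by rw [mul_assoc (B z), D.HBx hz]
    _ = H z * k := by rw [hk]

/-- For a self-adjoint `K`, the `(0,1)`-derivative is the adjoint of the `(1,0)`-derivative. -/
theorem FrameData.delbar_eq_adj_covDel (D : FrameData U H B Φ) {K : Cn n → 𝔸}
    (hK : ContDiffOn ℝ ∞ K U) (hs : ∀ z ∈ U, B z * star (K z) * H z = K z) {z : Cn n}
    (hz : z ∈ U) (a : Cn n) : delbar K a z = B z * star (covDel H B K a z) * H z := by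
  have hdK : DifferentiableAt ℝ K z := ContDiffOn.diffAt hK D.isOpen hz
  have hdsK : DifferentiableAt ℝ (fun z => star (K z)) z :=
    ContDiffOn.diffAt (contDiffOn_star hK) D.isOpen hz
  have e1 : delbar K a z = delbar (fun z => B z * star (K z) * H z) a z :=
    delbar_congr (by filter_upwards [D.isOpen.mem_nhds hz] with z' hz' using (hs z' hz').symm) a
  have e2 : star (K z) * H z = H z * K z := D.star_mul_H hz (hs z hz)
  rw [e1, delbar_mul ((D.dB hz).fun_mul hdsK) (D.dH hz), delbar_mul (D.dB hz) hdsK, D.delbar_B hz,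
    delbar_star, covDel]
  simp only [star_add, star_sub, star_mul, D.star_B hz, D.star_del_H hz, mul_add, add_mul,
    mul_sub, sub_mul, mul_assoc, neg_mul, D.inv_mul z hz, mul_one]
  rw [e2, D.BHx hz]
  abel

/-- The pairing of a self-adjoint `K` with the variation of the curvature in the direction `K` is
a divergence plus the squares of `D'K` and `[φ, K]`. -/
theorem trace_mul_higgsCurvVar_self (D : FrameData U H B Φ) {K : Cn n → 𝔸}
    (hK : ContDiffOn ℝ ∞ K U) (hs : ∀ z ∈ U, B z * star (K z) * H z = K z) (tr : 𝔸 →L[ℂ] ℂ)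
    (htr : ∀ x y, tr (x * y) = tr (y * x)) {z : Cn n} (hz : z ∈ U) (a b : Cn n) :
    tr (K z * higgsCurvVar H B Φ K a b z)
      = -(1 / 2) * delbar (del (fun z => tr (K z * K z)) a) b z
        + tr (covDel H B K a z * (B z * star (covDel H B K b z) * H z))
        + tr ((Φ z a * K z - K z * Φ z a)
          * (B z * star (Φ z b * K z - K z * Φ z b) * H z)) := by
  have hdK : ∀ z ∈ U, DifferentiableAt ℝ K z := fun z hz => ContDiffOn.diffAt hK D.isOpen hz
  have e1 : ∀ z ∈ U, del (fun z => tr (K z * K z)) a z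
      = (2 : ℂ) • tr (K z * covDel H B K a z) := by
    intro z hz
    rw [del_clm tr ((hdK z hz).fun_mul (hdK z hz)), del_mul (hdK z hz) (hdK z hz), map_add,
      htr (del K a z) (K z), covDel]
    have h5 := htr (K z) (K z * (B z * del H a z))
    simp only [mul_add, mul_sub, map_add, map_sub, mul_assoc, smul_eq_mul] at h5 ⊢
    linear_combination 2 * h5
  have hc := ContDiffOn.diffAt (D.smooth_covDel hK a) D.isOpen hz
  have e2 : delbar (del (fun z => tr (K z * K z)) a) b z
      = (2 : ℂ) • (tr (delbar K b z * covDel H B K a z)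
        + tr (K z * delbar (covDel H B K a) b z)) := by
    rw [delbar_congr (by filter_upwards [D.isOpen.mem_nhds hz] with z' hz' using e1 z' hz')]
    have h6 : DifferentiableAt ℝ (fun z => tr (K z * covDel H B K a z)) z :=
      (tr.restrictScalars ℝ).differentiableAt.comp z ((hdK z hz).fun_mul hc)
    rw [delbar_smul (differentiableAt_const _) h6, delbar_clm tr ((hdK z hz).fun_mul hc),
      delbar_mul (hdK z hz) hc, map_add]
    simp [delbar]
  rw [e2, D.delbar_eq_adj_covDel hK hs hz b, htr (covDel H B K a z)]
  have e3 : star (K z) * H z = H z * K z := D.star_mul_H hz (hs z hz)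
  have e4 : B z * star (Φ z b * K z - K z * Φ z b) * H z
      = K z * (B z * star (Φ z b) * H z) - B z * star (Φ z b) * H z * K z := by
    have e5 : B z * star (K z) = K z * B z := by
      rw [← D.BHx hz (K z * B z), ← mul_assoc (H z), ← e3, mul_assoc, D.mul_inv z hz, mul_one]
    simp only [star_sub, star_mul, mul_sub, sub_mul, mul_assoc, e3]
    rw [← mul_assoc (B z), e5, mul_assoc]
  rw [e4, higgsCurvVar]
  generalize B z * star (Φ z b) * H z = T
  generalize Φ z a = S
  generalize K z = k
  generalize delbar (covDel H B K a) b z = X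
  have c1 := htr (k * k * T) S
  have c2 := htr (k * T * k) S
  simp only [mul_add, mul_sub, sub_mul, map_add, map_sub, mul_neg, map_neg, mul_assoc,
    smul_eq_mul] at c1 c2 ⊢
  linear_combination c1 - c2

/-- The Hitchin–Simpson connection form splits into a complex linear and a conjugate linear part.
For a self-adjoint `K` the equation `dK + [Θ, K] = 0` says that `D'K` and `[φ, K]` vanish. -/
theorem FrameData.parallel_iff (D : FrameData U H B Φ) {K : Cn n → 𝔸}
    (hK : ContDiffOn ℝ ∞ K U) (hs : ∀ z ∈ U, B z * star (K z) * H z = K z) {z : Cn n}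
    (hz : z ∈ U) :
    (∀ u, fderiv ℝ K z u + ((B z * del H u z + Φ z u + B z * star (Φ z u) * H z) * K z
      - K z * (B z * del H u z + Φ z u + B z * star (Φ z u) * H z)) = 0) ↔
    ∀ u, covDel H B K u z = 0 ∧ Φ z u * K z - K z * Φ z u = 0 := by
  have e3 : star (K z) * H z = H z * K z := D.star_mul_H hz (hs z hz)
  have e4 : ∀ u, B z * star (Φ z u) * H z * K z - K z * (B z * star (Φ z u) * H z)
      = -(B z * star (Φ z u * K z - K z * Φ z u) * H z) := fun u => by
    have e5 : B z * star (K z) = K z * B z := by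
      rw [← D.BHx hz (K z * B z), ← mul_assoc (H z), ← e3, mul_assoc, D.mul_inv z hz, mul_one]
    simp only [star_sub, star_mul, mul_sub, sub_mul, mul_assoc, e3]
    rw [← mul_assoc (B z) (star (K z)), e5, mul_assoc, neg_sub]
  have split : ∀ u, fderiv ℝ K z u + ((B z * del H u z + Φ z u + B z * star (Φ z u) * H z) * K z
      - K z * (B z * del H u z + Φ z u + B z * star (Φ z u) * H z))
      = (covDel H B K u z + (Φ z u * K z - K z * Φ z u))
        + B z * star (covDel H B K u z - (Φ z u * K z - K z * Φ z u)) * H z := fun u => by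
    rw [star_sub (covDel H B K u z), mul_sub (B z), sub_mul _ _ (H z), sub_eq_add_neg _
      (B z * star (Φ z u * K z - K z * Φ z u) * H z), ← e4,
      ← D.delbar_eq_adj_covDel hK hs hz, covDel, fderiv_eq_del_add_delbar]
    noncomm_ring
  constructor
  · intro h u
    have hI : covDel H B K (Complex.I • u) z = Complex.I • covDel H B K u z := by
      simp only [covDel, del_smul_right, mul_smul_comm, smul_mul_assoc, smul_add, smul_sub]
    have h1 := (split u).symm.trans (h u)
    have h2 := (split (Complex.I • u)).symm.trans (h (Complex.I • u))
    rw [hI, D.map_smul, smul_mul_assoc, mul_smul_comm, ← smul_sub, ← smul_add, ← smul_sub,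
      star_smul, mul_smul_comm, smul_mul_assoc] at h2
    set X := covDel H B K u z
    set Y := Φ z u * K z - K z * Φ z u
    have h3 : X + Y = 0 := by
      have h4 : (2 : ℂ) • (X + Y) = 0 := by
        have h5 := congrArg₂ (fun x y => x - Complex.I • y) h1 h2
        simp only [smul_add, smul_smul, Complex.star_def, Complex.conj_I, Complex.I_mul_I,
          mul_neg, smul_zero, sub_zero] at h5
        rw [← h5]; module
      exact (smul_eq_zero.1 h4).resolve_left two_ne_zero
    have h4 : X - Y = 0 := by
      rw [h3, zero_add] at h1
      have h5 := congrArg (fun x => H z * x * B z) h1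
      simp only [mul_assoc, D.mul_inv z hz, D.HBx hz, mul_one, mul_zero, zero_mul] at h5
      exact star_eq_zero.1 h5
    have h5 : (2 : ℂ) • X = 0 := by
      rw [show (2 : ℂ) • X = (X + Y) + (X - Y) by module, h3, h4, add_zero]
    have h6 : X = 0 := (smul_eq_zero.1 h5).resolve_left two_ne_zero
    exact ⟨h6, by rwa [h6, zero_add] at h3⟩
  · intro h u
    rw [split, (h u).1, (h u).2]; simp

end TraceFormulas

/-! ### The normed star algebra of matrices -/

section MatrixAlgebra

/-- The algebra of complex `r × r` matrices with its operator norm. A type synonym is used so that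
its normed structure does not interfere with the entrywise structures on matrices. -/
def MatAlg (r : ℕ) : Type := Matrix (Fin r) (Fin r) ℂ

/-- A matrix as an element of the normed algebra of matrices. -/
def toAlg {r : ℕ} (A : Matrix (Fin r) (Fin r) ℂ) : MatAlg r := A

namespace MatAlg

variable {r : ℕ}

section Instances

open scoped Matrix.Norms.Operator

instance : NormedRing (MatAlg r) :=
  inferInstanceAs (NormedRing (Matrix (Fin r) (Fin r) ℂ))

instance : NormedAlgebra ℂ (MatAlg r) :=
  inferInstanceAs (NormedAlgebra ℂ (Matrix (Fin r) (Fin r) ℂ))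

instance : StarRing (MatAlg r) :=
  inferInstanceAs (StarRing (Matrix (Fin r) (Fin r) ℂ))

instance : StarModule ℂ (MatAlg r) :=
  inferInstanceAs (StarModule ℂ (Matrix (Fin r) (Fin r) ℂ))

instance : FiniteDimensional ℂ (MatAlg r) :=
  inferInstanceAs (FiniteDimensional ℂ (Matrix (Fin r) (Fin r) ℂ))

end Instances

instance : CompleteSpace (MatAlg r) := FiniteDimensional.complete ℂ _

instance : FiniteDimensional ℝ (MatAlg r) := FiniteDimensional.complexToReal _

instance : ContinuousStar (MatAlg r) where
  continuous_star :=
    (show MatAlg r →ₗ[ℝ] MatAlg r from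
      { toFun := star
        map_add' := star_add
        map_smul' := fun c x => by simp }).continuous_of_finiteDimensional

theorem toAlg_mul (A B : Matrix (Fin r) (Fin r) ℂ) : toAlg (A * B) = toAlg A * toAlg B := rfl

theorem toAlg_add (A B : Matrix (Fin r) (Fin r) ℂ) : toAlg (A + B) = toAlg A + toAlg B := rfl

theorem toAlg_sub (A B : Matrix (Fin r) (Fin r) ℂ) : toAlg (A - B) = toAlg A - toAlg B := rfl

theorem toAlg_smul (c : ℂ) (A : Matrix (Fin r) (Fin r) ℂ) : toAlg (c • A) = c • toAlg A := rfl

theorem toAlg_one : toAlg (1 : Matrix (Fin r) (Fin r) ℂ) = 1 := rfl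

theorem toAlg_conjTranspose (A : Matrix (Fin r) (Fin r) ℂ) : toAlg Aᴴ = star (toAlg A) := rfl

variable (r) in
/-- The linear identification of matrices with the normed algebra of matrices. -/
def toAlgL : Matrix (Fin r) (Fin r) ℂ ≃ₗ[ℂ] MatAlg r where
  toFun := toAlg
  invFun A := A
  map_add' _ _ := rfl
  map_smul' _ _ := rfl
  left_inv _ := rfl
  right_inv _ := rfl

theorem toAlg_sum {ι : Type*} (s : Finset ι) (f : ι → Matrix (Fin r) (Fin r) ℂ) :
    toAlg (∑ i ∈ s, f i) = ∑ i ∈ s, toAlg (f i) :=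
  map_sum (toAlgL r) f s

variable (r) in
/-- The trace as a continuous linear form. -/
def tr : MatAlg r →L[ℂ] ℂ :=
  LinearMap.toContinuousLinearMap ((Matrix.traceLinearMap (Fin r) ℂ ℂ) ∘ₗ (toAlgL r).symm)

theorem tr_toAlg (A : Matrix (Fin r) (Fin r) ℂ) : tr r (toAlg A) = A.trace := rfl

theorem tr_mul_comm (x y : MatAlg r) : tr r (x * y) = tr r (y * x) :=
  Matrix.trace_mul_comm ((toAlgL r).symm x) ((toAlgL r).symm y)

/-- A matrix entry as a continuous linear form. -/
def entry (i j : Fin r) : MatAlg r →L[ℂ] ℂ :=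
  LinearMap.toContinuousLinearMap ((Matrix.entryLinearMap ℂ ℂ i j) ∘ₗ (toAlgL r).symm)

theorem entry_toAlg (i j : Fin r) (A : Matrix (Fin r) (Fin r) ℂ) :
    entry i j (toAlg A) = A i j := rfl

theorem ext_entry {x y : MatAlg r} (h : ∀ i j, entry i j x = entry i j y) : x = y :=
  (toAlgL r).symm.injective (Matrix.ext h)

theorem eq_sum_entries (x : MatAlg r) :
    x = ∑ i, ∑ j, entry i j x • toAlg (Matrix.single i j (1 : ℂ)) := by
  have h := congrArg toAlg (Matrix.matrix_eq_sum_single ((toAlgL r).symm x))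
  simp only [toAlg_sum] at h
  refine h.trans (Finset.sum_congr rfl fun i _ => Finset.sum_congr rfl fun j _ => ?_)
  rw [← toAlg_smul, Matrix.smul_single, smul_eq_mul, mul_one]; rfl

theorem contDiffOn_of_entries {E : Type*} [NormedAddCommGroup E] [NormedSpace ℝ E] {k : WithTop ℕ∞}
    {f : E → MatAlg r} {U : Set E} (hf : ∀ i j, ContDiffOn ℝ k (fun z => entry i j (f z)) U) :
    ContDiffOn ℝ k f U := by
  have h : f = fun z => ∑ i, ∑ j, entry i j (f z) • toAlg (Matrix.single i j (1 : ℂ)) := by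
    funext z; exact eq_sum_entries _
  rw [h]
  refine ContDiffOn.sum fun i _ => ContDiffOn.sum fun j _ => ?_
  exact ((ContinuousLinearMap.toSpanSingleton ℂ
    (toAlg (Matrix.single i j (1 : ℂ)))).restrictScalars ℝ).contDiff.comp_contDiffOn (hf i j)

theorem contDiffOn_complex_of_entries {E : Type*} [NormedAddCommGroup E] [NormedSpace ℂ E]
    {k : WithTop ℕ∞}
    {f : E → MatAlg r} {U : Set E} (hf : ∀ i j, ContDiffOn ℂ k (fun z => entry i j (f z)) U) :
    ContDiffOn ℂ k f U := by
  have h : f = fun z => ∑ i, ∑ j, entry i j (f z) • toAlg (Matrix.single i j (1 : ℂ)) := by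
    funext z; exact eq_sum_entries _
  rw [h]
  exact ContDiffOn.sum fun i _ => ContDiffOn.sum fun j _ =>
    (ContinuousLinearMap.toSpanSingleton ℂ
    (toAlg (Matrix.single i j (1 : ℂ)))).contDiff.comp_contDiffOn (hf i j)

theorem toAlg_matDeriv {n : ℕ} {f : Cn n → Matrix (Fin r) (Fin r) ℂ} {z : Cn n}
    (hf : DifferentiableAt ℝ (fun z => toAlg (f z)) z) (u : Cn n) :
    toAlg (matDeriv f z u) = fderiv ℝ (fun z => toAlg (f z)) z u := by
  refine ext_entry fun i j => ?_
  have h := (((entry i j).restrictScalars ℝ).hasFDerivAt.comp z hf.hasFDerivAt).fderiv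
  exact congrArg (fun L : Cn n →L[ℝ] ℂ => L u) h

theorem toAlg_matDel {n : ℕ} {f : Cn n → Matrix (Fin r) (Fin r) ℂ} {z : Cn n}
    (hf : DifferentiableAt ℝ (fun z => toAlg (f z)) z) (u : Cn n) :
    toAlg (matDel f z u) = del (fun z => toAlg (f z)) u z := by
  rw [matDel, toAlg_smul, toAlg_sub, toAlg_smul, toAlg_matDeriv hf, toAlg_matDeriv hf]; rfl

/-- Smoothness of the inverse of an invertible matrix function. -/
theorem contDiffOn_inv {E : Type*} [NormedAddCommGroup E] [NormedSpace ℝ E]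
    {f : E → Matrix (Fin r) (Fin r) ℂ} {U : Set E} (hf : ContDiffOn ℝ ∞ (fun z => toAlg (f z)) U)
    (hinv : ∀ z ∈ U, IsUnit (f z)) : ContDiffOn ℝ ∞ (fun z => toAlg (f z)⁻¹) U := by
  intro z hz
  obtain ⟨u, hu⟩ : IsUnit (toAlg (f z)) := hinv z hz
  have h : (fun z => toAlg (f z)⁻¹) = fun z => Ring.inverse (toAlg (f z)) := by
    funext z; exact Matrix.nonsing_inv_eq_ringInverse (f z)
  rw [h]
  have h2 : ContDiffAt ℝ ∞ (Ring.inverse : MatAlg r → MatAlg r) (toAlg (f z)) := by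
    rw [← hu]; exact contDiffAt_ringInverse ℝ u
  exact h2.comp_contDiffWithinAt z (hf z hz)

end MatAlg

end MatrixAlgebra

/-! ### Hermitian forms and Higgs fields in frames -/

section Frames

open MatAlg
open scoped ComplexOrder

variable {n : ℕ} {X : Type*} [TopologicalSpace X] [ChartedSpace (Cn n) X]
variable {r : ℕ} {V : X → Type*} [TopologicalSpace (TotalSpace (Cn r) V)]
  [∀ x, AddCommGroup (V x)] [∀ x, Module ℂ (V x)] [∀ x, TopologicalSpace (V x)]
  [FiberBundle (Cn r) V] [VectorBundle ℂ (Cn r) V]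

theorem isOpen_coordDomain (x₀ : X) : IsOpen (coordDomain n r V x₀) :=
  (chartAt (Cn n) x₀).isOpen_inter_preimage_symm (trivializationAt (Cn r) V x₀).open_baseSet

variable (r V) in
theorem coframeMap_frameMap {x₀ y : X} (hy : y ∈ (trivializationAt (Cn r) V x₀).baseSet)
    (v : Cn r) : coframeMap r V x₀ y (frameMap r V x₀ y v) = v :=
  (trivializationAt (Cn r) V x₀).continuousLinearMapAt_symmL hy v

variable (r V) in
theorem frameMap_coframeMap {x₀ y : X} (hy : y ∈ (trivializationAt (Cn r) V x₀).baseSet)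
    (v : V y) : frameMap r V x₀ y (coframeMap r V x₀ y v) = v :=
  (trivializationAt (Cn r) V x₀).symmL_continuousLinearMapAt hy v

theorem HermitianForm.form_frameMap (h : HermitianForm n r V) (x₀ : X) (z : Cn n) (u v : Cn r) :
    h.form (pt n X x₀ z) (frameMap r V x₀ _ u) (frameMap r V x₀ _ v)
      = star u ⬝ᵥ (h.mat x₀ z *ᵥ v) := by
  have hu : u = ∑ i, u i • Pi.single i (1 : ℂ) := pi_eq_sum_univ' u
  have hv : v = ∑ i, v i • Pi.single i (1 : ℂ) := pi_eq_sum_univ' v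
  conv_lhs => rw [hu, hv]
  simp only [map_sum, map_smul, LinearMap.sum_apply, LinearMap.map_smulₛₗ, LinearMap.smul_apply,
    smul_eq_mul, dotProduct, Matrix.mulVec, HermitianForm.mat, Matrix.of_apply, frameVec,
    Finset.mul_sum, Pi.star_apply]
  rw [Finset.sum_comm]
  refine Finset.sum_congr rfl fun i _ => Finset.sum_congr rfl fun j _ => ?_
  simp only [RCLike.star_def]; ring

theorem HermitianForm.isHermitian (h : HermitianForm n r V) (x₀ : X) (z : Cn n) :
    (h.mat x₀ z).IsHermitian := by
  ext i j
  simp [HermitianForm.mat, h.conj_symm]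

/-- The matrix of a Hermitian form in the frame around `x₀`, in the normed algebra of matrices. -/
def HermitianForm.alg (h : HermitianForm n r V) (x₀ : X) (z : Cn n) : MatAlg r :=
  toAlg (h.mat x₀ z)

/-- The inverse of the matrix of a Hermitian form in the frame around `x₀`. -/
def HermitianForm.algInv (h : HermitianForm n r V) (x₀ : X) (z : Cn n) : MatAlg r :=
  toAlg (h.mat x₀ z)⁻¹

theorem HermitianForm.contDiffOn_alg (h : HermitianForm n r V) (x₀ : X) :
    ContDiffOn ℝ ∞ (h.alg x₀) (coordDomain n r V x₀) :=
  contDiffOn_of_entries fun i j => h.smooth x₀ i j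

theorem HermitianMetric.posDef (h : HermitianMetric n r V) {x₀ : X} {z : Cn n}
    (hz : z ∈ coordDomain n r V x₀) : (h.mat x₀ z).PosDef := by
  refine Matrix.PosDef.of_dotProduct_mulVec_pos (h.isHermitian x₀ z) fun v hv => ?_
  rw [← h.form_frameMap]
  have hne : frameMap r V x₀ (pt n X x₀ z) v ≠ 0 := fun h0 => hv (by
    rw [← coframeMap_frameMap r V hz.2 v, h0, map_zero])
  rw [RCLike.pos_iff]
  refine ⟨h.pos _ _ hne, ?_⟩
  exact Complex.conj_eq_iff_im.1 (h.conj_symm _ _ _)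

theorem HermitianMetric.contDiffOn_algInv (h : HermitianMetric n r V) (x₀ : X) :
    ContDiffOn ℝ ∞ (h.algInv x₀) (coordDomain n r V x₀) :=
  contDiffOn_inv (h.contDiffOn_alg x₀) fun _ hz => (h.posDef hz).isUnit

theorem endMatrix_mulVec (x₀ y : X) (A : Module.End ℂ (V y)) (v : Cn r) :
    endMatrix r x₀ y A *ᵥ v = coframeMap r V x₀ y (A (frameMap r V x₀ y v)) := by
  rw [endMatrix, LinearMap.toMatrix'_mulVec]; rfl

theorem endMatrix_add (x₀ y : X) (A A' : Module.End ℂ (V y)) :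
    endMatrix r x₀ y (A + A') = endMatrix r x₀ y A + endMatrix r x₀ y A' := by
  simp [endMatrix, LinearMap.comp_add, LinearMap.add_comp]

theorem endMatrix_smul (x₀ y : X) (c : ℂ) (A : Module.End ℂ (V y)) :
    endMatrix r x₀ y (c • A) = c • endMatrix r x₀ y A := by
  simp [endMatrix, LinearMap.comp_smul, LinearMap.smul_comp]

theorem endOfMatrix_apply (x₀ y : X) (M : Matrix (Fin r) (Fin r) ℂ) (v : V y) :
    endOfMatrix V x₀ y M v = frameMap r V x₀ y (M *ᵥ coframeMap r V x₀ y v) := by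
  simp [endOfMatrix]

theorem endMatrix_endOfMatrix {x₀ y : X} (hy : y ∈ (trivializationAt (Cn r) V x₀).baseSet)
    (M : Matrix (Fin r) (Fin r) ℂ) : endMatrix r x₀ y (endOfMatrix V x₀ y M) = M := by
  refine Matrix.ext_of_mulVec_single fun i => ?_
  rw [endMatrix_mulVec, endOfMatrix_apply, coframeMap_frameMap r V hy, coframeMap_frameMap r V hy]

theorem endOfMatrix_eq_zero_iff {x₀ y : X} (hy : y ∈ (trivializationAt (Cn r) V x₀).baseSet)
    (M : Matrix (Fin r) (Fin r) ℂ) : endOfMatrix V x₀ y M = 0 ↔ M = 0 := by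
  constructor
  · intro h
    rw [← endMatrix_endOfMatrix hy M, h]; simp [endMatrix]
  · rintro rfl; ext v; simp [endOfMatrix]

variable [IsManifold 𝓘(ℂ, Cn n) ω X]

theorem HiggsField.mat_add (φ : HiggsField n r V) (x₀ : X) (z u v : Cn n) :
    φ.mat x₀ z (u + v) = φ.mat x₀ z u + φ.mat x₀ z v := by
  simp only [HiggsField.mat, map_add, endMatrix_add]

theorem HiggsField.mat_smul (φ : HiggsField n r V) (x₀ : X) (z : Cn n) (c : ℂ) (u : Cn n) :
    φ.mat x₀ z (c • u) = c • φ.mat x₀ z u := by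
  simp only [HiggsField.mat, map_smul, endMatrix_smul]

theorem HiggsField.mat_eq_sum (φ : HiggsField n r V) (x₀ : X) (z u : Cn n) :
    φ.mat x₀ z u = ∑ α, u α • φ.mat x₀ z (Pi.single α 1) := by
  have h (s : Finset (Fin n)) : φ.mat x₀ z (∑ γ ∈ s, u γ • Pi.single γ (1 : ℂ))
      = ∑ γ ∈ s, u γ • φ.mat x₀ z (Pi.single γ 1) := by
    classical
    induction s using Finset.induction_on with
    | empty => simpa using φ.mat_smul x₀ z 0 0
    | insert i s hi ih => rw [Finset.sum_insert hi, Finset.sum_insert hi, φ.mat_add, ih,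
        φ.mat_smul]
  rw [← h]
  congr 1
  exact pi_eq_sum_univ' u

/-- The matrix of the Higgs field in the frame around `x₀`, in the normed algebra of matrices. -/
def HiggsField.alg (φ : HiggsField n r V) (x₀ : X) (z u : Cn n) : MatAlg r :=
  toAlg (φ.mat x₀ z u)

theorem HiggsField.contDiffOn_alg (φ : HiggsField n r V) (x₀ : X) (u : Cn n) :
    ContDiffOn ℂ ∞ (fun z => φ.alg x₀ z u) (coordDomain n r V x₀) := by
  refine contDiffOn_complex_of_entries fun i j => ?_
  have h : (fun z => entry i j (φ.alg x₀ z u))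
      = fun z => ∑ α, u α * φ.mat x₀ z (Pi.single α 1) i j := by
    funext z
    rw [HiggsField.alg, entry_toAlg, φ.mat_eq_sum, Matrix.sum_apply]; rfl
  rw [h]
  refine ContDiffOn.sum fun α _ => contDiffOn_const.mul ?_
  exact contDiffOn_of_differentiableOn_complex (isOpen_coordDomain x₀) (φ.holomorphic x₀ α i j)

/-- The local data of the Hermitian Higgs bundle in the frame around `x₀`. -/
theorem frameData (φ : HiggsField n r V) (h : HermitianMetric n r V) (x₀ : X) :
    FrameData (coordDomain n r V x₀) (h.alg x₀) (h.algInv x₀) (φ.alg x₀) where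
  isOpen := isOpen_coordDomain x₀
  smooth_H := h.contDiffOn_alg x₀
  smooth_B := h.contDiffOn_algInv x₀
  mul_inv _ hz := congrArg toAlg
    (Matrix.mul_nonsing_inv _ ((Matrix.isUnit_iff_isUnit_det _).1 (h.posDef hz).isUnit))
  inv_mul _ hz := congrArg toAlg
    (Matrix.nonsing_inv_mul _ ((Matrix.isUnit_iff_isUnit_det _).1 (h.posDef hz).isUnit))
  star_H z _ := congrArg toAlg (h.isHermitian x₀ z)
  holo := φ.contDiffOn_alg x₀
  map_add z a b := congrArg toAlg (φ.mat_add x₀ z a b)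
  map_smul z c a := congrArg toAlg (φ.mat_smul x₀ z c a)

theorem toAlg_hsForm (φ : HiggsField n r V) (h : HermitianMetric n r V) {x₀ : X} {z : Cn n}
    (hz : z ∈ coordDomain n r V x₀) (u : Cn n) : toAlg (hsForm φ h x₀ z u)
      = h.algInv x₀ z * del (h.alg x₀) u z + φ.alg x₀ z u
        + h.algInv x₀ z * star (φ.alg x₀ z u) * h.alg x₀ z := by
  rw [hsForm, chernForm, toAlg_add, toAlg_add, toAlg_mul,
    toAlg_matDel (f := h.mat x₀) ((frameData φ h x₀).dH hz)]; rfl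

theorem toAlg_coeff11_hsCurvature (φ : HiggsField n r V) (h : HermitianMetric n r V) {x₀ : X}
    {z : Cn n} (hz : z ∈ coordDomain n r V x₀) (α β : Fin n) :
    toAlg (coeff11 (hsCurvature φ h x₀ z) α β)
      = higgsCurv (h.alg x₀) (h.algInv x₀) (φ.alg x₀) (Pi.single α 1) (Pi.single β 1) z := by
  have D := frameData φ h x₀
  let Θ : Cn n → Cn n → MatAlg r := fun u z => h.algInv x₀ z * del (h.alg x₀) u z + φ.alg x₀ z u
        + h.algInv x₀ z * star (φ.alg x₀ z u) * h.alg x₀ z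
  have hΘd : ∀ u, DifferentiableAt ℝ (Θ u) z := fun u =>
    ((ContDiffOn.diffAt (D.smooth_A u) D.isOpen hz).fun_add (D.dPhi hz u)).fun_add
      (ContDiffOn.diffAt (D.smooth_adj u) D.isOpen hz)
  have h1 : ∀ u v, toAlg (matDeriv (fun z' => hsForm φ h x₀ z' v) z u) = fderiv ℝ (Θ v) z u :=
    fun u v => by
      have hev : (fun z' => toAlg (hsForm φ h x₀ z' v)) =ᶠ[𝓝 z] Θ v := by
        filter_upwards [D.isOpen.mem_nhds hz] with z' hz' using toAlg_hsForm φ h hz' v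
      rw [toAlg_matDeriv ((hΘd v).congr_of_eventuallyEq hev), hev.fderiv_eq]
  have h2 : ∀ u v, toAlg (hsCurvature φ h x₀ z u v) = fderiv ℝ (Θ v) z u - fderiv ℝ (Θ u) z v
      + (Θ u z * Θ v z - Θ v z * Θ u z) := fun u v => by
    rw [hsCurvature, toAlg_add, toAlg_sub, h1, h1, toAlg_sub, toAlg_mul, toAlg_mul,
      toAlg_hsForm φ h hz u, toAlg_hsForm φ h hz v]
  have hI : ∀ γ : Fin n, (Pi.single γ Complex.I : Cn n) = Complex.I • Pi.single γ 1 := fun γ => by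
    rw [← Pi.single_smul]; simp
  rw [← D.coeff_curvature hz (Θ := Θ) rfl rfl, coeff11]
  simp only [toAlg_smul, toAlg_add, toAlg_sub, h2, hI]

end Frames

/-! ### Contraction with the metric -/

section Contraction

variable {n : ℕ} {F : Type*} [AddCommGroup F] [Module ℂ F]

/-- The contraction `∑ g^{αβ̄} S_{αβ̄}` of a sesquilinear form with the metric of matrix `G`. -/
def contract (G : Matrix (Fin n) (Fin n) ℂ) (S : Fin n → Fin n → F) : F :=
  ∑ α, ∑ β, G⁻¹ α β • S α β

theorem contract_transform {G₀ G₁ T : Matrix (Fin n) (Fin n) ℂ} (hT : IsUnit T)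
    (hG : G₀ = Tᴴ * G₁ * T) {S₀ S₁ : Fin n → Fin n → F}
    (hS : ∀ α β, S₀ α β = ∑ γ, ∑ δ, (T γ α * conj (T δ β)) • S₁ γ δ) :
    contract G₀ S₀ = contract G₁ S₁ := by
  have hT' : IsUnit Tᴴ := (Matrix.isUnit_conjTranspose T).2 hT
  rw [Matrix.isUnit_iff_isUnit_det] at hT hT'
  have hinv : T * G₀⁻¹ * Tᴴ = G₁⁻¹ := by
    rw [hG, Matrix.mul_inv_rev, Matrix.mul_inv_rev]
    rw [Matrix.mul_assoc, Matrix.mul_assoc, Matrix.mul_assoc, Matrix.nonsing_inv_mul _ hT',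
      Matrix.mul_one, ← Matrix.mul_assoc, Matrix.mul_nonsing_inv _ hT, Matrix.one_mul]
  have hentry : ∀ γ δ, G₁⁻¹ γ δ = ∑ α, ∑ β, G₀⁻¹ α β * (T γ α * conj (T δ β)) := by
    intro γ δ
    rw [← hinv]
    simp only [Matrix.mul_apply, Matrix.conjTranspose_apply, Finset.sum_mul]
    rw [Finset.sum_comm]
    refine Finset.sum_congr rfl fun α _ => Finset.sum_congr rfl fun β _ => ?_
    simp only [RCLike.star_def]; ring
  simp only [contract, hS, hentry, Finset.sum_smul, Finset.smul_sum, mul_smul]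
  calc _ = ∑ α, ∑ γ, ∑ β, ∑ δ, G₀⁻¹ α β • T γ α • (starRingEnd ℂ) (T δ β) • S₁ γ δ :=
        Finset.sum_congr rfl fun α _ => Finset.sum_comm
    _ = ∑ γ, ∑ α, ∑ β, ∑ δ, G₀⁻¹ α β • T γ α • (starRingEnd ℂ) (T δ β) • S₁ γ δ :=
        Finset.sum_comm
    _ = ∑ γ, ∑ α, ∑ δ, ∑ β, G₀⁻¹ α β • T γ α • (starRingEnd ℂ) (T δ β) • S₁ γ δ :=
        Finset.sum_congr rfl fun γ _ => Finset.sum_congr rfl fun α _ => Finset.sum_comm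
    _ = _ := Finset.sum_congr rfl fun γ _ => Finset.sum_comm

theorem contract_add (G : Matrix (Fin n) (Fin n) ℂ) (S S' : Fin n → Fin n → F) :
    contract G (fun α β => S α β + S' α β) = contract G S + contract G S' := by
  simp only [contract, smul_add, Finset.sum_add_distrib]

theorem contract_smul (G : Matrix (Fin n) (Fin n) ℂ) (c : ℂ) (S : Fin n → Fin n → F) :
    contract G (fun α β => c • S α β) = c • contract G S := by
  simp only [contract, Finset.smul_sum, smul_comm c]

end Contraction

/-! ### Sesquilinearity of the curvature -/

section Sesquilinear

variable {n : ℕ} {𝔸 : Type*} [NormedRing 𝔸] [NormedAlgebra ℂ 𝔸]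
  [StarRing 𝔸] [ContinuousStar 𝔸] [StarModule ℂ 𝔸]

theorem FrameData.eq_sum {U : Set (Cn n)} {H B : Cn n → 𝔸} {Φ : Cn n → Cn n → 𝔸}
    (D : FrameData U H B Φ) (z a : Cn n) : Φ z a = ∑ γ, a γ • Φ z (Pi.single γ 1) := by
  have h (s : Finset (Fin n)) : Φ z (∑ γ ∈ s, a γ • Pi.single γ (1 : ℂ))
      = ∑ γ ∈ s, a γ • Φ z (Pi.single γ 1) := by
    classical
    induction s using Finset.induction_on with
    | empty => simpa using D.map_smul z 0 0
    | insert i s hi ih => rw [Finset.sum_insert hi, Finset.sum_insert hi, D.map_add, ih,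
        D.map_smul]
  rw [← h]
  congr 1
  exact pi_eq_sum_univ' a

theorem FrameData.higgsCurv_eq_sum {U : Set (Cn n)} {H B : Cn n → 𝔸} {Φ : Cn n → Cn n → 𝔸}
    (D : FrameData U H B Φ) {z : Cn n} (hz : z ∈ U) (a b : Cn n) :
    higgsCurv H B Φ a b z = ∑ γ, ∑ δ, (a γ * conj (b δ)) •
      higgsCurv H B Φ (Pi.single γ 1) (Pi.single δ 1) z := by
  have h1 : delbar (fun w => B w * del H a w) b z
      = ∑ γ, ∑ δ, (a γ * conj (b δ)) •
        delbar (fun w => B w * del H (Pi.single γ 1) w) (Pi.single δ 1) z := by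
    have dA : ∀ γ, DifferentiableAt ℝ (fun w => B w * del H (Pi.single γ 1) w) z := fun γ =>
      ContDiffOn.diffAt (D.smooth_A _) D.isOpen hz
    have h7 : (fun w => B w * del H a w)
        = fun w => ∑ γ, a γ • (B w * del H (Pi.single γ 1) w) := by
      funext w
      simp only [← mul_smul_comm]
      rw [← Finset.mul_sum, ← del_eq_sum]
    rw [h7, delbar_sum _ (fun γ _ => (dA γ).fun_const_smul (a γ))]
    refine Finset.sum_congr rfl fun γ _ => ?_
    rw [delbar_const_smul _ (dA γ), delbar_eq_sum _ b]
    simp only [Finset.smul_sum, smul_smul]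
  have h2 : B z * star (Φ z b) * H z
      = ∑ δ, conj (b δ) • (B z * star (Φ z (Pi.single δ 1)) * H z) := by
    rw [D.eq_sum z b, star_sum, Finset.mul_sum, Finset.sum_mul]
    refine Finset.sum_congr rfl fun δ _ => ?_
    rw [star_smul, mul_smul_comm, smul_mul_assoc]; rfl
  rw [higgsCurv, h1, h2, D.eq_sum z a]
  simp only [higgsCurv, smul_add, smul_neg, smul_sub, Finset.sum_add_distrib,
    Finset.sum_neg_distrib, Finset.sum_sub_distrib, Finset.sum_mul_sum, smul_mul_assoc,
    mul_smul_comm, smul_smul]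
  congr 2
  · simp only [mul_comm (conj _)]
  · rw [Finset.sum_comm]

end Sesquilinear

/-! ### Changes of coordinates -/

section Transition

open MatAlg

variable {n : ℕ} {X : Type*} [TopologicalSpace X] [ChartedSpace (Cn n) X]

/-- The coordinate change from the chart around `x₀` to the chart around `x₁`. -/
def trans (x₀ x₁ : X) (z : Cn n) : Cn n := chartAt (Cn n) x₁ (pt n X x₀ z)

variable (n) in
/-- The domain of the coordinate change between the charts around `x₀` and `x₁`. -/
def chartOverlap (x₀ x₁ : X) : Set (Cn n) :=
  (chartAt (Cn n) x₀).target ∩ pt n X x₀ ⁻¹' (chartAt (Cn n) x₁).source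

theorem isOpen_chartOverlap (x₀ x₁ : X) : IsOpen (chartOverlap n x₀ x₁) :=
  (chartAt (Cn n) x₀).isOpen_inter_preimage_symm (chartAt (Cn n) x₁).open_source

theorem pt_mem_source {x₀ : X} {z : Cn n} (hz : z ∈ (chartAt (Cn n) x₀).target) :
    pt n X x₀ z ∈ (chartAt (Cn n) x₀).source := (chartAt (Cn n) x₀).map_target hz

theorem chartAt_pt {x₀ : X} {z : Cn n} (hz : z ∈ (chartAt (Cn n) x₀).target) :
    chartAt (Cn n) x₀ (pt n X x₀ z) = z := (chartAt (Cn n) x₀).right_inv hz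

theorem pt_chartAt {x₀ x : X} (hx : x ∈ (chartAt (Cn n) x₀).source) :
    pt n X x₀ (chartAt (Cn n) x₀ x) = x := (chartAt (Cn n) x₀).left_inv hx

theorem pt_trans {x₀ x₁ : X} {z : Cn n} (hz : z ∈ chartOverlap n x₀ x₁) :
    pt n X x₁ (trans x₀ x₁ z) = pt n X x₀ z := pt_chartAt hz.2

theorem trans_mem {x₀ x₁ : X} {z : Cn n} (hz : z ∈ chartOverlap n x₀ x₁) :
    trans x₀ x₁ z ∈ chartOverlap n x₁ x₀ :=
  ⟨(chartAt (Cn n) x₁).map_source hz.2, by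
    rw [mem_preimage, pt_trans hz]; exact pt_mem_source hz.1⟩

theorem trans_trans {x₀ x₁ : X} {z : Cn n} (hz : z ∈ chartOverlap n x₀ x₁) :
    trans x₁ x₀ (trans x₀ x₁ z) = z := by
  rw [trans, pt_trans hz, chartAt_pt hz.1]

variable [IsManifold 𝓘(ℂ, Cn n) ω X]

theorem contDiffOn_trans (x₀ x₁ : X) : ContDiffOn ℂ ω (trans x₀ x₁) (chartOverlap n x₀ x₁) := by
  have h : (chartAt (Cn n) x₀).symm ≫ₕ (chartAt (Cn n) x₁) ∈ contDiffGroupoid ω 𝓘(ℂ, Cn n) :=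
    HasGroupoid.compatible (chart_mem_atlas _ x₀) (chart_mem_atlas _ x₁)
  rw [contDiffGroupoid, mem_groupoid_of_pregroupoid, contDiffPregroupoid] at h
  have h3 : ContDiffOn ℂ ω ((chartAt (Cn n) x₀).symm ≫ₕ (chartAt (Cn n) x₁))
      ((chartAt (Cn n) x₀).symm ≫ₕ (chartAt (Cn n) x₁)).source := by
    simpa using h.1
  exact h3

theorem differentiableAt_trans {x₀ x₁ : X} {z : Cn n} (hz : z ∈ chartOverlap n x₀ x₁) :
    DifferentiableAt ℂ (trans x₀ x₁) z :=
  ((contDiffOn_trans x₀ x₁).contDiffAt ((isOpen_chartOverlap x₀ x₁).mem_nhds hz)).differentiableAt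
    (by simp)

/-- The Jacobian matrix of the coordinate change. -/
def jac (x₀ x₁ : X) (z : Cn n) : Matrix (Fin n) (Fin n) ℂ :=
  LinearMap.toMatrix' (fderiv ℂ (trans x₀ x₁) z).toLinearMap

theorem jac_apply (x₀ x₁ : X) (z : Cn n) (γ α : Fin n) :
    jac x₀ x₁ z γ α = fderiv ℂ (trans x₀ x₁) z (Pi.single α 1) γ := by
  simp [jac, LinearMap.toMatrix'_apply]

theorem jac_mul_jac {x₀ x₁ : X} {z : Cn n} (hz : z ∈ chartOverlap n x₀ x₁) :
    jac x₁ x₀ (trans x₀ x₁ z) * jac x₀ x₁ z = 1 := by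
  have h1 := (differentiableAt_trans (trans_mem hz)).hasFDerivAt.comp z
    (differentiableAt_trans hz).hasFDerivAt
  have h2 : HasFDerivAt (trans x₁ x₀ ∘ trans x₀ x₁) (ContinuousLinearMap.id ℂ (Cn n)) z := by
    refine (hasFDerivAt_id z).congr_of_eventuallyEq ?_
    filter_upwards [(isOpen_chartOverlap x₀ x₁).mem_nhds hz] with z' hz' using trans_trans hz'
  have h3 := h1.unique h2
  rw [jac, jac, ← LinearMap.toMatrix'_comp]
  exact (congrArg (fun L : Cn n →L[ℂ] Cn n => LinearMap.toMatrix' L.toLinearMap) h3).trans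
    LinearMap.toMatrix'_id

theorem isUnit_jac {x₀ x₁ : X} {z : Cn n} (hz : z ∈ chartOverlap n x₀ x₁) :
    IsUnit (jac x₀ x₁ z) := by
  rw [Matrix.isUnit_iff_isUnit_det]
  exact Matrix.isUnit_det_of_left_inverse (jac_mul_jac hz)

/-- Between tangent frames induced by charts, the transition map is the derivative of the coordinate
change. -/
theorem coframeMap_frameMap_tangent {x₀ x₁ : X} {z : Cn n} (hz : z ∈ chartOverlap n x₀ x₁)
    (u : Cn n) :
    coframeMap n (fun x : X => TangentSpace 𝓘(ℂ, Cn n) x) x₁ (pt n X x₀ z)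
      (frameMap n (fun x : X => TangentSpace 𝓘(ℂ, Cn n) x) x₀ (pt n X x₀ z) u)
      = fderiv ℂ (trans x₀ x₁) z u := by
  have : IsManifold 𝓘(ℂ, Cn n) 1 X := IsManifold.of_le (n := ω) le_top
  have e1 : frameMap n (fun x : X => TangentSpace 𝓘(ℂ, Cn n) x) x₀ (pt n X x₀ z)
      = tangentCoordChange 𝓘(ℂ, Cn n) x₀ (pt n X x₀ z) (pt n X x₀ z) :=
    TangentBundle.symmL_trivializationAt_eq_core (pt_mem_source hz.1)
  have e2 : coframeMap n (fun x : X => TangentSpace 𝓘(ℂ, Cn n) x) x₁ (pt n X x₀ z)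
      = tangentCoordChange 𝓘(ℂ, Cn n) (pt n X x₀ z) x₁ (pt n X x₀ z) :=
    TangentBundle.continuousLinearMapAt_trivializationAt_eq_core hz.2
  rw [e1, e2]
  have e3 := tangentCoordChange_comp (I := 𝓘(ℂ, Cn n)) (w := x₀) (x := pt n X x₀ z) (y := x₁)
    (z := pt n X x₀ z) (v := u) ⟨⟨by simpa using pt_mem_source hz.1, by simp⟩, by
      simpa using hz.2⟩
  refine e3.trans ?_
  rw [tangentCoordChange_def]
  simp only [mfld_simps]
  rw [fderivWithin_univ]
  congr 2
  exact chartAt_pt hz.1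

theorem frameMap_tangent {x₀ x₁ : X} {z : Cn n} (hz : z ∈ chartOverlap n x₀ x₁) (u : Cn n) :
    frameMap n (fun x : X => TangentSpace 𝓘(ℂ, Cn n) x) x₀ (pt n X x₀ z) u
      = frameMap n (fun x : X => TangentSpace 𝓘(ℂ, Cn n) x) x₁ (pt n X x₀ z)
        (fderiv ℂ (trans x₀ x₁) z u) := by
  rw [← coframeMap_frameMap_tangent hz,
    frameMap_coframeMap n (fun x : X => TangentSpace 𝓘(ℂ, Cn n) x)]
  rw [TangentBundle.trivializationAt_baseSet]
  exact hz.2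

end Transition

/-! ### Changes of frames -/

section BundleTransition

open MatAlg

variable {n : ℕ} {X : Type*} [TopologicalSpace X] [ChartedSpace (Cn n) X]
  [IsManifold 𝓘(ℂ, Cn n) ω X]
variable {r : ℕ} {V : X → Type*} [TopologicalSpace (TotalSpace (Cn r) V)]
  [∀ x, AddCommGroup (V x)] [∀ x, Module ℂ (V x)] [∀ x, TopologicalSpace (V x)]
  [FiberBundle (Cn r) V] [VectorBundle ℂ (Cn r) V]

variable (n r V) in
/-- The set of coordinate vectors over which both charts and both frames, around `x₀` and around
`x₁`, are defined. -/
def frameOverlap (x₀ x₁ : X) : Set (Cn n) :=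
  chartOverlap n x₀ x₁ ∩ (coordDomain n r V x₀ ∩
    pt n X x₀ ⁻¹' (trivializationAt (Cn r) V x₁).baseSet)

variable (r V) in
/-- The transition matrix from the frame around `x₀` to the frame around `x₁`. -/
def transMat (x₀ x₁ y : X) : Matrix (Fin r) (Fin r) ℂ :=
  LinearMap.toMatrix' ((coframeMap r V x₁ y).toLinearMap ∘ₗ (frameMap r V x₀ y).toLinearMap)

theorem transMat_mulVec (x₀ x₁ y : X) (v : Cn r) :
    transMat r V x₀ x₁ y *ᵥ v = coframeMap r V x₁ y (frameMap r V x₀ y v) := by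
  rw [transMat, LinearMap.toMatrix'_mulVec]; rfl

theorem transMat_mul {x₀ x₁ y : X} (h₀ : y ∈ (trivializationAt (Cn r) V x₀).baseSet)
    (h₁ : y ∈ (trivializationAt (Cn r) V x₁).baseSet) :
    transMat r V x₁ x₀ y * transMat r V x₀ x₁ y = 1 := by
  refine Matrix.ext_of_mulVec_single fun i => ?_
  rw [← Matrix.mulVec_mulVec, transMat_mulVec, transMat_mulVec, frameMap_coframeMap r V h₁,
    coframeMap_frameMap r V h₀, Matrix.one_mulVec]

theorem isOpen_frameOverlap (x₀ x₁ : X) : IsOpen (frameOverlap n r V x₀ x₁) := by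
  have h : frameOverlap n r V x₀ x₁ = (chartAt (Cn n) x₀).target ∩ pt n X x₀ ⁻¹'
      ((chartAt (Cn n) x₁).source ∩ ((trivializationAt (Cn r) V x₀).baseSet ∩
        (trivializationAt (Cn r) V x₁).baseSet)) := by
    ext z
    simp only [frameOverlap, chartOverlap, coordDomain, mem_inter_iff, mem_preimage]
    tauto
  rw [h]
  exact (chartAt (Cn n) x₀).isOpen_inter_preimage_symm ((chartAt (Cn n) x₁).open_source.inter
    ((trivializationAt (Cn r) V x₀).open_baseSet.inter
      (trivializationAt (Cn r) V x₁).open_baseSet))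

theorem trans_mem_coordDomain {x₀ x₁ : X} {z : Cn n} (hz : z ∈ frameOverlap n r V x₀ x₁) :
    trans x₀ x₁ z ∈ coordDomain n r V x₁ :=
  ⟨(trans_mem hz.1).1, by rw [mem_preimage, pt_trans hz.1]; exact hz.2.2⟩

theorem HermitianForm.mat_transform (h : HermitianForm n r V) {x₀ x₁ : X} {z : Cn n}
    (hz : z ∈ frameOverlap n r V x₀ x₁) :
    h.mat x₀ z = (transMat r V x₀ x₁ (pt n X x₀ z))ᴴ * h.mat x₁ (trans x₀ x₁ z)
      * transMat r V x₀ x₁ (pt n X x₀ z) := by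
  have key : ∀ u v, star u ⬝ᵥ (h.mat x₀ z *ᵥ v) = star u ⬝ᵥ
      (((transMat r V x₀ x₁ (pt n X x₀ z))ᴴ * h.mat x₁ (trans x₀ x₁ z)
      * transMat r V x₀ x₁ (pt n X x₀ z)) *ᵥ v) := by
    intro u v
    have h1 := h.form_frameMap x₁ (trans x₀ x₁ z) (transMat r V x₀ x₁ (pt n X x₀ z) *ᵥ u)
      (transMat r V x₀ x₁ (pt n X x₀ z) *ᵥ v)
    rw [pt_trans hz.1, transMat_mulVec, transMat_mulVec, frameMap_coframeMap r V hz.2.2,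
      frameMap_coframeMap r V hz.2.2, h.form_frameMap, ← transMat_mulVec, ← transMat_mulVec] at h1
    rw [h1, Matrix.star_mulVec, ← Matrix.dotProduct_mulVec, Matrix.mulVec_mulVec,
      Matrix.mulVec_mulVec, Matrix.mul_assoc]
  refine Matrix.ext_of_mulVec_single fun j => ?_
  ext i
  have h2 := key (Pi.single i 1) (Pi.single j 1)
  simpa using h2

theorem endMatrix_transform {x₀ x₁ y : X} (h₁ : y ∈ (trivializationAt (Cn r) V x₁).baseSet)
    (A : Module.End ℂ (V y)) :
    endMatrix r x₀ y A = transMat r V x₁ x₀ y * endMatrix r x₁ y A * transMat r V x₀ x₁ y := by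
  refine Matrix.ext_of_mulVec_single fun j => ?_
  rw [← Matrix.mulVec_mulVec, ← Matrix.mulVec_mulVec, transMat_mulVec, transMat_mulVec,
    endMatrix_mulVec, endMatrix_mulVec, frameMap_coframeMap r V h₁, frameMap_coframeMap r V h₁]

theorem HiggsField.mat_transform (φ : HiggsField n r V) {x₀ x₁ : X} {z : Cn n}
    (hz : z ∈ frameOverlap n r V x₀ x₁) (u : Cn n) :
    φ.mat x₀ z u = transMat r V x₁ x₀ (pt n X x₀ z)
      * φ.mat x₁ (trans x₀ x₁ z) (fderiv ℂ (trans x₀ x₁) z u)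
      * transMat r V x₀ x₁ (pt n X x₀ z) := by
  have gen : ∀ y, y = pt n X x₀ z → ∀ w, endMatrix r x₁ y
      (φ.field y (frameMap n (fun x : X => TangentSpace 𝓘(ℂ, Cn n) x) x₁ y w))
      = endMatrix r x₁ (pt n X x₀ z) (φ.field _
        (frameMap n (fun x : X => TangentSpace 𝓘(ℂ, Cn n) x) x₁ (pt n X x₀ z) w)) := by
    rintro y rfl w; rfl
  rw [HiggsField.mat, HiggsField.mat, gen _ (pt_trans hz.1), ← frameMap_tangent hz.1]
  exact endMatrix_transform hz.2.2 _

variable (n X) in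
theorem coordDomain_tangent (x₀ : X) :
    coordDomain n n (fun x : X => TangentSpace 𝓘(ℂ, Cn n) x) x₀ = (chartAt (Cn n) x₀).target := by
  ext z
  simp only [coordDomain, mem_inter_iff, mem_preimage, TangentBundle.trivializationAt_baseSet]
  exact ⟨fun h => h.1, fun h => ⟨h, pt_mem_source h⟩⟩

theorem KahlerMetric.mat_transform (g : KahlerMetric n X) {x₀ x₁ : X} {z : Cn n}
    (hz : z ∈ chartOverlap n x₀ x₁) :
    g.mat x₀ z = (jac x₀ x₁ z)ᴴ * g.mat x₁ (trans x₀ x₁ z) * jac x₀ x₁ z := by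
  have h1 : jac x₀ x₁ z
      = transMat n (fun x : X => TangentSpace 𝓘(ℂ, Cn n) x) x₀ x₁ (pt n X x₀ z) := by
    refine Matrix.ext_of_mulVec_single fun j => ?_
    rw [transMat_mulVec, coframeMap_frameMap_tangent hz, jac, LinearMap.toMatrix'_mulVec]; rfl
  rw [h1]
  refine g.toHermitianForm.mat_transform ⟨hz, ?_, ?_⟩
  · rw [coordDomain_tangent]; exact hz.1
  · rw [mem_preimage, TangentBundle.trivializationAt_baseSet]; exact hz.2

open scoped ComplexOrder in
theorem KahlerMetric.posDef (g : KahlerMetric n X) {x₀ : X} {z : Cn n}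
    (hz : z ∈ (chartAt (Cn n) x₀).target) : (g.mat x₀ z).PosDef :=
  g.toHermitianMetric.posDef (by rwa [coordDomain_tangent])

theorem contDiffOn_transMat [ContMDiffVectorBundle ω (Cn r) V 𝓘(ℂ, Cn n)] (x₀ x₁ : X) :
    ContDiffOn ℂ ∞ (fun z => toAlg (transMat r V x₀ x₁ (pt n X x₀ z)))
      {z | z ∈ (chartAt (Cn n) x₀).target ∧ pt n X x₀ z ∈
        (trivializationAt (Cn r) V x₀).baseSet ∩ (trivializationAt (Cn r) V x₁).baseSet} := by
  have h1 := contMDiffOn_coordChangeL (IB := 𝓘(ℂ, Cn n)) (n := ω)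
    (trivializationAt (Cn r) V x₀) (trivializationAt (Cn r) V x₁)
  have h2 : ContMDiffOn 𝓘(ℂ, Cn n) 𝓘(ℂ, Cn n) ω (pt n X x₀) (chartAt (Cn n) x₀).target :=
    contMDiffOn_chart_symm
  have h3 := (h1.comp (s := {z | z ∈ (chartAt (Cn n) x₀).target ∧ pt n X x₀ z ∈
        (trivializationAt (Cn r) V x₀).baseSet ∩ (trivializationAt (Cn r) V x₁).baseSet})
      (h2.mono fun z hz => hz.1) fun z hz => hz.2).contDiffOn
  refine contDiffOn_complex_of_entries fun i j => ?_
  have h4 : ContDiffOn ℂ ω (fun z => ((trivializationAt (Cn r) V x₀).coordChangeL ℂ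
      (trivializationAt (Cn r) V x₁) (pt n X x₀ z) : Cn r →L[ℂ] Cn r) (Pi.single j 1) i)
      {z | z ∈ (chartAt (Cn n) x₀).target ∧ pt n X x₀ z ∈
        (trivializationAt (Cn r) V x₀).baseSet ∩ (trivializationAt (Cn r) V x₁).baseSet} :=
    contDiffOn_pi.1 (h3.clm_apply contDiffOn_const) i
  refine (h4.of_le le_top).congr fun z hz => ?_
  rw [entry_toAlg, transMat, LinearMap.toMatrix'_apply]
  simp only [LinearMap.comp_apply, ContinuousLinearMap.coe_coe, coframeMap, frameMap]
  rw [ContinuousLinearEquiv.coe_coe, Trivialization.coordChangeL_apply _ _ hz.2,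
    Trivialization.continuousLinearMapAt_apply, Trivialization.coe_linearMapAt_of_mem _ hz.2.2,
    Trivialization.symmL_apply]
  exact hz.2.1

end BundleTransition

/-! ### The mean curvature and its covariant derivative -/

section MeanCurvature

open MatAlg
open scoped ComplexOrder

variable {n : ℕ} {X : Type*} [TopologicalSpace X] [ChartedSpace (Cn n) X]
  [IsManifold 𝓘(ℂ, Cn n) ω X]
variable {r : ℕ} {V : X → Type*} [TopologicalSpace (TotalSpace (Cn r) V)]
  [∀ x, AddCommGroup (V x)] [∀ x, Module ℂ (V x)] [∀ x, TopologicalSpace (V x)]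
  [FiberBundle (Cn r) V] [VectorBundle ℂ (Cn r) V]

/-- The matrix `∑ g^{αβ̄} (F_{αβ̄} + [φ_α, φ^*_β̄])` of the mean curvature in the chart and the
frame around `x₀`. -/
def meanCurv (g : KahlerMetric n X) (φ : HiggsField n r V) (h : HermitianMetric n r V) (x₀ : X)
    (z : Cn n) : MatAlg r :=
  contract (g.mat x₀ z) fun α β => higgsCurv (h.alg x₀) (h.algInv x₀) (φ.alg x₀)
    (Pi.single α 1) (Pi.single β 1) z

theorem toAlg_hsMeanCurvature (g : KahlerMetric n X) (φ : HiggsField n r V)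
    (h : HermitianMetric n r V) {x₀ : X} {z : Cn n} (hz : z ∈ coordDomain n r V x₀) :
    toAlg (Complex.I • lefschetzLambda (g.mat x₀ z) (hsCurvature φ h x₀ z))
      = meanCurv g φ h x₀ z := by
  rw [lefschetzLambda, smul_smul, mul_neg, Complex.I_mul_I, neg_neg, one_smul, meanCurv, contract]
  simp only [toAlg_sum, toAlg_smul, toAlg_coeff11_hsCurvature φ h hz]

theorem KahlerMetric.contDiffOn_inv_entry (g : KahlerMetric n X) (x₀ : X) (α β : Fin n) :
    ContDiffOn ℝ ∞ (fun z => (g.mat x₀ z)⁻¹ α β) (chartAt (Cn n) x₀).target := by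
  have h := g.toHermitianMetric.contDiffOn_algInv x₀
  rw [coordDomain_tangent] at h
  exact ((entry α β).restrictScalars ℝ).contDiff.comp_contDiffOn h

theorem contDiffOn_contract (g : KahlerMetric n X) (x₀ : X) {E : Type*} [NormedAddCommGroup E]
    [NormedSpace ℝ E] {F : Type*} [NormedAddCommGroup F] [NormedSpace ℝ F] [NormedSpace ℂ F]
    [IsScalarTower ℝ ℂ F]
    {pr : E → Cn n} (hpr : ContDiff ℝ ∞ pr) {U : Set E}
    (hU : MapsTo pr U (chartAt (Cn n) x₀).target) {S : Fin n → Fin n → E → F}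
    (hS : ∀ α β, ContDiffOn ℝ ∞ (S α β) U) :
    ContDiffOn ℝ ∞ (fun p => contract (g.mat x₀ (pr p)) fun α β => S α β p) U :=
  ContDiffOn.sum fun α _ => ContDiffOn.sum fun β _ =>
    ((g.contDiffOn_inv_entry x₀ α β).comp hpr.contDiffOn hU).smul (hS α β)

theorem contDiffOn_meanCurv (g : KahlerMetric n X) (φ : HiggsField n r V)
    (h : HermitianMetric n r V) (x₀ : X) :
    ContDiffOn ℝ ∞ (meanCurv g φ h x₀) (coordDomain n r V x₀) :=
  contDiffOn_contract g x₀ contDiff_id (fun _ hz => hz.1) fun _ _ =>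
    (frameData φ h x₀).smooth_higgsCurv _ _

theorem KahlerMetric.inv_conj (g : KahlerMetric n X) (x₀ : X) (z : Cn n) (α β : Fin n) :
    conj ((g.mat x₀ z)⁻¹ α β) = (g.mat x₀ z)⁻¹ β α := by
  have h := (g.toHermitianForm.isHermitian x₀ z).inv
  have h2 := congrFun (congrFun h β) α
  simpa [Matrix.conjTranspose_apply] using h2

/-- The mean curvature is self-adjoint. -/
theorem meanCurv_adj (g : KahlerMetric n X) (φ : HiggsField n r V) (h : HermitianMetric n r V)
    {x₀ : X} {z : Cn n} (hz : z ∈ coordDomain n r V x₀) :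
    h.algInv x₀ z * star (meanCurv g φ h x₀ z) * h.alg x₀ z = meanCurv g φ h x₀ z := by
  have D := frameData φ h x₀
  have e1 : h.algInv x₀ z * star (meanCurv g φ h x₀ z) * h.alg x₀ z
      = ∑ α, ∑ β, (g.mat x₀ z)⁻¹ β α • higgsCurv (h.alg x₀) (h.algInv x₀) (φ.alg x₀)
        (Pi.single β 1) (Pi.single α 1) z := by
    simp only [meanCurv, contract, star_sum, star_smul, Finset.mul_sum, Finset.sum_mul,
      mul_smul_comm, smul_mul_assoc, D.higgsCurv_adj hz, Complex.star_def, g.inv_conj]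
  rw [e1, Finset.sum_comm]; rfl

/-- The transition data between two frames in the normed algebra of matrices. -/
theorem transition_data [ContMDiffVectorBundle ω (Cn r) V 𝓘(ℂ, Cn n)] (x₀ x₁ : X) :
    ContDiffOn ℂ ∞ (fun z => toAlg (transMat r V x₀ x₁ (pt n X x₀ z)))
      (frameOverlap n r V x₀ x₁) ∧
    ContDiffOn ℂ ∞ (fun z => toAlg (transMat r V x₁ x₀ (pt n X x₀ z)))
      (frameOverlap n r V x₀ x₁) ∧
    (∀ z ∈ frameOverlap n r V x₀ x₁, toAlg (transMat r V x₀ x₁ (pt n X x₀ z))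
      * toAlg (transMat r V x₁ x₀ (pt n X x₀ z)) = 1) ∧
    (∀ z ∈ frameOverlap n r V x₀ x₁, toAlg (transMat r V x₁ x₀ (pt n X x₀ z))
      * toAlg (transMat r V x₀ x₁ (pt n X x₀ z)) = 1) := by
  refine ⟨(contDiffOn_transMat x₀ x₁).mono fun z hz => ⟨hz.1.1, hz.2.1.2, hz.2.2⟩, ?_, ?_, ?_⟩
  · have h1 : ContDiffOn ℂ ∞ (trans x₀ x₁) (frameOverlap n r V x₀ x₁) :=
      ((contDiffOn_trans x₀ x₁).mono fun z hz => hz.1).of_le le_top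
    refine ((contDiffOn_transMat (V := V) x₁ x₀).comp h1 fun z hz => ?_).congr fun z hz => ?_
    · refine ⟨(trans_mem hz.1).1, ?_⟩
      rw [pt_trans hz.1]
      exact ⟨hz.2.2, hz.2.1.2⟩
    · simp only [Function.comp_apply, pt_trans hz.1]
  · intro z hz
    rw [← toAlg_mul, transMat_mul hz.2.2 hz.2.1.2, toAlg_one]
  · intro z hz
    rw [← toAlg_mul, transMat_mul hz.2.1.2 hz.2.2, toAlg_one]

theorem alg_transform (h : HermitianForm n r V) {x₀ x₁ : X} {z : Cn n}
    (hz : z ∈ frameOverlap n r V x₀ x₁) :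
    h.alg x₀ z = star (toAlg (transMat r V x₀ x₁ (pt n X x₀ z))) * h.alg x₁ (trans x₀ x₁ z)
      * toAlg (transMat r V x₀ x₁ (pt n X x₀ z)) :=
  congrArg toAlg (h.mat_transform hz)

theorem higgs_alg_transform (φ : HiggsField n r V) {x₀ x₁ : X} {z : Cn n}
    (hz : z ∈ frameOverlap n r V x₀ x₁) (u : Cn n) :
    φ.alg x₀ z u = toAlg (transMat r V x₁ x₀ (pt n X x₀ z))
      * φ.alg x₁ (trans x₀ x₁ z) (fderiv ℂ (trans x₀ x₁) z u)
      * toAlg (transMat r V x₀ x₁ (pt n X x₀ z)) :=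
  congrArg toAlg (φ.mat_transform hz u)

theorem contract_jac {F : Type*} [AddCommGroup F] [Module ℂ F] (g : KahlerMetric n X) {x₀ x₁ : X}
    {z : Cn n} (hz : z ∈ chartOverlap n x₀ x₁) {S₀ S₁ : Fin n → Fin n → F}
    (hS : ∀ α β, S₀ α β = ∑ γ, ∑ δ, (fderiv ℂ (trans x₀ x₁) z (Pi.single α 1) γ
      * conj (fderiv ℂ (trans x₀ x₁) z (Pi.single β 1) δ)) • S₁ γ δ) :
    contract (g.mat x₀ z) S₀ = contract (g.mat x₁ (trans x₀ x₁ z)) S₁ := by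
  refine contract_transform (isUnit_jac hz) (g.mat_transform hz) fun α β => ?_
  simp only [jac_apply, hS]

/-- The local matrices of the mean curvature define one endomorphism. -/
theorem meanCurv_transform [ContMDiffVectorBundle ω (Cn r) V 𝓘(ℂ, Cn n)] (g : KahlerMetric n X)
    (φ : HiggsField n r V) (h : HermitianMetric n r V) {x₀ x₁ : X} {z : Cn n}
    (hz : z ∈ frameOverlap n r V x₀ x₁) :
    meanCurv g φ h x₀ z = toAlg (transMat r V x₁ x₀ (pt n X x₀ z))
      * meanCurv g φ h x₁ (trans x₀ x₁ z) * toAlg (transMat r V x₀ x₁ (pt n X x₀ z)) := by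
  obtain ⟨hP, hQ, hPQ, hQP⟩ := transition_data (n := n) (r := r) (V := V) x₀ x₁
  have D := frameData φ h x₀
  have D' := frameData φ h x₁
  have hτ : ContDiffOn ℂ ∞ (trans x₀ x₁) (frameOverlap n r V x₀ x₁) :=
    ((contDiffOn_trans x₀ x₁).mono fun z hz => hz.1).of_le le_top
  have hR := fun a b => D.higgsCurv_transform D' (isOpen_frameOverlap x₀ x₁)
    (fun z hz => hz.2.1) hτ (fun z hz => trans_mem_coordDomain hz) hP hQ hPQ hQP
    (fun z hz => alg_transform h.toHermitianForm hz) (fun z hz a => higgs_alg_transform φ hz a)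
    hz a b
  rw [meanCurv, contract_jac g hz.1 (S₁ := fun γ δ => toAlg (transMat r V x₁ x₀ (pt n X x₀ z))
      * higgsCurv (h.alg x₁) (h.algInv x₁) (φ.alg x₁) (Pi.single γ 1) (Pi.single δ 1)
        (trans x₀ x₁ z) * toAlg (transMat r V x₀ x₁ (pt n X x₀ z)))]
  · simp only [meanCurv, contract, Finset.mul_sum, Finset.sum_mul, mul_smul_comm, smul_mul_assoc]
  · intro α β
    rw [hR, D'.higgsCurv_eq_sum (trans_mem_coordDomain hz)]
    simp only [Finset.mul_sum, Finset.sum_mul, mul_smul_comm, smul_mul_assoc]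

theorem mem_frameOverlap_pt {x₀ : X} {z : Cn n} (hz : z ∈ coordDomain n r V x₀) :
    z ∈ frameOverlap n r V x₀ (pt n X x₀ z) :=
  ⟨⟨hz.1, mem_chart_source _ _⟩, hz, mem_baseSet_trivializationAt _ _ _⟩

theorem chartAt_mem_coordDomain (x : X) : chartAt (Cn n) x x ∈ coordDomain n r V x :=
  ⟨mem_chart_target _ _, by
    rw [mem_preimage, pt_chartAt (mem_chart_source _ _)]
    exact mem_baseSet_trivializationAt _ _ _⟩

/-- The matrix of the mean curvature endomorphism in an arbitrary frame. -/
theorem toAlg_endMatrix_hsMeanCurvature [ContMDiffVectorBundle ω (Cn r) V 𝓘(ℂ, Cn n)]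
    (g : KahlerMetric n X) (φ : HiggsField n r V) (h : HermitianMetric n r V) {x₀ : X} {z : Cn n}
    (hz : z ∈ coordDomain n r V x₀) :
    toAlg (endMatrix r x₀ (pt n X x₀ z) (hsMeanCurvature g φ h (pt n X x₀ z)))
      = meanCurv g φ h x₀ z := by
  rw [endMatrix_transform (x₁ := pt n X x₀ z) (mem_baseSet_trivializationAt _ _ _), toAlg_mul,
    toAlg_mul, hsMeanCurvature, endMatrix_endOfMatrix (mem_baseSet_trivializationAt _ _ _),
    toAlg_hsMeanCurvature g φ h (chartAt_mem_coordDomain _),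
    meanCurv_transform g φ h (mem_frameOverlap_pt hz)]
  rfl

theorem tr_conjugate {p q : MatAlg r} (hpq : p * q = 1) (x : MatAlg r) :
    tr r (q * x * p) = tr r x := by
  rw [tr_mul_comm, ← mul_assoc, hpq, one_mul]

/-- The pointwise squared norm of the mean curvature is `tr 𝒦²`, in every frame. -/
theorem endNormSq_hsMeanCurvature [ContMDiffVectorBundle ω (Cn r) V 𝓘(ℂ, Cn n)]
    (g : KahlerMetric n X) (φ : HiggsField n r V) (h : HermitianMetric n r V) {x₀ : X} {z : Cn n}
    (hz : z ∈ coordDomain n r V x₀) :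
    endNormSq h (pt n X x₀ z) (hsMeanCurvature g φ h (pt n X x₀ z))
      = (tr r (meanCurv g φ h x₀ z * meanCurv g φ h x₀ z)).re := by
  obtain ⟨-, -, hPQ, -⟩ := transition_data (n := n) (r := r) (V := V) x₀ (pt n X x₀ z)
  have hz' := mem_frameOverlap_pt hz
  set x := pt n X x₀ z with hx
  have e1 : toAlg (endMatrix r x x (hsMeanCurvature g φ h x))
      = meanCurv g φ h x (chartAt (Cn n) x x) := by
    rw [hsMeanCurvature, endMatrix_endOfMatrix (mem_baseSet_trivializationAt _ _ _),
      toAlg_hsMeanCurvature g φ h (chartAt_mem_coordDomain _)]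
  have e2 : toAlg (matAdjoint (h.mat x (chartAt (Cn n) x x))
      (endMatrix r x x (hsMeanCurvature g φ h x))) = meanCurv g φ h x (chartAt (Cn n) x x) := by
    rw [matAdjoint, toAlg_mul, toAlg_mul, toAlg_conjTranspose, e1]
    exact meanCurv_adj g φ h (chartAt_mem_coordDomain _)
  have h4 : ∀ y, toAlg (transMat r V x₀ x (pt n X x₀ z)) *
      (toAlg (transMat r V x x₀ (pt n X x₀ z)) * y) = y := fun y => by
    rw [← mul_assoc, hPQ z hz', one_mul]
  rw [endNormSq, ← tr_toAlg, toAlg_mul, e1, e2, meanCurv_transform g φ h hz']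
  rw [show trans x₀ x z = chartAt (Cn n) x x from rfl]
  rw [show ∀ p q k : MatAlg r, (q * k * p) * (q * k * p) = q * (k * (p * (q * k))) * p by
    intro p q k; noncomm_ring, h4, tr_conjugate (hPQ z hz')]

theorem algInv_transform {x₀ x₁ : X} [ContMDiffVectorBundle ω (Cn r) V 𝓘(ℂ, Cn n)]
    (h : HermitianMetric n r V) (φ : HiggsField n r V) {z : Cn n}
    (hz : z ∈ frameOverlap n r V x₀ x₁) :
    h.algInv x₀ z = toAlg (transMat r V x₁ x₀ (pt n X x₀ z)) * h.algInv x₁ (trans x₀ x₁ z)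
      * star (toAlg (transMat r V x₁ x₀ (pt n X x₀ z))) := by
  obtain ⟨-, -, hPQ, hQP⟩ := transition_data (n := n) (r := r) (V := V) x₀ x₁
  exact (frameData φ h x₀).B_transform (frameData φ h x₁) hz.2.1 (trans_mem_coordDomain hz)
    (hPQ z hz) (hQP z hz) (alg_transform h.toHermitianForm hz)

/-- The Hitchin–Simpson covariant derivative of the mean curvature vanishes at `x` if and only if
`D'𝒦` and `[φ, 𝒦]` vanish at `x`. -/
theorem hsCovDeriv_eq_zero_iff [ContMDiffVectorBundle ω (Cn r) V 𝓘(ℂ, Cn n)]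
    (g : KahlerMetric n X) (φ : HiggsField n r V) (h : HermitianMetric n r V) (x : X) :
    (∀ u : TangentSpace 𝓘(ℂ, Cn n) x, hsCovDeriv φ h (hsMeanCurvature g φ h) x u = 0) ↔
    ∀ u : Cn n, covDel (h.alg x) (h.algInv x) (meanCurv g φ h x) u (chartAt (Cn n) x x) = 0 ∧
      φ.alg x (chartAt (Cn n) x x) u * meanCurv g φ h x (chartAt (Cn n) x x)
        - meanCurv g φ h x (chartAt (Cn n) x x) * φ.alg x (chartAt (Cn n) x x) u = 0 := by
  have D := frameData φ h x
  have hz := chartAt_mem_coordDomain (n := n) (r := r) (V := V) x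
  have hK := contDiffOn_meanCurv g φ h x
  rw [← D.parallel_iff hK (fun z hz => meanCurv_adj g φ h hz) hz]
  set z := chartAt (Cn n) x x with hzdef
  have hev : (fun z' => toAlg (endMatrix r x (pt n X x z') (hsMeanCurvature g φ h (pt n X x z'))))
      =ᶠ[𝓝 z] meanCurv g φ h x := by
    filter_upwards [D.isOpen.mem_nhds hz] with z' hz'
      using toAlg_endMatrix_hsMeanCurvature g φ h hz'
  have key : ∀ u : Cn n, hsCovDeriv φ h (hsMeanCurvature g φ h) x
      (frameMap n (fun y : X => TangentSpace 𝓘(ℂ, Cn n) y) x x u) = 0 ↔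
      fderiv ℝ (meanCurv g φ h x) z u + ((h.algInv x z * del (h.alg x) u z + φ.alg x z u
        + h.algInv x z * star (φ.alg x z u) * h.alg x z) * meanCurv g φ h x z
      - meanCurv g φ h x z * (h.algInv x z * del (h.alg x) u z + φ.alg x z u
        + h.algInv x z * star (φ.alg x z u) * h.alg x z)) = 0 := by
    intro u
    rw [hsCovDeriv, endOfMatrix_eq_zero_iff (mem_baseSet_trivializationAt _ _ _),
      coframeMap_frameMap n (fun y : X => TangentSpace 𝓘(ℂ, Cn n) y)
        (mem_baseSet_trivializationAt _ _ _)]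
    rw [← toAlg_hsForm φ h hz, ← hev.fderiv_eq, ← toAlg_endMatrix_hsMeanCurvature g φ h hz,
      ← toAlg_matDeriv ((ContDiffOn.diffAt hK D.isOpen hz).congr_of_eventuallyEq hev)]
    rfl
  constructor
  · exact fun H u => (key u).1 (H _)
  · intro H u
    have h1 := (key (coframeMap n (fun y : X => TangentSpace 𝓘(ℂ, Cn n) y) x x u)).2 (H _)
    rwa [frameMap_coframeMap n (fun y : X => TangentSpace 𝓘(ℂ, Cn n) y)
        (mem_baseSet_trivializationAt _ _ _)] at h1

/-- If the mean curvature is parallel, then `D'𝒦` and `[φ, 𝒦]` vanish in every chart and frame. -/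
theorem parallel_in_frame [ContMDiffVectorBundle ω (Cn r) V 𝓘(ℂ, Cn n)]
    (g : KahlerMetric n X) (φ : HiggsField n r V) (h : HermitianMetric n r V)
    (hpar : IsHSParallel φ h (hsMeanCurvature g φ h)) {x₀ : X} {z : Cn n}
    (hz : z ∈ coordDomain n r V x₀) (u : Cn n) :
    covDel (h.alg x₀) (h.algInv x₀) (meanCurv g φ h x₀) u z = 0 ∧
      φ.alg x₀ z u * meanCurv g φ h x₀ z - meanCurv g φ h x₀ z * φ.alg x₀ z u = 0 := by
  obtain ⟨hP, hQ, hPQ, hQP⟩ := transition_data (n := n) (r := r) (V := V) x₀ (pt n X x₀ z)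
  have hz' := mem_frameOverlap_pt hz
  have hp := fun u => (hsCovDeriv_eq_zero_iff g φ h (pt n X x₀ z)).1 (hpar (pt n X x₀ z)) u
  set x := pt n X x₀ z with hx
  have hτ : ContDiffOn ℂ ∞ (trans x₀ x) (frameOverlap n r V x₀ x) :=
    ((contDiffOn_trans x₀ x).mono fun z hz => hz.1).of_le le_top
  have hτz : trans x₀ x z = chartAt (Cn n) x x := rfl
  constructor
  · rw [(frameData φ h x₀).covDel_transform (frameData φ h x) (isOpen_frameOverlap x₀ x)
      (fun z hz => hz.2.1) hτ (fun z hz => trans_mem_coordDomain hz) hP hQ hPQ hQP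
      (fun z hz => alg_transform h.toHermitianForm hz) (contDiffOn_meanCurv g φ h x)
      (fun z hz => meanCurv_transform g φ h hz) hz' u, hτz, (hp _).1]
    simp
  · have h4 : ∀ y, toAlg (transMat r V x₀ x (pt n X x₀ z)) *
      (toAlg (transMat r V x x₀ (pt n X x₀ z)) * y) = y := fun y => by
      rw [← mul_assoc, hPQ z hz', one_mul]
    have h5 := (hp (fderiv ℂ (trans x₀ x) z u)).2
    rw [meanCurv_transform g φ h hz', higgs_alg_transform φ hz' u, hτz]
    have h6 := congrArg (fun y => toAlg (transMat r V x x₀ (pt n X x₀ z)) * y *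
      toAlg (transMat r V x₀ x (pt n X x₀ z))) h5
    simp only [mul_sub, sub_mul, mul_assoc, mul_zero, zero_mul] at h6
    simp only [mul_assoc, h4]
    exact h6

end MeanCurvature

/-! ### The operator `□` on functions -/

section ScalarLaplacian

variable {n : ℕ} {X : Type*} [TopologicalSpace X] [ChartedSpace (Cn n) X]
  [IsManifold 𝓘(ℂ, Cn n) ω X]

variable (n) in
/-- A function on `X` is smooth if it is smooth in all charts. -/
def SmoothInCharts {E : Type*} [NormedAddCommGroup E] [NormedSpace ℝ E] (f : X → E) : Prop :=
  ∀ x₀ : X, ContDiffOn ℝ ∞ (fun z => f (pt n X x₀ z)) (chartAt (Cn n) x₀).target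

/-- The operator `□ f = ∑ g^{αβ̄} ∂_β̄ ∂_α f` in the chart around `x₀`. -/
def boxIn (g : KahlerMetric n X) (f : X → ℂ) (x₀ : X) (z : Cn n) : ℂ :=
  contract (g.mat x₀ z) fun α β =>
    delbar (del (fun z => f (pt n X x₀ z)) (Pi.single α 1)) (Pi.single β 1) z

/-- The operator `□ f = ∑ g^{αβ̄} ∂_β̄ ∂_α f` on functions. -/
def box (g : KahlerMetric n X) (f : X → ℂ) (x : X) : ℂ := boxIn g f x (chartAt (Cn n) x x)

theorem contDiffOn_boxIn (g : KahlerMetric n X) {f : X → ℂ} (hf : SmoothInCharts n f) (x₀ : X) :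
    ContDiffOn ℝ ∞ (boxIn g f x₀) (chartAt (Cn n) x₀).target :=
  contDiffOn_contract g x₀ contDiff_id (fun _ hz => hz) fun _ _ =>
    ContDiffOn.delbar (ContDiffOn.del (hf x₀) (chartAt (Cn n) x₀).open_target _)
      (chartAt (Cn n) x₀).open_target _

/-- The mixed second derivatives of a function composed with a holomorphic map. -/
theorem delbar_del_comp {m : ℕ} {f : Cn m → ℂ} {U' : Set (Cn m)} (hU' : IsOpen U')
    (hf : ContDiffOn ℝ ∞ f U') {W : Set (Cn n)} (hW : IsOpen W) {τ : Cn n → Cn m}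
    (hτ : ContDiffOn ℂ ∞ τ W) (hτU : MapsTo τ W U') {z : Cn n} (hz : z ∈ W) (a b : Cn n) :
    delbar (del (fun z => f (τ z)) a) b z = ∑ γ, ∑ δ, (fderiv ℂ τ z a γ *
      conj (fderiv ℂ τ z b δ)) • delbar (del f (Pi.single γ 1)) (Pi.single δ 1) (τ z) := by
  have dτ : ∀ z ∈ W, DifferentiableAt ℂ τ z := fun z hz =>
    (hτ.contDiffAt (hW.mem_nhds hz)).differentiableAt (by simp)
  have dc : ∀ γ, DifferentiableAt ℂ (fun z => fderiv ℂ τ z a γ) z := fun γ => by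
    have h1 : ContDiffOn ℂ ∞ (fun z => fderiv ℂ τ z a) W :=
      (hτ.fderiv_of_isOpen hW (m := ∞) (by exact le_rfl)).clm_apply contDiffOn_const
    exact differentiableAt_pi.1 ((h1.contDiffAt (hW.mem_nhds hz)).differentiableAt (by simp)) γ
  have df : ∀ γ, DifferentiableAt ℝ (del f (Pi.single γ 1)) (τ z) := fun γ =>
    ContDiffOn.diffAt (ContDiffOn.del hf hU' _) hU' (hτU hz)
  have dfτ : ∀ γ, DifferentiableAt ℝ (fun z => del f (Pi.single γ 1) (τ z)) z := fun γ =>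
    (df γ).comp z ((dτ z hz).restrictScalars ℝ)
  rw [delbar_congr (g := fun z => ∑ γ, fderiv ℂ τ z a γ • del f (Pi.single γ 1) (τ z))
    (by filter_upwards [hW.mem_nhds hz] with z' hz'
        rw [del_comp (ContDiffOn.diffAt hf hU' (hτU hz')) (dτ z' hz'), del_eq_sum]),
    delbar_sum _ fun γ _ => ((dc γ).restrictScalars ℝ).fun_smul (dfτ γ)]
  refine Finset.sum_congr rfl fun γ _ => ?_
  rw [delbar_smul ((dc γ).restrictScalars ℝ) (dfτ γ), delbar_of_holomorphic (dc γ), zero_smul,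
    zero_add, delbar_comp (df γ) (dτ z hz), delbar_eq_sum]
  simp only [Finset.smul_sum, smul_smul]

/-- The operator `□` does not depend on the chart. -/
theorem boxIn_eq_box (g : KahlerMetric n X) {f : X → ℂ} (hf : SmoothInCharts n f) {x₀ : X}
    {z : Cn n} (hz : z ∈ (chartAt (Cn n) x₀).target) :
    boxIn g f x₀ z = box g f (pt n X x₀ z) := by
  have hz' : z ∈ chartOverlap n x₀ (pt n X x₀ z) := ⟨hz, mem_chart_source _ _⟩
  set x := pt n X x₀ z with hx
  have hW := isOpen_chartOverlap (n := n) x₀ x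
  refine contract_jac g hz' fun α β => ?_
  have hev : (fun z => f (pt n X x₀ z)) =ᶠ[𝓝 z] fun z => f (pt n X x (trans x₀ x z)) := by
    filter_upwards [hW.mem_nhds hz'] with z' hz'
    rw [pt_trans hz']
  have hev2 : del (fun z => f (pt n X x₀ z)) (Pi.single α 1) =ᶠ[𝓝 z]
      del (fun z => f (pt n X x (trans x₀ x z))) (Pi.single α 1) := by
    filter_upwards [hev.eventuallyEq_nhds] with z' hz' using del_congr hz' _
  rw [delbar_congr hev2]
  exact delbar_del_comp (chartAt (Cn n) x).open_target (hf x) hW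
    ((contDiffOn_trans x₀ x).of_le le_top) (fun z hz => (trans_mem hz).1) hz' _ _

/-- A function which is smooth in the charts around each of its points, near the centre of the
chart, is smooth in all charts. A parameter `t ∈ S` is allowed. -/
theorem contDiffOn_of_local {E : Type*} [NormedAddCommGroup E] [NormedSpace ℝ E] {S : Set ℝ}
    (hS : IsOpen S) {f : ℝ → X → E}
    (hf : ∀ x : X, ∃ W : Set (Cn n), IsOpen W ∧ chartAt (Cn n) x x ∈ W ∧
      ContDiffOn ℝ ∞ (fun p : ℝ × Cn n => f p.1 (pt n X x p.2)) (S ×ˢ W)) (x₀ : X) :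
    ContDiffOn ℝ ∞ (fun p : ℝ × Cn n => f p.1 (pt n X x₀ p.2))
      (S ×ˢ (chartAt (Cn n) x₀).target) := by
  rintro ⟨t, z⟩ ⟨ht, hz⟩
  apply ContDiffAt.contDiffWithinAt
  obtain ⟨W, hW, hzW, hfW⟩ := hf (pt n X x₀ z)
  have hz' : z ∈ chartOverlap n x₀ (pt n X x₀ z) := ⟨hz, mem_chart_source _ _⟩
  set x := pt n X x₀ z with hx
  have hO := isOpen_chartOverlap (n := n) x₀ x
  have hτ : ContDiffAt ℝ ∞ (trans x₀ x) z :=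
    (((contDiffOn_trans x₀ x).restrict_scalars ℝ).of_le le_top).contDiffAt (hO.mem_nhds hz')
  have h1 : ContDiffAt ℝ ∞ (fun p : ℝ × Cn n => (p.1, trans x₀ x p.2)) (t, z) :=
    contDiffAt_fst.prodMk
      (ContDiffAt.comp (g := trans x₀ x) (f := Prod.snd) (t, z) hτ contDiffAt_snd)
  have h2 : ContDiffAt ℝ ∞ (fun p : ℝ × Cn n => f p.1 (pt n X x p.2)) (t, trans x₀ x z) :=
    hfW.contDiffAt ((hS.prod hW).mem_nhds ⟨ht, hzW⟩)
  refine (h2.comp (t, z) h1).congr_of_eventuallyEq ?_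
  have h3 : ∀ᶠ p : ℝ × Cn n in 𝓝 (t, z), p.2 ∈ chartOverlap n x₀ x :=
    continuous_snd.continuousAt.eventually_mem (hO.mem_nhds hz')
  filter_upwards [h3] with p hp
  simp only [Function.comp_apply, pt_trans hp]

theorem smoothInCharts_of_local {E : Type*} [NormedAddCommGroup E] [NormedSpace ℝ E] {f : X → E}
    (hf : ∀ x : X, ∃ W : Set (Cn n), IsOpen W ∧ chartAt (Cn n) x x ∈ W ∧
      ContDiffOn ℝ ∞ (fun z => f (pt n X x z)) W) : SmoothInCharts n f := by
  intro x₀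
  have h := contDiffOn_of_local (S := univ) isOpen_univ (f := fun _ => f) (fun x => by
    obtain ⟨W, hW, hx, h⟩ := hf x
    exact ⟨W, hW, hx, h.comp contDiff_snd.contDiffOn fun p hp => hp.2⟩) x₀
  exact h.comp (contDiff_prodMk_right (0 : ℝ)).contDiffOn fun z hz => ⟨mem_univ _, hz⟩

end ScalarLaplacian

/-! ### Integrals of compactly supported derivatives -/

section CompactSupport

open MeasureTheory

variable {E : Type*} [NormedAddCommGroup E] [NormedSpace ℝ E] {F : Type*} [NormedAddCommGroup F]
  [NormedSpace ℝ F]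

/-- A smooth function on an open set which vanishes off a compact subset extends by zero to a
smooth function. -/
theorem contDiff_indicator {U K : Set E} (hU : IsOpen U) (hK : IsCompact K) (hKU : K ⊆ U)
    {f : E → F} (hf : ContDiffOn ℝ ∞ f U) (h0 : ∀ z ∈ U, z ∉ K → f z = 0) :
    ContDiff ℝ ∞ (U.indicator f) := by
  rw [contDiff_iff_contDiffAt]
  intro z
  by_cases hz : z ∈ K
  · have hz' := hU.mem_nhds (hKU hz)
    refine (hf.contDiffAt hz').congr_of_eventuallyEq ?_
    filter_upwards [hz'] with w hw using indicator_of_mem hw f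
  · refine (contDiffAt_const (c := (0 : F))).congr_of_eventuallyEq ?_
    filter_upwards [hK.isClosed.isOpen_compl.mem_nhds hz] with w hw
    by_cases hwU : w ∈ U
    · rw [indicator_of_mem hwU, h0 w hwU hw]
    · rw [indicator_of_notMem hwU]

theorem hasCompactSupport_indicator {U K : Set E} (hK : IsCompact K)
    {f : E → F} (h0 : ∀ z ∈ U, z ∉ K → f z = 0) : HasCompactSupport (U.indicator f) := by
  refine HasCompactSupport.intro hK fun z hz => ?_
  by_cases hzU : z ∈ U
  · rw [indicator_of_mem hzU, h0 z hzU hz]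
  · rw [indicator_of_notMem hzU]

variable {n : ℕ}

theorem integrableOn_of_vanish_off_compact {U K : Set (Cn n)} (hU : IsOpen U) (hK : IsCompact K)
    (hKU : K ⊆ U) {f : Cn n → F} (hf : ContDiffOn ℝ ∞ f U) (h0 : ∀ z ∈ U, z ∉ K → f z = 0) :
    IntegrableOn f U := by
  rw [← integrable_indicator_iff hU.measurableSet]
  exact (contDiff_indicator hU hK hKU hf h0).continuous.integrable_of_hasCompactSupport
    (hasCompactSupport_indicator hK h0)

/-- The divergence theorem for smooth compactly supported functions. -/
theorem setIntegral_fderiv_eq_zero {U K : Set (Cn n)} (hU : IsOpen U) (hK : IsCompact K)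
    (hKU : K ⊆ U) {f : Cn n → ℂ} (hf : ContDiffOn ℝ ∞ f U) (h0 : ∀ z ∈ U, z ∉ K → f z = 0)
    (a : Cn n) : IntegrableOn (fun z => fderiv ℝ f z a) U ∧ ∫ z in U, fderiv ℝ f z a = 0 := by
  have hs := contDiff_indicator hU hK hKU hf h0
  have hc := hasCompactSupport_indicator hK h0
  have hc' : HasCompactSupport (fun z => fderiv ℝ (U.indicator f) z a) :=
    hc.fderiv_apply ℝ a
  have hcont : Continuous (fun z => fderiv ℝ (U.indicator f) z a) :=
    (hs.continuous_fderiv (by simp)).clm_apply continuous_const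
  have hi := hcont.integrable_of_hasCompactSupport (μ := volume) hc'
  have heq : ∀ z, U.indicator (fun z => fderiv ℝ f z a) z = fderiv ℝ (U.indicator f) z a := by
    intro z
    by_cases hz : z ∈ U
    · rw [indicator_of_mem hz]
      have : U.indicator f =ᶠ[𝓝 z] f := by
        filter_upwards [hU.mem_nhds hz] with w hw using indicator_of_mem hw f
      rw [this.fderiv_eq]
    · rw [indicator_of_notMem hz]
      have : U.indicator f =ᶠ[𝓝 z] fun _ => 0 := by
        filter_upwards [hK.isClosed.isOpen_compl.mem_nhds fun h => hz (hKU h)] with w hw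
        by_cases hwU : w ∈ U
        · rw [indicator_of_mem hwU, h0 w hwU hw]
        · rw [indicator_of_notMem hwU]
      rw [this.fderiv_eq]; simp
  constructor
  · rw [← integrable_indicator_iff hU.measurableSet, funext heq]; exact hi
  · rw [← integral_indicator hU.measurableSet, funext heq]
    have := integral_smul_fderiv_eq_neg_fderiv_smul_of_integrable (𝕜 := ℝ)
      (μ := (volume : Measure (Cn n))) (f := fun _ => (1 : ℝ)) (g := U.indicator f) (v := a)
      (by simp) (by simpa using hi)
      (by simpa using hs.continuous.integrable_of_hasCompactSupport (μ := volume) hc)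
      (by fun_prop) (fun x _ => hs.differentiable (by simp) x)
    simpa using this

theorem setIntegral_delbar_eq_zero {U K : Set (Cn n)} (hU : IsOpen U) (hK : IsCompact K)
    (hKU : K ⊆ U) {f : Cn n → ℂ} (hf : ContDiffOn ℝ ∞ f U) (h0 : ∀ z ∈ U, z ∉ K → f z = 0)
    (a : Cn n) : IntegrableOn (delbar f a) U ∧ ∫ z in U, delbar f a z = 0 := by
  obtain ⟨h1, h2⟩ := setIntegral_fderiv_eq_zero hU hK hKU hf h0 a
  obtain ⟨h3, h4⟩ := setIntegral_fderiv_eq_zero hU hK hKU hf h0 (Complex.I • a)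
  have h3' := h3.const_mul Complex.I
  constructor
  · exact (h1.add h3').const_mul (1 / 2 : ℂ)
  · simp only [delbar, smul_eq_mul]
    rw [integral_const_mul, integral_add h1 h3', integral_const_mul, h2, h4]
    simp

end CompactSupport

/-! ### The partition of unity -/

section Partition

variable {n : ℕ} {X : Type*} [TopologicalSpace X] [ChartedSpace (Cn n) X]
  [IsManifold 𝓘(ℂ, Cn n) ω X] [T2Space X] [CompactSpace X]

variable (n X) in
/-- The finitely many indices of the members of the partition of unity which are not zero. -/
def activeCharts : Finset X :=
  ((chartPartition n X).locallyFinite.finite_nonempty_of_compact).toFinset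

theorem mem_activeCharts {i x : X} (h : chartPartition n X i x ≠ 0) : i ∈ activeCharts n X := by
  rw [activeCharts, Set.Finite.mem_toFinset]
  exact ⟨x, h⟩

theorem sum_chartPartition (x : X) : ∑ i ∈ activeCharts n X, chartPartition n X i x = 1 := by
  rw [← (chartPartition n X).sum_eq_one (mem_univ x)]
  refine (finsum_eq_sum_of_support_subset _ fun i hi => ?_).symm
  exact mem_activeCharts hi

theorem smoothInCharts_chartPartition (i : X) : SmoothInCharts n (chartPartition n X i) := by
  intro x₀
  have : IsManifold 𝓘(ℝ, Cn n) ∞ X := isManifold_real_of_complex n X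
  have h2 : ContMDiffOn 𝓘(ℝ, Cn n) 𝓘(ℝ, Cn n) ∞ (pt n X x₀) (chartAt (Cn n) x₀).target :=
    contMDiffOn_chart_symm
  have h1 : ContMDiff 𝓘(ℝ, Cn n) 𝓘(ℝ, ℝ) ∞ (chartPartition n X i) :=
    (chartPartition n X i).contMDiff
  exact contMDiffOn_iff_contDiffOn.1 (h1.comp_contMDiffOn h2)

variable (n) in
/-- The support of a member of the partition of unity, in the coordinates of its chart. -/
def chartSupport (i : X) : Set (Cn n) := chartAt (Cn n) i '' tsupport (chartPartition n X i)

theorem isCompact_chartSupport (i : X) : IsCompact (chartSupport n i) := by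
  refine IsCompact.image_of_continuousOn (isClosed_tsupport _).isCompact ?_
  exact (chartAt (Cn n) i).continuousOn.mono (chartPartition_isSubordinate i)

theorem chartSupport_subset (i : X) : chartSupport n i ⊆ (chartAt (Cn n) i).target := by
  rintro _ ⟨x, hx, rfl⟩
  exact (chartAt (Cn n) i).map_source (chartPartition_isSubordinate i hx)

theorem notMem_tsupport_pt {i : X} {z : Cn n} (hz : z ∈ (chartAt (Cn n) i).target)
    (h : z ∉ chartSupport n i) : pt n X i z ∉ tsupport (chartPartition n X i) := fun h' =>
  h ⟨_, h', chartAt_pt hz⟩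

theorem chartPartition_pt_eq_zero {i : X} {z : Cn n} (hz : z ∈ (chartAt (Cn n) i).target)
    (h : z ∉ chartSupport n i) : chartPartition n X i (pt n X i z) = 0 :=
  image_eq_zero_of_notMem_tsupport (notMem_tsupport_pt hz h)

end Partition

/-! ### The volume density -/

section Density

open MeasureTheory MatAlg
open scoped ComplexOrder

variable {n : ℕ} {X : Type*} [TopologicalSpace X] [ChartedSpace (Cn n) X]
  [IsManifold 𝓘(ℂ, Cn n) ω X]

/-- The density `n! 2ⁿ det (g_{αβ̄})` of `ωⁿ` in the coordinates around `x₀`. -/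
def density (g : KahlerMetric n X) (x₀ : X) (z : Cn n) : ℝ :=
  (n.factorial : ℝ) * 2 ^ n * (g.mat x₀ z).det.re

theorem KahlerMetric.det_pos (g : KahlerMetric n X) {x₀ : X} {z : Cn n}
    (hz : z ∈ (chartAt (Cn n) x₀).target) : 0 < (g.mat x₀ z).det.re ∧ (g.mat x₀ z).det.im = 0 := by
  have h := (g.posDef hz).det_pos
  rw [Complex.lt_def] at h
  exact ⟨h.1, h.2.symm⟩

theorem density_pos (g : KahlerMetric n X) {x₀ : X} {z : Cn n}
    (hz : z ∈ (chartAt (Cn n) x₀).target) : 0 < density g x₀ z :=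
  mul_pos (by positivity) (g.det_pos hz).1

theorem KahlerMetric.contDiffOn_entry (g : KahlerMetric n X) (x₀ : X) (α β : Fin n) :
    ContDiffOn ℝ ∞ (fun z => g.mat x₀ z α β) (chartAt (Cn n) x₀).target := by
  have := g.smooth x₀ α β
  rwa [coordDomain_tangent] at this

theorem KahlerMetric.contDiffOn_det (g : KahlerMetric n X) (x₀ : X) :
    ContDiffOn ℝ ∞ (fun z => (g.mat x₀ z).det) (chartAt (Cn n) x₀).target := by
  simp only [Matrix.det_apply]
  exact ContDiffOn.sum fun σ _ =>
    (contDiffOn_prod fun i _ => g.contDiffOn_entry x₀ _ _).const_smul _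

theorem contDiffOn_density (g : KahlerMetric n X) (x₀ : X) :
    ContDiffOn ℝ ∞ (density g x₀) (chartAt (Cn n) x₀).target :=
  contDiffOn_const.mul (Complex.reCLM.contDiff.comp_contDiffOn (g.contDiffOn_det x₀))

/-- The real Jacobian determinant of a holomorphic map is the squared modulus of the complex one. -/
theorem abs_det_fderiv_trans {x₀ x₁ : X} (z : Cn n) :
    |((fderiv ℂ (trans x₀ x₁) z).restrictScalars ℝ).det| = ‖(jac x₀ x₁ z).det‖ ^ 2 := by
  have h : (((fderiv ℂ (trans x₀ x₁) z).restrictScalars ℝ).toLinearMap)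
      = ((fderiv ℂ (trans x₀ x₁) z).toLinearMap).restrictScalars ℝ := rfl
  rw [ContinuousLinearMap.det, h, LinearMap.det_restrictScalars, Algebra.norm_complex_eq, jac,
    LinearMap.det_toMatrix']
  simp [Complex.normSq_eq_norm_sq]

/-- The densities in two charts define one measure on `X`. -/
theorem density_transform (g : KahlerMetric n X) {x₀ x₁ : X} {z : Cn n}
    (hz : z ∈ chartOverlap n x₀ x₁) :
    density g x₀ z = ‖(jac x₀ x₁ z).det‖ ^ 2 * density g x₁ (trans x₀ x₁ z) := by
  have h : (g.mat x₀ z).det = ((‖(jac x₀ x₁ z).det‖ ^ 2 : ℝ) : ℂ) *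
      (g.mat x₁ (trans x₀ x₁ z)).det := by
    rw [g.mat_transform hz, Matrix.det_mul, Matrix.det_mul, Matrix.det_conjTranspose,
      ← Complex.normSq_eq_norm_sq, Complex.normSq_eq_conj_mul_self, Complex.star_def]
    ring
  rw [density, h, Complex.re_ofReal_mul, density]
  ring

/-- The change of variables between two charts. -/
theorem setIntegral_chartOverlap (g : KahlerMetric n X) (x₀ x₁ : X) (f : X → ℝ) :
    ∫ z in chartOverlap n x₀ x₁, f (pt n X x₀ z) * density g x₀ z
      = ∫ z in chartOverlap n x₁ x₀, f (pt n X x₁ z) * density g x₁ z := by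
  have him : trans x₀ x₁ '' chartOverlap n x₀ x₁ = chartOverlap n x₁ x₀ := by
    ext w
    constructor
    · rintro ⟨z, hz, rfl⟩; exact trans_mem hz
    · exact fun hw => ⟨trans x₁ x₀ w, trans_mem hw, trans_trans hw⟩
  rw [← him, integral_image_eq_integral_abs_det_fderiv_smul volume
    (isOpen_chartOverlap x₀ x₁).measurableSet
    (fun z hz => ((differentiableAt_trans hz).hasFDerivAt.restrictScalars ℝ).hasFDerivWithinAt)
    (fun z hz w hw h => by rw [← trans_trans hz, ← trans_trans hw, h])]
  refine setIntegral_congr_fun (isOpen_chartOverlap x₀ x₁).measurableSet fun z hz => ?_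
  simp only [abs_det_fderiv_trans, pt_trans hz, density_transform g hz, smul_eq_mul]
  ring

end Density

/-! ### The integral over the manifold -/

section Integral

open MeasureTheory

variable {n : ℕ} {X : Type*} [TopologicalSpace X] [ChartedSpace (Cn n) X]
  [IsManifold 𝓘(ℂ, Cn n) ω X] [T2Space X] [CompactSpace X]

theorem kahlerIntegral_eq_sum (g : KahlerMetric n X) (f : X → ℝ) :
    kahlerIntegral g f = ∑ i ∈ activeCharts n X, ∫ z in (chartAt (Cn n) i).target,
      chartPartition n X i (pt n X i z) * f (pt n X i z) * density g i z := by
  refine finsum_eq_sum_of_support_subset _ fun i hi => ?_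
  by_contra h
  refine hi ?_
  have h0 : ∀ x, chartPartition n X i x = 0 := fun x => by
    by_contra hx; exact h (mem_activeCharts hx)
  simp [h0]

theorem SmoothInCharts.contDiffOn_integrand (g : KahlerMetric n X) {f : X → ℝ}
    (hf : SmoothInCharts n f) (i j : X) : ContDiffOn ℝ ∞ (fun z => chartPartition n X j (pt n X i z)
      * f (pt n X i z) * density g i z) (chartAt (Cn n) i).target :=
  ((smoothInCharts_chartPartition j i).mul (hf i)).mul (contDiffOn_density g i)

theorem SmoothInCharts.integrableOn (g : KahlerMetric n X) {f : X → ℝ}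
    (hf : SmoothInCharts n f) (i : X) : IntegrableOn (fun z => chartPartition n X i (pt n X i z)
      * f (pt n X i z) * density g i z) (chartAt (Cn n) i).target :=
  integrableOn_of_vanish_off_compact (chartAt (Cn n) i).open_target (isCompact_chartSupport i)
    (chartSupport_subset i) (hf.contDiffOn_integrand g i i) fun z hz h => by
      rw [chartPartition_pt_eq_zero hz h, zero_mul, zero_mul]

theorem kahlerIntegral_add (g : KahlerMetric n X) {f f' : X → ℝ} (hf : SmoothInCharts n f)
    (hf' : SmoothInCharts n f') :
    kahlerIntegral g (fun x => f x + f' x) = kahlerIntegral g f + kahlerIntegral g f' := by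
  simp only [kahlerIntegral_eq_sum, mul_add, add_mul]
  rw [← Finset.sum_add_distrib]
  exact Finset.sum_congr rfl fun i _ => integral_add (hf.integrableOn g i) (hf'.integrableOn g i)

theorem kahlerIntegral_const_mul (g : KahlerMetric n X) (c : ℝ) (f : X → ℝ) :
    kahlerIntegral g (fun x => c * f x) = c * kahlerIntegral g f := by
  simp only [kahlerIntegral_eq_sum, Finset.mul_sum, ← integral_const_mul]
  refine Finset.sum_congr rfl fun i _ => integral_congr_ae (.of_forall fun z => ?_)
  simp only; ring

theorem kahlerIntegral_sum (g : KahlerMetric n X) {ι : Type*} (s : Finset ι) {f : ι → X → ℝ}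
    (hf : ∀ i ∈ s, SmoothInCharts n (f i)) :
    kahlerIntegral g (fun x => ∑ i ∈ s, f i x) = ∑ i ∈ s, kahlerIntegral g (f i) := by
  simp only [kahlerIntegral_eq_sum, Finset.mul_sum, Finset.sum_mul]
  rw [Finset.sum_comm]
  refine Finset.sum_congr rfl fun j _ => ?_
  exact integral_finsetSum _ fun i hi => (hf i hi).integrableOn g j

/-- A smooth nonnegative function with vanishing integral is zero. -/
theorem eq_zero_of_kahlerIntegral_eq_zero (g : KahlerMetric n X) {f : X → ℝ}
    (hf : SmoothInCharts n f) (h0 : ∀ x, 0 ≤ f x) (hi : kahlerIntegral g f = 0) (x : X) :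
    f x = 0 := by
  rw [kahlerIntegral_eq_sum] at hi
  have hnn : ∀ i, ∀ z ∈ (chartAt (Cn n) i).target, 0 ≤ chartPartition n X i (pt n X i z)
      * f (pt n X i z) * density g i z := fun i z hz =>
    mul_nonneg (mul_nonneg ((chartPartition n X).nonneg i _) (h0 _)) (density_pos g hz).le
  have hO := fun i : X => (chartAt (Cn n) i).open_target.measurableSet
  rw [Finset.sum_eq_zero_iff_of_nonneg fun i _ => setIntegral_nonneg (hO i) (hnn i)] at hi
  obtain ⟨i, hiA, hix⟩ : ∃ i ∈ activeCharts n X, chartPartition n X i x ≠ 0 := by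
    by_contra! h
    have := sum_chartPartition (n := n) x
    rw [Finset.sum_eq_zero h] at this
    exact zero_ne_one this
  have hxs : x ∈ (chartAt (Cn n) i).source :=
    chartPartition_isSubordinate i (subset_tsupport _ hix)
  have hz := (chartAt (Cn n) i).map_source hxs
  have h1 := hi i hiA
  rw [setIntegral_eq_zero_iff_of_nonneg_ae ((ae_restrict_iff' (hO i)).2 (.of_forall (hnn i)))
    (hf.integrableOn g i)] at h1
  have h2 := Measure.eqOn_open_of_ae_eq h1 (chartAt (Cn n) i).open_target
    (hf.contDiffOn_integrand g i i).continuousOn continuousOn_const hz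
  simp only [pt_chartAt hxs, Pi.zero_apply] at h2
  have h3 := (density_pos g hz).ne'
  simp_all

/-- The integral of a function supported in the support of one member of the partition of unity is
computed in one chart. -/
theorem kahlerIntegral_of_support (g : KahlerMetric n X) {f : X → ℝ} (hf : SmoothInCharts n f)
    (j : X) (hj : ∀ x ∉ tsupport (chartPartition n X j), f x = 0) :
    kahlerIntegral g f = ∫ z in (chartAt (Cn n) j).target, f (pt n X j z) * density g j z := by
  have hfz : ∀ {i : X} {z}, f (pt n X i z) ≠ 0 → pt n X i z ∈ (chartAt (Cn n) j).source := by
    intro i z h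
    by_contra h'
    exact h (hj _ fun h'' => h' (chartPartition_isSubordinate j h''))
  have key : ∀ i, ∫ z in (chartAt (Cn n) i).target,
      chartPartition n X i (pt n X i z) * f (pt n X i z) * density g i z
      = ∫ z in (chartAt (Cn n) j).target,
      chartPartition n X i (pt n X j z) * f (pt n X j z) * density g j z := by
    intro i
    rw [setIntegral_eq_of_subset_of_forall_sdiff_eq_zero (s := chartOverlap n i j)
        (chartAt (Cn n) i).open_target.measurableSet inter_subset_left,
      setIntegral_eq_of_subset_of_forall_sdiff_eq_zero (s := chartOverlap n j i)
        (chartAt (Cn n) j).open_target.measurableSet inter_subset_left]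
    · exact setIntegral_chartOverlap g i j fun x => chartPartition n X i x * f x
    · rintro z ⟨hz, hz'⟩
      have : chartPartition n X i (pt n X j z) = 0 := by
        by_contra h
        exact hz' ⟨hz, chartPartition_isSubordinate i (subset_tsupport _ h)⟩
      rw [this, zero_mul, zero_mul]
    · rintro z ⟨hz, hz'⟩
      have : f (pt n X i z) = 0 := by
        by_contra h
        exact hz' ⟨hz, hfz h⟩
      rw [this, mul_zero, zero_mul]
  rw [kahlerIntegral_eq_sum, Finset.sum_congr rfl fun i _ => key i, ← integral_finsetSum]
  · refine integral_congr_ae (.of_forall fun z => ?_)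
    simp only
    rw [← Finset.sum_mul, ← Finset.sum_mul, sum_chartPartition, one_mul]
  · intro i _
    refine integrableOn_of_vanish_off_compact (chartAt (Cn n) j).open_target
      (isCompact_chartSupport j) (chartSupport_subset j) (hf.contDiffOn_integrand g j i)
      fun z hz h => ?_
    rw [hj _ (notMem_tsupport_pt hz h), mul_zero, zero_mul]

end Integral

/-! ### The Kähler condition and divergences -/

section KahlerIdentity

variable {n : ℕ}

/-- Jacobi's formula for the `∂̄`-derivative of a determinant. -/
theorem delbar_det {ι : Type*} [Fintype ι] [DecidableEq ι] {G : Cn n → Matrix ι ι ℂ} {z : Cn n}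
    (hG : ∀ i j, DifferentiableAt ℝ (fun z => G z i j) z) (b : Cn n) :
    delbar (fun z => (G z).det) b z
      = ∑ k, ∑ l, (G z).adjugate k l * delbar (fun z => G z l k) b z := by
  have key : ∀ u, fderiv ℝ (fun z => (G z).det) z u
      = ∑ k, ∑ l, (G z).adjugate k l * fderiv ℝ (fun z => G z l k) z u := by
    intro u
    have h1 : HasFDerivAt (fun z => (G z).det) (∑ σ : Equiv.Perm ι, (Equiv.Perm.sign σ : ℤ) •
        ∑ k, (∏ j ∈ Finset.univ.erase k, G z (σ j) j) • fderiv ℝ (fun z => G z (σ k) k) z) z := by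
      simp only [Matrix.det_apply']
      refine HasFDerivAt.fun_sum fun σ _ => ?_
      simp only [← zsmul_eq_mul]
      exact (HasFDerivAt.finsetProd fun k _ => (hG (σ k) k).hasFDerivAt).fun_const_smul _
    rw [h1.fderiv]
    have h2 : ∀ k, ∑ l, (G z).adjugate k l * fderiv ℝ (fun z => G z l k) z u
        = ((G z).updateCol k fun l => fderiv ℝ (fun z => G z l k) z u).det := by
      intro k
      rw [← Matrix.cramer_apply, Matrix.cramer_eq_adjugate_mulVec]; rfl
    simp only [h2, Matrix.det_apply', _root_.sum_apply, _root_.smul_apply]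
    rw [Finset.sum_comm]
    refine Finset.sum_congr rfl fun σ _ => ?_
    rw [Finset.smul_sum]
    refine Finset.sum_congr rfl fun k _ => ?_
    rw [zsmul_eq_mul, ← Finset.mul_prod_erase _ _ (Finset.mem_univ k), Matrix.updateCol_self,
      smul_eq_mul, mul_comm (∏ j ∈ _, _)]
    congr 2
    refine Finset.prod_congr rfl fun j hj => ?_
    rw [Matrix.updateCol_ne (Finset.ne_of_mem_erase hj)]
  simp only [delbar, key, smul_eq_mul, Finset.mul_sum, ← Finset.sum_add_distrib]
  refine Finset.sum_congr rfl fun k _ => Finset.sum_congr rfl fun l _ => ?_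
  ring

variable {X : Type*} [TopologicalSpace X] [ChartedSpace (Cn n) X]
  [IsManifold 𝓘(ℂ, Cn n) ω X]

/-- The Kähler condition in the form `∂_δ̄ g_{αβ̄} = ∂_β̄ g_{αδ̄}`. -/
theorem KahlerMetric.delbar_symm (g : KahlerMetric n X) {x₀ : X} {z : Cn n}
    (hz : z ∈ (chartAt (Cn n) x₀).target) (α β δ : Fin n) :
    delbar (fun z => g.mat x₀ z β α) (Pi.single δ 1) z
      = delbar (fun z => g.mat x₀ z δ α) (Pi.single β 1) z := by
  have hd : ∀ i j, DifferentiableAt ℝ (fun z => g.mat x₀ z i j) z := fun i j =>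
    ContDiffOn.diffAt (g.contDiffOn_entry x₀ i j) (chartAt (Cn n) x₀).open_target hz
  have hform : ∀ (γ ε : Fin n) (c d : ℂ) (z' : Cn n),
      fundamentalForm n X g.toHermitianForm x₀ z' (c • Pi.single γ 1) (d • Pi.single ε 1)
        = (Complex.I * (c * conj d)) * g.mat x₀ z' ε γ
          - (Complex.I * (d * conj c)) * g.mat x₀ z' γ ε := by
    intro γ ε c d z'
    simp only [fundamentalForm, mul_sub, Finset.sum_sub_distrib, Pi.smul_apply, smul_eq_mul,
      Pi.single_apply, apply_ite conj, map_zero, mul_ite, mul_one, mul_zero,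
      ite_mul, zero_mul, Finset.sum_ite_eq', Finset.mem_univ, if_true]
    ring
  have hder : ∀ (γ ε κ : Fin n) (c d b : ℂ),
      fderiv ℝ (fun z' => fundamentalForm n X g.toHermitianForm x₀ z' (c • Pi.single γ 1)
        (d • Pi.single ε 1)) z (b • Pi.single κ 1)
      = (Complex.I * (c * conj d)) * (b * del (fun z => g.mat x₀ z ε γ) (Pi.single κ 1) z
          + conj b * delbar (fun z => g.mat x₀ z ε γ) (Pi.single κ 1) z)
        - (Complex.I * (d * conj c)) * (b * del (fun z => g.mat x₀ z γ ε) (Pi.single κ 1) z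
          + conj b * delbar (fun z => g.mat x₀ z γ ε) (Pi.single κ 1) z) := by
    intro γ ε κ c d b
    simp only [hform]
    rw [fderiv_fun_sub ((hd _ _).const_mul _) ((hd _ _).const_mul _), fderiv_const_mul (hd _ _),
      fderiv_const_mul (hd _ _)]
    simp only [_root_.sub_apply, _root_.smul_apply, smul_eq_mul, fderiv_eq_del_add_delbar,
      del_smul_right, delbar_smul_right]
  -- closedness on real and imaginary multiples of the basis vectors separates the types
  have hcl : ∀ b c d : ℂ, _ := fun b c d =>
    g.closed x₀ z hz (b • Pi.single δ 1) (c • Pi.single α 1) (d • Pi.single β 1)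
  simp only [hder] at hcl
  have c1 := hcl 1 1 1
  have c2 := hcl Complex.I 1 1
  have c3 := hcl 1 Complex.I 1
  have c4 := hcl 1 1 Complex.I
  have c5 := hcl Complex.I Complex.I 1
  have c6 := hcl Complex.I 1 Complex.I
  have c7 := hcl 1 Complex.I Complex.I
  have c8 := hcl Complex.I Complex.I Complex.I
  simp only [map_one, Complex.conj_I, mul_one, one_mul] at c1 c2 c3 c4 c5 c6 c7 c8
  -- the eight equations are combined so that only the terms conjugate linear in the first and the
  -- third vector and linear in the second one survive
  have i6 : Complex.I ^ 6 = -1 := by rw [pow_add _ 4 2, Complex.I_pow_four, Complex.I_sq]; ring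
  linear_combination (norm := skip) (-Complex.I / 8) * (c1 + Complex.I * c2 - Complex.I * c3
    + Complex.I * c4 + c5 - c6 + c7 + Complex.I * c8)
  ring_nf
  simp only [Complex.I_sq, Complex.I_pow_four, i6]
  ring

/-- The Kähler condition makes the coefficients `det (g) g^{αβ̄}` divergence free. -/
theorem KahlerMetric.sum_delbar_det_mul_inv (g : KahlerMetric n X) {x₀ : X} {z : Cn n}
    (hz : z ∈ (chartAt (Cn n) x₀).target) (α : Fin n) :
    ∑ β, delbar (fun z => (g.mat x₀ z).det * (g.mat x₀ z)⁻¹ α β) (Pi.single β 1) z = 0 := by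
  have hO := (chartAt (Cn n) x₀).open_target
  have hd : ∀ i j, DifferentiableAt ℝ (fun z => g.mat x₀ z i j) z := fun i j =>
    ContDiffOn.diffAt (g.contDiffOn_entry x₀ i j) hO hz
  have hi : ∀ i j, DifferentiableAt ℝ (fun z => (g.mat x₀ z)⁻¹ i j) z := fun i j =>
    ContDiffOn.diffAt (g.contDiffOn_inv_entry x₀ i j) hO hz
  have hdet : DifferentiableAt ℝ (fun z => (g.mat x₀ z).det) z :=
    ContDiffOn.diffAt (g.contDiffOn_det x₀) hO hz
  have hu : ∀ z ∈ (chartAt (Cn n) x₀).target, IsUnit (g.mat x₀ z).det := fun z hz => by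
    rw [isUnit_iff_ne_zero]
    intro h
    have := (g.det_pos hz).1
    simp [h] at this
  -- the derivative of the determinant
  have e1 : ∀ β, delbar (fun z => (g.mat x₀ z).det) (Pi.single β 1) z = (g.mat x₀ z).det *
      ∑ k, ∑ l, (g.mat x₀ z)⁻¹ k l * delbar (fun z => g.mat x₀ z l k) (Pi.single β 1) z := by
    intro β
    have h1 : (g.mat x₀ z).adjugate = (g.mat x₀ z).det • (g.mat x₀ z)⁻¹ := by
      rw [Matrix.inv_def, smul_smul, Ring.mul_inverse_cancel _ (hu z hz), one_smul]
    rw [delbar_det hd, h1]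
    simp only [Matrix.smul_apply, smul_eq_mul, Finset.mul_sum, mul_assoc]
  -- the derivative of the inverse
  have e2 : ∀ β, delbar (fun z => (g.mat x₀ z)⁻¹ α β) (Pi.single β 1) z
      = -∑ k, ∑ l, (g.mat x₀ z)⁻¹ α l * delbar (fun z => g.mat x₀ z l k) (Pi.single β 1) z
        * (g.mat x₀ z)⁻¹ k β := by
    intro β
    have h1 : ∀ k, ∑ l, (delbar (fun z => (g.mat x₀ z)⁻¹ α l) (Pi.single β 1) z * g.mat x₀ z l k
        + (g.mat x₀ z)⁻¹ α l * delbar (fun z => g.mat x₀ z l k) (Pi.single β 1) z) = 0 := by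
      intro k
      have h2 : delbar (fun z => ∑ l, (g.mat x₀ z)⁻¹ α l * g.mat x₀ z l k) (Pi.single β 1) z
          = 0 := by
        have h3 : (fun z => ∑ l, (g.mat x₀ z)⁻¹ α l * g.mat x₀ z l k)
            =ᶠ[𝓝 z] fun _ => (1 : Matrix (Fin n) (Fin n) ℂ) α k := by
          filter_upwards [hO.mem_nhds hz] with w hw
          rw [← Matrix.mul_apply, Matrix.nonsing_inv_mul _ (hu w hw)]
        rw [delbar_congr h3]
        simp [delbar]
      rw [delbar_sum _ fun l _ => (hi α l).fun_mul (hd l k)] at h2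
      rw [← h2]
      refine Finset.sum_congr rfl fun l _ => ?_
      exact (delbar_mul (hi α l) (hd l k) _).symm
    have h4 : ∑ k, (∑ l, (delbar (fun z => (g.mat x₀ z)⁻¹ α l) (Pi.single β 1) z * g.mat x₀ z l k
        + (g.mat x₀ z)⁻¹ α l * delbar (fun z => g.mat x₀ z l k) (Pi.single β 1) z))
        * (g.mat x₀ z)⁻¹ k β = 0 := Finset.sum_eq_zero fun k _ => by rw [h1, zero_mul]
    simp only [Finset.sum_add_distrib, add_mul, Finset.sum_mul] at h4
    have h5 : ∑ k, ∑ l, delbar (fun z => (g.mat x₀ z)⁻¹ α l) (Pi.single β 1) z * g.mat x₀ z l k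
        * (g.mat x₀ z)⁻¹ k β = delbar (fun z => (g.mat x₀ z)⁻¹ α β) (Pi.single β 1) z := by
      rw [Finset.sum_comm]
      simp only [mul_assoc, ← Finset.mul_sum, ← Matrix.mul_apply,
        Matrix.mul_nonsing_inv _ (hu z hz), Matrix.one_apply, mul_ite, mul_one, mul_zero,
        Finset.sum_ite_eq', Finset.mem_univ, if_true]
    rw [h5] at h4
    exact eq_neg_of_add_eq_zero_left h4
  have e3 : ∀ β, delbar (fun z => (g.mat x₀ z).det * (g.mat x₀ z)⁻¹ α β) (Pi.single β 1) z
      = (g.mat x₀ z).det * ∑ k, ∑ l, (g.mat x₀ z)⁻¹ k l * (g.mat x₀ z)⁻¹ α β *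
          delbar (fun z => g.mat x₀ z l k) (Pi.single β 1) z
        - (g.mat x₀ z).det * ∑ k, ∑ l, (g.mat x₀ z)⁻¹ k β * (g.mat x₀ z)⁻¹ α l *
          delbar (fun z => g.mat x₀ z l k) (Pi.single β 1) z := by
    intro β
    rw [delbar_mul hdet (hi α β), e1, e2, mul_neg, ← sub_eq_add_neg, mul_assoc, Finset.sum_mul]
    congr 2
    · refine Finset.sum_congr rfl fun k _ => ?_
      rw [Finset.sum_mul]
      refine Finset.sum_congr rfl fun l _ => ?_
      ring
    · refine Finset.sum_congr rfl fun k _ => Finset.sum_congr rfl fun l _ => ?_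
      ring
  simp only [e3]
  -- the two triple sums agree after exchanging indices by the Kähler condition
  rw [Finset.sum_sub_distrib, ← Finset.mul_sum, ← Finset.mul_sum, sub_eq_zero]
  congr 1
  rw [Finset.sum_comm]
  conv_rhs => rw [Finset.sum_comm]
  refine Finset.sum_congr rfl fun k _ => ?_
  rw [Finset.sum_comm]
  refine Finset.sum_congr rfl fun l _ => Finset.sum_congr rfl fun β _ => ?_
  rw [g.delbar_symm hz k l β]

end KahlerIdentity

/-! ### The integral of `□ f` and differentiation under the integral sign -/

section IntegralOfLaplacian

open MeasureTheory

variable {n : ℕ} {X : Type*} [TopologicalSpace X] [ChartedSpace (Cn n) X]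
  [IsManifold 𝓘(ℂ, Cn n) ω X]

/-- On a Kähler manifold the operator `□` is in divergence form. -/
theorem det_mul_boxIn (g : KahlerMetric n X) {f : X → ℂ} (hf : SmoothInCharts n f) {x₀ : X}
    {z : Cn n} (hz : z ∈ (chartAt (Cn n) x₀).target) :
    (g.mat x₀ z).det * boxIn g f x₀ z = ∑ β, delbar (fun z => ∑ α,
      (g.mat x₀ z).det * (g.mat x₀ z)⁻¹ α β * del (fun z => f (pt n X x₀ z)) (Pi.single α 1) z)
      (Pi.single β 1) z := by
  have hO := (chartAt (Cn n) x₀).open_target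
  have h1 : ∀ α β, DifferentiableAt ℝ (fun z => (g.mat x₀ z).det * (g.mat x₀ z)⁻¹ α β) z :=
    fun α β => ContDiffOn.diffAt ((g.contDiffOn_det x₀).mul (g.contDiffOn_inv_entry x₀ α β)) hO hz
  have h2 : ∀ α, DifferentiableAt ℝ (del (fun z => f (pt n X x₀ z)) (Pi.single α 1)) z :=
    fun α => ContDiffOn.diffAt (ContDiffOn.del (hf x₀) hO _) hO hz
  have h3 : ∀ β, delbar (fun z => ∑ α, (g.mat x₀ z).det * (g.mat x₀ z)⁻¹ α β *
      del (fun z => f (pt n X x₀ z)) (Pi.single α 1) z) (Pi.single β 1) z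
      = ∑ α, (delbar (fun z => (g.mat x₀ z).det * (g.mat x₀ z)⁻¹ α β) (Pi.single β 1) z
          * del (fun z => f (pt n X x₀ z)) (Pi.single α 1) z
        + (g.mat x₀ z).det * (g.mat x₀ z)⁻¹ α β *
          delbar (del (fun z => f (pt n X x₀ z)) (Pi.single α 1)) (Pi.single β 1) z) := by
    intro β
    rw [delbar_sum _ fun α _ => (h1 α β).fun_mul (h2 α)]
    exact Finset.sum_congr rfl fun α _ => delbar_mul (h1 α β) (h2 α) _
  simp only [h3]
  rw [Finset.sum_comm]
  simp only [Finset.sum_add_distrib, ← Finset.sum_mul, g.sum_delbar_det_mul_inv hz, zero_mul,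
    zero_add]
  simp only [boxIn, contract, Finset.mul_sum, smul_eq_mul, mul_assoc]

/-- The integral of `□ f` over a chart vanishes if `f` has compact support in the chart. -/
theorem setIntegral_boxIn_eq_zero (g : KahlerMetric n X) {f : X → ℂ} (hf : SmoothInCharts n f)
    {x₀ : X} {K : Set (Cn n)} (hK : IsCompact K) (hKU : K ⊆ (chartAt (Cn n) x₀).target)
    (h0 : ∀ z ∈ (chartAt (Cn n) x₀).target, z ∉ K → f (pt n X x₀ z) = 0) :
    ∫ z in (chartAt (Cn n) x₀).target, (boxIn g f x₀ z).re * density g x₀ z = 0 := by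
  have hO := (chartAt (Cn n) x₀).open_target
  set P : Fin n → Cn n → ℂ := fun β z => ∑ α, (g.mat x₀ z).det * (g.mat x₀ z)⁻¹ α β *
    del (fun z => f (pt n X x₀ z)) (Pi.single α 1) z with hP
  have hPs : ∀ β, ContDiffOn ℝ ∞ (P β) (chartAt (Cn n) x₀).target := fun β =>
    ContDiffOn.sum fun α _ => ((g.contDiffOn_det x₀).mul (g.contDiffOn_inv_entry x₀ α β)).mul
      (ContDiffOn.del (hf x₀) hO _)
  have hP0 : ∀ β, ∀ z ∈ (chartAt (Cn n) x₀).target, z ∉ K → P β z = 0 := by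
    intro β z hz hzK
    have h1 : (fun z => f (pt n X x₀ z)) =ᶠ[𝓝 z] fun _ => 0 := by
      filter_upwards [hO.mem_nhds hz, hK.isClosed.isOpen_compl.mem_nhds hzK] with w hw hwK
        using h0 w hw hwK
    refine Finset.sum_eq_zero fun α _ => ?_
    rw [del_congr h1]
    simp [del]
  have hint := fun β => setIntegral_delbar_eq_zero hO hK hKU (hPs β) (hP0 β) (Pi.single β 1)
  have h2 : ∫ z in (chartAt (Cn n) x₀).target, ∑ β, delbar (P β) (Pi.single β 1) z = 0 := by
    rw [integral_finsetSum _ fun β _ => (hint β).1]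
    exact Finset.sum_eq_zero fun β _ => (hint β).2
  have hi2 : IntegrableOn (fun z => ∑ β, delbar (P β) (Pi.single β 1) z)
      (chartAt (Cn n) x₀).target := integrable_finsetSum _ fun β _ => (hint β).1
  have h3 : ∀ z ∈ (chartAt (Cn n) x₀).target, (boxIn g f x₀ z).re * density g x₀ z
      = ((n.factorial : ℝ) * 2 ^ n) * (∑ β, delbar (P β) (Pi.single β 1) z).re := by
    intro z hz
    rw [← det_mul_boxIn g hf hz, density, Complex.mul_re, (g.det_pos hz).2]
    ring
  rw [setIntegral_congr_fun hO.measurableSet h3, integral_const_mul]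
  have h4 := integral_re (𝕜 := ℂ) hi2
  rw [h2] at h4
  simp only [RCLike.re_eq_complex_re, Complex.zero_re] at h4
  rw [h4, mul_zero]

theorem smoothInCharts_box (g : KahlerMetric n X) {f : X → ℂ} (hf : SmoothInCharts n f) :
    SmoothInCharts n (box g f) := fun x₀ =>
  (contDiffOn_boxIn g hf x₀).congr fun _ hz => (boxIn_eq_box g hf hz).symm

theorem box_sum (g : KahlerMetric n X) {ι : Type*} (s : Finset ι) {f : ι → X → ℂ}
    (hf : ∀ i ∈ s, SmoothInCharts n (f i)) (x : X) :
    box g (fun x => ∑ i ∈ s, f i x) x = ∑ i ∈ s, box g (f i) x := by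
  have hO := (chartAt (Cn n) x).open_target
  have hx := mem_chart_target (Cn n) x
  have h1 : ∀ α β, delbar (del (fun z => ∑ i ∈ s, f i (pt n X x z)) (Pi.single α 1))
      (Pi.single β 1) (chartAt (Cn n) x x) = ∑ i ∈ s, delbar (del (fun z => f i (pt n X x z))
      (Pi.single α 1)) (Pi.single β 1) (chartAt (Cn n) x x) := by
    intro α β
    rw [← delbar_sum s fun i hi => ContDiffOn.diffAt (ContDiffOn.del (hf i hi x) hO _) hO hx]
    refine delbar_congr ?_ _
    filter_upwards [hO.mem_nhds hx] with z hz
    exact del_sum s (fun i hi => ContDiffOn.diffAt (hf i hi x) hO hz) _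
  simp only [box, boxIn, contract, h1, Finset.smul_sum]
  conv_rhs => rw [Finset.sum_comm]
  exact Finset.sum_congr rfl fun α _ => Finset.sum_comm

variable [T2Space X] [CompactSpace X]

/-- On a compact Kähler manifold the integral of `□ f` vanishes. -/
theorem kahlerIntegral_box (g : KahlerMetric n X) {f : X → ℂ} (hf : SmoothInCharts n f) :
    kahlerIntegral g (fun x => (box g f x).re) = 0 := by
  -- `f` is a finite sum of functions, each supported in a chart
  set fj : X → X → ℂ := fun j x => (chartPartition n X j x : ℂ) * f x with hfj
  have hs : ∀ j, SmoothInCharts n (fj j) := fun j x₀ =>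
    (Complex.ofRealCLM.contDiff.comp_contDiffOn (smoothInCharts_chartPartition j x₀)).mul (hf x₀)
  have hsum : f = fun x => ∑ j ∈ activeCharts n X, fj j x := by
    funext x
    rw [hfj]
    simp only
    rw [← Finset.sum_mul, ← Complex.ofReal_sum, sum_chartPartition, Complex.ofReal_one, one_mul]
  have hre : ∀ j, SmoothInCharts n (fun x => (box g (fj j) x).re) := fun j x₀ =>
    Complex.reCLM.contDiff.comp_contDiffOn (smoothInCharts_box g (hs j) x₀)
  have h1 : (fun x => (box g f x).re)
      = fun x => ∑ j ∈ activeCharts n X, (box g (fj j) x).re := by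
    funext x
    conv_lhs => rw [hsum]
    rw [box_sum g _ fun j _ => hs j, Complex.re_sum]
  rw [h1, kahlerIntegral_sum g _ fun j _ => hre j]
  refine Finset.sum_eq_zero fun j _ => ?_
  rw [kahlerIntegral_of_support g (hre j) j]
  · rw [← setIntegral_boxIn_eq_zero g (hs j) (isCompact_chartSupport j) (chartSupport_subset j)]
    · refine setIntegral_congr_fun (chartAt (Cn n) j).open_target.measurableSet fun z hz => ?_
      simp only [boxIn_eq_box g (hs j) hz]
    · intro z hz hzK
      simp only [hfj, chartPartition_pt_eq_zero hz hzK, Complex.ofReal_zero, zero_mul]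
  -- `□` is local, so `□ (ρ_j f)` is supported where `ρ_j` is
  · intro x hx
    have hx' := mem_chart_target (Cn n) x
    have h2 : ∀ᶠ z in 𝓝 (chartAt (Cn n) x x), pt n X x z ∉ tsupport (chartPartition n X j) := by
      have hc : ContinuousAt (pt n X x) (chartAt (Cn n) x x) :=
        (chartAt (Cn n) x).continuousAt_symm hx'
      refine hc.eventually_mem ((isClosed_tsupport _).isOpen_compl.mem_nhds ?_)
      rwa [pt_chartAt (mem_chart_source _ _)]
    have h3 : (fun z => fj j (pt n X x z)) =ᶠ[𝓝 (chartAt (Cn n) x x)] fun _ => 0 := by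
      filter_upwards [h2] with z hz
      simp only [hfj, image_eq_zero_of_notMem_tsupport hz, Complex.ofReal_zero, zero_mul]
    have h4 : ∀ a, del (fun z => fj j (pt n X x z)) a =ᶠ[𝓝 (chartAt (Cn n) x x)]
        fun _ => 0 := by
      intro a
      filter_upwards [h3.eventuallyEq_nhds] with z hz
      rw [del_congr hz]
      simp [del]
    have h5 : box g (fj j) x = 0 := by
      simp only [box, boxIn, contract, delbar_congr (h4 _)]
      simp [delbar]
    simp [h5]

/-- Differentiation under the integral sign. -/
theorem hasDerivAt_kahlerIntegral (g : KahlerMetric n X) {ε : ℝ} (hε : 0 < ε) {F F' : ℝ → X → ℝ}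
    (hF : ∀ x₀ : X, ContDiffOn ℝ ∞ (fun p : ℝ × Cn n => F p.1 (pt n X x₀ p.2))
      (Ioo (-ε) ε ×ˢ (chartAt (Cn n) x₀).target))
    (hF' : ∀ x₀ : X, ContDiffOn ℝ ∞ (fun p : ℝ × Cn n => F' p.1 (pt n X x₀ p.2))
      (Ioo (-ε) ε ×ˢ (chartAt (Cn n) x₀).target))
    (hd : ∀ t ∈ Ioo (-ε) ε, ∀ x, HasDerivAt (fun t => F t x) (F' t x) t) :
    HasDerivAt (fun t => kahlerIntegral g (F t)) (kahlerIntegral g (F' 0)) 0 := by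
  simp only [kahlerIntegral_eq_sum]
  refine HasDerivAt.fun_sum fun i _ => ?_
  have hO := (chartAt (Cn n) i).open_target
  have hslice : ∀ {F : ℝ → X → ℝ}, ContDiffOn ℝ ∞ (fun p : ℝ × Cn n => F p.1 (pt n X i p.2))
      (Ioo (-ε) ε ×ˢ (chartAt (Cn n) i).target) → ∀ t ∈ Ioo (-ε) ε,
      ContDiffOn ℝ ∞ (fun z => chartPartition n X i (pt n X i z) * F t (pt n X i z)
        * density g i z) (chartAt (Cn n) i).target := fun hF t ht =>
    ((smoothInCharts_chartPartition i i).mul (hF.comp (contDiff_prodMk_right t).contDiffOn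
      fun z hz => ⟨ht, hz⟩)).mul (contDiffOn_density g i)
  have h0 : (0 : ℝ) ∈ Ioo (-ε) ε := ⟨by linarith, hε⟩
  have hsub : Icc (-(ε / 2)) (ε / 2) ⊆ Ioo (-ε) ε := fun t ht =>
    ⟨by linarith [ht.1], by linarith [ht.2]⟩
  -- the integrand is bounded on the compact set `[-ε/2, ε/2] × supp ρ_i` and vanishes off it
  obtain ⟨C, hC⟩ :=
    (isCompact_Icc.prod (isCompact_chartSupport (n := n) i)).exists_bound_of_continuousOn
    (f := fun p : ℝ × Cn n => chartPartition n X i (pt n X i p.2) * F' p.1 (pt n X i p.2)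
      * density g i p.2) (s := Icc (-(ε / 2)) (ε / 2) ×ˢ chartSupport n i) (by
      refine ContinuousOn.mono (s := Ioo (-ε) ε ×ˢ (chartAt (Cn n) i).target) ?_
        (prod_mono hsub (chartSupport_subset i))
      have hsnd : MapsTo (Prod.snd : ℝ × Cn n → Cn n) (Ioo (-ε) ε ×ˢ (chartAt (Cn n) i).target)
        (chartAt (Cn n) i).target := fun p hp => hp.2
      exact ((((smoothInCharts_chartPartition i i).continuousOn.comp continuousOn_snd hsnd).mul
        (hF' i).continuousOn).mul ((contDiffOn_density g i).continuousOn.comp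
          continuousOn_snd hsnd)))
  refine (hasDerivAt_integral_of_dominated_loc_of_deriv_le
    (F' := fun t z => chartPartition n X i (pt n X i z) * F' t (pt n X i z) * density g i z)
    (bound := (chartSupport n i).indicator fun _ => C)
    (s := Ioo (-(ε / 2)) (ε / 2)) (Ioo_mem_nhds (by linarith) (by linarith)) ?_ ?_ ?_ ?_ ?_ ?_).2
  · filter_upwards [Ioo_mem_nhds h0.1 h0.2] with t ht
    exact (hslice (hF i) t ht).continuousOn.aestronglyMeasurable hO.measurableSet
  · refine integrableOn_of_vanish_off_compact hO (isCompact_chartSupport i)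
      (chartSupport_subset i) (hslice (hF i) 0 h0) fun z hz h => ?_
    rw [chartPartition_pt_eq_zero hz h, zero_mul, zero_mul]
  · exact (hslice (hF' i) 0 h0).continuousOn.aestronglyMeasurable hO.measurableSet
  · refine (ae_restrict_iff' hO.measurableSet).2 (.of_forall fun z hz t ht => ?_)
    by_cases hzK : z ∈ chartSupport n i
    · rw [indicator_of_mem hzK]
      exact hC (t, z) ⟨Ioo_subset_Icc_self ht, hzK⟩
    · rw [indicator_of_notMem hzK, chartPartition_pt_eq_zero hz hzK]
      simp
  · refine Integrable.restrict ?_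
    rw [integrable_indicator_iff (isCompact_chartSupport i).isClosed.measurableSet]
    exact integrableOn_const (isCompact_chartSupport i).measure_lt_top.ne
  · refine .of_forall fun z t ht => ?_
    exact ((hd t (hsub (Ioo_subset_Icc_self ht)) _).const_mul _).mul_const _

end IntegralOfLaplacian

/-! ### The first variation of the functional -/

section FirstVariation

open MatAlg
open scoped ComplexOrder

variable {n : ℕ} {X : Type*} [TopologicalSpace X] [ChartedSpace (Cn n) X]
  [IsManifold 𝓘(ℂ, Cn n) ω X]
variable {r : ℕ} {V : X → Type*} [TopologicalSpace (TotalSpace (Cn r) V)]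
  [∀ x, AddCommGroup (V x)] [∀ x, Module ℂ (V x)] [∀ x, TopologicalSpace (V x)]
  [FiberBundle (Cn r) V] [VectorBundle ℂ (Cn r) V]

/-- The matrices of a family of metrics in the frame around `x₀`, as a function of the parameter
and the coordinates. -/
def familyAlg (ht : ℝ → HermitianMetric n r V) (x₀ : X) (p : ℝ × Cn n) : MatAlg r :=
  (ht p.1).alg x₀ p.2

/-- The endomorphism `h⁻¹ ∂h_t/∂t` at `t = 0` in the frame around `x₀`. -/
def velocity (ht : ℝ → HermitianMetric n r V) (x₀ : X) (z : Cn n) : MatAlg r :=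
  (ht 0).algInv x₀ z * timeDeriv (familyAlg ht x₀) (0, z)

/-- The first variation of the mean curvature when the metric varies with velocity `h W`. -/
def meanCurvVar (g : KahlerMetric n X) (φ : HiggsField n r V) (h : HermitianMetric n r V) (x₀ : X)
    (W : Cn n → MatAlg r) (z : Cn n) : MatAlg r :=
  contract (g.mat x₀ z) fun α β => higgsCurvVar (h.alg x₀) (h.algInv x₀) (φ.alg x₀) W
    (Pi.single α 1) (Pi.single β 1) z

theorem meanCurvVar_congr (g : KahlerMetric n X) (φ : HiggsField n r V) (h : HermitianMetric n r V)
    (x₀ : X) {W W' : Cn n → MatAlg r} {z : Cn n} (hW : W =ᶠ[𝓝 z] W') :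
    meanCurvVar g φ h x₀ W z = meanCurvVar g φ h x₀ W' z := by
  have h1 : ∀ a, covDel (h.alg x₀) (h.algInv x₀) W a
      =ᶠ[𝓝 z] covDel (h.alg x₀) (h.algInv x₀) W' a := by
    intro a
    filter_upwards [hW.eventuallyEq_nhds] with w hw
    rw [covDel, covDel, del_congr hw, hw.eq_of_nhds]
  simp only [meanCurvVar, higgsCurvVar, delbar_congr (h1 _), hW.eq_of_nhds]

section Family

variable {h : HermitianMetric n r V} {ε : ℝ} {ht : ℝ → HermitianMetric n r V}

theorem IsFamilyThrough.contDiffOn_alg (hf : IsFamilyThrough h ε ht) (x₀ : X) :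
    ContDiffOn ℝ ∞ (familyAlg ht x₀) (Ioo (-ε) ε ×ˢ coordDomain n r V x₀) :=
  contDiffOn_of_entries fun i j => hf.smooth x₀ i j

theorem IsFamilyThrough.contDiffOn_algInv (hf : IsFamilyThrough h ε ht) (x₀ : X) :
    ContDiffOn ℝ ∞ (fun p : ℝ × Cn n => (ht p.1).algInv x₀ p.2)
      (Ioo (-ε) ε ×ˢ coordDomain n r V x₀) :=
  MatAlg.contDiffOn_inv (hf.contDiffOn_alg x₀) fun p hp => ((ht p.1).posDef hp.2).isUnit

theorem IsFamilyThrough.zero_mem (hf : IsFamilyThrough h ε ht) : (0 : ℝ) ∈ Ioo (-ε) ε :=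
  ⟨neg_lt_zero.2 hf.pos, hf.pos⟩

theorem IsFamilyThrough.hasDerivAt_alg (hf : IsFamilyThrough h ε ht) {x₀ : X} {z : Cn n}
    (hz : z ∈ coordDomain n r V x₀) :
    HasDerivAt (fun t => (ht t).alg x₀ z) (timeDeriv (familyAlg ht x₀) (0, z)) 0 :=
  hasDerivAt_slice (f := familyAlg ht x₀) (p := (0, z)) (ContDiffOn.diffAt (hf.contDiffOn_alg x₀)
    (isOpen_Ioo.prod (isOpen_coordDomain x₀)) ⟨hf.zero_mem, hz⟩)

theorem IsFamilyThrough.contDiffOn_velocity (hf : IsFamilyThrough h ε ht) (x₀ : X) :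
    ContDiffOn ℝ ∞ (velocity ht x₀) (coordDomain n r V x₀) :=
  ((ht 0).contDiffOn_algInv x₀).mul ((ContDiffOn.timeDeriv (hf.contDiffOn_alg x₀)
    (isOpen_Ioo.prod (isOpen_coordDomain x₀))).comp (contDiff_prodMk_right (0 : ℝ)).contDiffOn
      fun _ hz => ⟨hf.zero_mem, hz⟩)

theorem IsFamilyThrough.contDiffOn_meanCurv (g : KahlerMetric n X) (φ : HiggsField n r V)
    (hf : IsFamilyThrough h ε ht) (x₀ : X) :
    ContDiffOn ℝ ∞ (fun p : ℝ × Cn n => meanCurv g φ (ht p.1) x₀ p.2)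
      (Ioo (-ε) ε ×ˢ coordDomain n r V x₀) :=
  contDiffOn_contract g x₀ contDiff_snd (fun _ hp => hp.2.1) fun _ _ =>
    contDiffOn_higgsCurv_family isOpen_Ioo (isOpen_coordDomain x₀) (hf.contDiffOn_alg x₀)
      (hf.contDiffOn_algInv x₀) (fun a => ((φ.contDiffOn_alg x₀ a).restrict_scalars ℝ)) _ _

/-- The first variation of the mean curvature in a fixed frame. -/
theorem IsFamilyThrough.hasDerivAt_meanCurv (g : KahlerMetric n X) (φ : HiggsField n r V)
    (hf : IsFamilyThrough h ε ht) {x₀ : X} {z : Cn n} (hz : z ∈ coordDomain n r V x₀) :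
    HasDerivAt (fun t => meanCurv g φ (ht t) x₀ z)
      (meanCurvVar g φ (ht 0) x₀ (velocity ht x₀) z) 0 := by
  unfold meanCurv meanCurvVar contract
  exact HasDerivAt.fun_sum fun α _ => HasDerivAt.fun_sum fun β _ =>
    (hasDerivAt_higgsCurv (H := familyAlg ht x₀) isOpen_Ioo (hf.contDiffOn_alg x₀)
      (hf.contDiffOn_algInv x₀) (fun t _ => frameData φ (ht t) x₀) hf.zero_mem hz
      (Pi.single α 1) (Pi.single β 1)).fun_const_smul ((g.mat x₀ z)⁻¹ α β)

variable [ContMDiffVectorBundle ω (Cn r) V 𝓘(ℂ, Cn n)]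

/-- The velocities of a family of metrics in different frames are matrices of one and the same
endomorphism. -/
theorem IsFamilyThrough.velocity_transform (φ : HiggsField n r V) (hf : IsFamilyThrough h ε ht)
    {x₀ x₁ : X} {z : Cn n} (hz : z ∈ frameOverlap n r V x₀ x₁) :
    velocity ht x₀ z = toAlg (transMat r V x₁ x₀ (pt n X x₀ z))
      * velocity ht x₁ (trans x₀ x₁ z) * toAlg (transMat r V x₀ x₁ (pt n X x₀ z)) := by
  obtain ⟨-, -, hPQ, hQP⟩ := transition_data (n := n) (r := r) (V := V) x₀ x₁
  have h1 := hf.hasDerivAt_alg hz.2.1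
  have h2 := ((hf.hasDerivAt_alg (trans_mem_coordDomain hz)).const_mul
    (star (toAlg (transMat r V x₀ x₁ (pt n X x₀ z))))).mul_const
      (toAlg (transMat r V x₀ x₁ (pt n X x₀ z)))
  have h3 : (fun t => (ht t).alg x₀ z) = fun t =>
      star (toAlg (transMat r V x₀ x₁ (pt n X x₀ z))) * (ht t).alg x₁ (trans x₀ x₁ z)
        * toAlg (transMat r V x₀ x₁ (pt n X x₀ z)) :=
    funext fun t => alg_transform (ht t).toHermitianForm hz
  rw [h3] at h1
  have h4 : ∀ y, star (toAlg (transMat r V x₁ x₀ (pt n X x₀ z)))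
      * (star (toAlg (transMat r V x₀ x₁ (pt n X x₀ z))) * y) = y := fun y => by
    rw [← mul_assoc, ← star_mul, hPQ z hz, star_one, one_mul]
  rw [velocity, velocity, h1.unique h2, algInv_transform (ht 0) φ hz]
  simp only [mul_assoc, h4]

theorem IsFamilyThrough.contDiffOn_normSq (g : KahlerMetric n X) (φ : HiggsField n r V)
    (hf : IsFamilyThrough h ε ht) (x₀ : X) :
    ContDiffOn ℝ ∞ (fun p : ℝ × Cn n => endNormSq (ht p.1) (pt n X x₀ p.2)
      (hsMeanCurvature g φ (ht p.1) (pt n X x₀ p.2)))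
      (Ioo (-ε) ε ×ˢ (chartAt (Cn n) x₀).target) := by
  refine contDiffOn_of_local (f := fun t x => endNormSq (ht t) x (hsMeanCurvature g φ (ht t) x))
    isOpen_Ioo (fun x => ⟨coordDomain n r V x, isOpen_coordDomain x, chartAt_mem_coordDomain x, ?_⟩)
    x₀
  have h1 := hf.contDiffOn_meanCurv g φ x
  have h2 : ContDiffOn ℝ ∞ (fun p : ℝ × Cn n => (tr r (meanCurv g φ (ht p.1) x p.2
      * meanCurv g φ (ht p.1) x p.2)).re) (Ioo (-ε) ε ×ˢ coordDomain n r V x) :=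
    Complex.reCLM.contDiff.comp_contDiffOn
      (((tr r).restrictScalars ℝ).contDiff.comp_contDiffOn (h1.mul h1))
  exact h2.congr fun p hp => endNormSq_hsMeanCurvature g φ (ht p.1) hp.2

theorem IsFamilyThrough.hasDerivAt_normSq (g : KahlerMetric n X) (φ : HiggsField n r V)
    (hf : IsFamilyThrough h ε ht) (x : X) :
    HasDerivAt (fun t => endNormSq (ht t) x (hsMeanCurvature g φ (ht t) x))
      (2 * (tr r (meanCurv g φ (ht 0) x (chartAt (Cn n) x x)
        * meanCurvVar g φ (ht 0) x (velocity ht x) (chartAt (Cn n) x x))).re) 0 := by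
  have hz := chartAt_mem_coordDomain (n := n) (r := r) (V := V) x
  have h1 : (fun t => endNormSq (ht t) x (hsMeanCurvature g φ (ht t) x))
      = fun t => (tr r (meanCurv g φ (ht t) x (chartAt (Cn n) x x)
        * meanCurv g φ (ht t) x (chartAt (Cn n) x x))).re := by
    funext t
    rw [← endNormSq_hsMeanCurvature g φ (ht t) hz, pt_chartAt (mem_chart_source _ _)]
  have h2 := hf.hasDerivAt_meanCurv g φ hz
  have h3 := (((tr r).restrictScalars ℝ).hasFDerivAt.comp_hasDerivAt (0 : ℝ) (h2.fun_mul h2))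
  have h4 := Complex.reCLM.hasFDerivAt.comp_hasDerivAt (0 : ℝ) h3
  rw [h1]
  refine h4.congr_deriv ?_
  change (tr r (_ + _)).re = _
  rw [map_add, Complex.add_re]
  rw [tr_mul_comm (meanCurvVar g φ (ht 0) x (velocity ht x) (chartAt (Cn n) x x))]
  ring

/-- The function `|𝒦_t|²` is differentiable in `t`, and its derivative is jointly smooth. -/
theorem IsFamilyThrough.differentiable_normSq (g : KahlerMetric n X) (φ : HiggsField n r V)
    (hf : IsFamilyThrough h ε ht) :
    (∀ t ∈ Ioo (-ε) ε, ∀ x, DifferentiableAt ℝ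
      (fun t => endNormSq (ht t) x (hsMeanCurvature g φ (ht t) x)) t) ∧
    ∀ x₀ : X, ContDiffOn ℝ ∞ (fun p : ℝ × Cn n => deriv (fun t => endNormSq (ht t) (pt n X x₀ p.2)
      (hsMeanCurvature g φ (ht t) (pt n X x₀ p.2))) p.1)
      (Ioo (-ε) ε ×ˢ (chartAt (Cn n) x₀).target) := by
  set F : ℝ → X → ℝ := fun t x => endNormSq (ht t) x (hsMeanCurvature g φ (ht t) x) with hFdef
  have hF := hf.contDiffOn_normSq g φ
  have hO : ∀ x₀ : X, IsOpen (Ioo (-ε) ε ×ˢ (chartAt (Cn n) x₀).target) := fun x₀ =>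
    isOpen_Ioo.prod (chartAt (Cn n) x₀).open_target
  have hd : ∀ x₀ : X, ∀ t ∈ Ioo (-ε) ε, ∀ z ∈ (chartAt (Cn n) x₀).target,
      HasDerivAt (fun t => F t (pt n X x₀ z)) (fderiv ℝ (fun p : ℝ × Cn n =>
        F p.1 (pt n X x₀ p.2)) (t, z) (1, 0)) t := by
    intro x₀ t ht' z hz
    have h1 : DifferentiableAt ℝ (fun p : ℝ × Cn n => F p.1 (pt n X x₀ p.2)) (t, z) :=
      ((hF x₀).contDiffAt ((hO x₀).mem_nhds ⟨ht', hz⟩)).differentiableAt (by simp)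
    have h2 : HasFDerivAt (fun t : ℝ => (t, z)) (ContinuousLinearMap.inl ℝ ℝ (Cn n)) t :=
      hasFDerivAt_prodMk_left t z
    exact (HasFDerivAt.comp (g := fun p : ℝ × Cn n => F p.1 (pt n X x₀ p.2)) t
      h1.hasFDerivAt h2).hasDerivAt
  refine ⟨fun t ht' x => ?_, fun x₀ => ?_⟩
  · have h1 := hd x t ht' _ (mem_chart_target (Cn n) x)
    rw [pt_chartAt (mem_chart_source _ _)] at h1
    exact h1.differentiableAt
  · have h1 : ContDiffOn ℝ ∞ (fun q : ℝ × Cn n => fderiv ℝ (fun p : ℝ × Cn n =>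
        F p.1 (pt n X x₀ p.2)) q (1, 0)) (Ioo (-ε) ε ×ˢ (chartAt (Cn n) x₀).target) :=
      ((hF x₀).fderiv_of_isOpen (hO x₀) (m := ∞) (by exact le_rfl)).clm_apply contDiffOn_const
    exact h1.congr fun p hp => (hd x₀ p.1 hp.1 p.2 hp.2).deriv

theorem IsFamilyThrough.smoothInCharts_variation (g : KahlerMetric n X) (φ : HiggsField n r V)
    (hf : IsFamilyThrough h ε ht) :
    SmoothInCharts n fun x : X => (tr r (meanCurv g φ (ht 0) x (chartAt (Cn n) x x)
      * meanCurvVar g φ (ht 0) x (velocity ht x) (chartAt (Cn n) x x))).re := by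
  intro x₀
  have h1 := contDiffOn_const (c := (1 / 2 : ℝ)).mul (((hf.differentiable_normSq g φ).2 x₀).comp
    (contDiff_prodMk_right (0 : ℝ)).contDiffOn fun z hz => ⟨hf.zero_mem, hz⟩)
  refine h1.congr fun z _ => ?_
  simp only [Function.comp_apply]
  rw [(hf.hasDerivAt_normSq g φ _).deriv]
  ring

variable [T2Space X] [CompactSpace X]

/-- The first variation of the Kobayashi functional, `∫ tr (𝒦 ∂𝒦/∂t) ωⁿ`. -/
theorem IsFamilyThrough.hasDerivAt_kobayashiFunctional (g : KahlerMetric n X)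
    (φ : HiggsField n r V) (hf : IsFamilyThrough h ε ht) :
    HasDerivAt (fun t => kobayashiFunctional g φ (ht t))
      (kahlerIntegral g fun x => (tr r (meanCurv g φ (ht 0) x (chartAt (Cn n) x x)
        * meanCurvVar g φ (ht 0) x (velocity ht x) (chartAt (Cn n) x x))).re) 0 := by
  obtain ⟨hd, hF'⟩ := hf.differentiable_normSq g φ
  have key := hasDerivAt_kahlerIntegral g hf.pos
    (F := fun t x => endNormSq (ht t) x (hsMeanCurvature g φ (ht t) x))
    (F' := fun t x => deriv (fun t => endNormSq (ht t) x (hsMeanCurvature g φ (ht t) x)) t)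
    (hf.contDiffOn_normSq g φ) hF' fun t ht' x => (hd t ht' x).hasDerivAt
  have key2 := key.const_mul (1 / 2 : ℝ)
  rw [← kahlerIntegral_const_mul] at key2
  refine key2.congr_deriv (congrArg (kahlerIntegral g) (funext fun x => ?_))
  rw [(hf.hasDerivAt_normSq g φ x).deriv]
  ring

/-- If the mean curvature is parallel, the first variation of the functional vanishes along every
family: the pairing of `𝒦` with its first variation is the divergence `-□ tr (𝒦 W)`, where `W` is
the velocity of the family. -/
theorem IsFamilyThrough.hasDerivAt_zero_of_parallel (g : KahlerMetric n X)
    (φ : HiggsField n r V) (hf : IsFamilyThrough h ε ht)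
    (hpar : IsHSParallel φ h (hsMeanCurvature g φ h)) :
    HasDerivAt (fun t => kobayashiFunctional g φ (ht t)) 0 0 := by
  have hpar' : IsHSParallel φ (ht 0) (hsMeanCurvature g φ (ht 0)) := by rwa [hf.zero]
  set f : X → ℂ := fun x => tr r (meanCurv g φ (ht 0) x (chartAt (Cn n) x x)
    * velocity ht x (chartAt (Cn n) x x)) with hfdef
  -- the function `tr (𝒦 W)` in an arbitrary frame
  have hfr : ∀ x₀ : X, ∀ z ∈ coordDomain n r V x₀, f (pt n X x₀ z)
      = tr r (meanCurv g φ (ht 0) x₀ z * velocity ht x₀ z) := by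
    intro x₀ z hz
    obtain ⟨-, -, hPQ, -⟩ := transition_data (n := n) (r := r) (V := V) x₀ (pt n X x₀ z)
    have hz' := mem_frameOverlap_pt hz
    rw [meanCurv_transform g φ (ht 0) hz', hf.velocity_transform φ hz']
    have h4 : ∀ y, toAlg (transMat r V x₀ (pt n X x₀ z) (pt n X x₀ z)) *
        (toAlg (transMat r V (pt n X x₀ z) x₀ (pt n X x₀ z)) * y) = y := fun y => by
      rw [← mul_assoc, hPQ z hz', one_mul]
    rw [show ∀ p q k l : MatAlg r, (q * k * p) * (q * l * p) = q * (k * (p * (q * l))) * p by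
      intro p q k l; noncomm_ring, h4, tr_conjugate (hPQ z hz')]
    rfl
  have hsm : ∀ x : X, ContDiffOn ℝ ∞ (fun z => tr r (meanCurv g φ (ht 0) x z * velocity ht x z))
      (coordDomain n r V x) := fun x =>
    ((tr r).restrictScalars ℝ).contDiff.comp_contDiffOn
      ((HiggsKobayashi.contDiffOn_meanCurv g φ (ht 0) x).mul (hf.contDiffOn_velocity x))
  have hfs : SmoothInCharts n f := smoothInCharts_of_local fun x =>
    ⟨coordDomain n r V x, isOpen_coordDomain x, chartAt_mem_coordDomain x, (hsm x).congr (hfr x)⟩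
  have key : ∀ x, (tr r (meanCurv g φ (ht 0) x (chartAt (Cn n) x x)
      * meanCurvVar g φ (ht 0) x (velocity ht x) (chartAt (Cn n) x x))).re
      = (-1) * (box g f x).re := by
    intro x
    have D := frameData φ (ht 0) x
    have hz := chartAt_mem_coordDomain (n := n) (r := r) (V := V) x
    have hK := HiggsKobayashi.contDiffOn_meanCurv g φ (ht 0) x
    have hp := fun z hz a => parallel_in_frame g φ (ht 0) hpar' (x₀ := x) (z := z) hz a
    have h1 : ∀ α β : Fin n, _ := fun α β => trace_mul_higgsCurvVar_of_parallel D hK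
      (hf.contDiffOn_velocity x) (tr r) tr_mul_comm (fun z hz a => (hp z hz a).1)
      (fun z hz a => by
        rw [D.delbar_eq_adj_covDel hK (fun z hz => meanCurv_adj g φ (ht 0) hz) hz, (hp z hz a).1]
        simp) (fun z hz a => (hp z hz a).2) hz (Pi.single α 1) (Pi.single β 1)
    have h2 : ∀ a, del (fun z => f (pt n X x z)) a =ᶠ[𝓝 (chartAt (Cn n) x x)]
        del (fun z => tr r (meanCurv g φ (ht 0) x z * velocity ht x z)) a := by
      intro a
      filter_upwards [D.isOpen.mem_nhds hz] with z hz'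
      refine del_congr ?_ a
      filter_upwards [D.isOpen.mem_nhds hz'] with w hw using hfr x w hw
    have h3 : tr r (meanCurv g φ (ht 0) x (chartAt (Cn n) x x)
        * meanCurvVar g φ (ht 0) x (velocity ht x) (chartAt (Cn n) x x))
        = (-1 : ℂ) * box g f x := by
      simp only [meanCurvVar, box, boxIn, contract, Finset.mul_sum, map_sum, mul_smul_comm,
        map_smul, h1, delbar_congr (h2 _), smul_eq_mul]
      refine Finset.sum_congr rfl fun α _ => Finset.sum_congr rfl fun β _ => ?_
      ring
    rw [h3]; simp
  have h4 := hf.hasDerivAt_kobayashiFunctional g φ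
  rw [funext key, kahlerIntegral_const_mul, kahlerIntegral_box g hfs, mul_zero] at h4
  exact h4

end Family

end FirstVariation

/-! ### Norms of endomorphisms -/

section Positivity

open scoped ComplexOrder

variable {ι κ : Type*} [Fintype ι] [DecidableEq ι] [Fintype κ] [DecidableEq κ]

open scoped MatrixOrder Matrix.Norms.L2Operator in
/-- A positive definite matrix is `Lᴴ L` with `L` invertible. -/
theorem exists_eq_conjTranspose_mul_self {H : Matrix ι ι ℂ} (hH : H.PosDef) :
    ∃ L M : Matrix ι ι ℂ, L * M = 1 ∧ M * L = 1 ∧ H = Lᴴ * L := by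
  obtain ⟨L, hL, h⟩ := CStarAlgebra.isStrictlyPositive_iff_eq_star_mul_self.mp
    hH.isStrictlyPositive
  obtain ⟨u, rfl⟩ := hL
  exact ⟨u, (u⁻¹ : (Matrix ι ι ℂ)ˣ), u.mul_inv, u.inv_mul, h⟩

/-- In an orthonormal frame the pairing `tr (A B^*_h)` is the standard one. -/
theorem trace_mul_adjoint {H L M : Matrix ι ι ℂ} (hLM : L * M = 1) (hML : M * L = 1)
    (hH : H = Lᴴ * L) (A B : Matrix ι ι ℂ) :
    (A * (H⁻¹ * Bᴴ * H)).trace = ∑ i, ∑ j, (L * A * M) i j * conj ((L * B * M) i j) := by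
  have hinv : H⁻¹ = M * Mᴴ := by
    refine Matrix.inv_eq_right_inv ?_
    rw [hH, Matrix.mul_assoc, ← Matrix.mul_assoc L, hLM, Matrix.one_mul,
      ← Matrix.conjTranspose_mul, hML, Matrix.conjTranspose_one]
  have h1 : (A * (H⁻¹ * Bᴴ * H)).trace = ((L * A * M) * (L * B * M)ᴴ).trace := by
    rw [hinv, hH, Matrix.conjTranspose_mul, Matrix.conjTranspose_mul]
    rw [show A * (M * Mᴴ * Bᴴ * (Lᴴ * L)) = (A * (M * Mᴴ * Bᴴ * Lᴴ)) * L by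
      simp only [Matrix.mul_assoc], Matrix.trace_mul_comm]
    simp only [Matrix.mul_assoc]
  rw [h1]
  simp only [Matrix.trace, Matrix.diag_apply, Matrix.mul_apply (M := L * A * M),
    Matrix.conjTranspose_apply, Complex.star_def]

/-- The `g`- and `h`-norm of an endomorphism valued form of type `(1,0)` is positive. -/
theorem contract_trace_mul_adjoint {n : ℕ} {G : Matrix (Fin n) (Fin n) ℂ} (hG : G.PosDef)
    {H : Matrix ι ι ℂ} (hH : H.PosDef) (A : Fin n → Matrix ι ι ℂ) :
    0 ≤ (contract G fun α β => (A α * (H⁻¹ * (A β)ᴴ * H)).trace).re ∧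
    ((contract G fun α β => (A α * (H⁻¹ * (A β)ᴴ * H)).trace).re = 0 → ∀ α, A α = 0) := by
  obtain ⟨L, M, hLM, hML, hLH⟩ := exists_eq_conjTranspose_mul_self hH
  set y : ι → ι → Fin n → ℂ := fun i j α => conj ((L * A α * M) i j) with hy
  have h1 : contract G (fun α β => (A α * (H⁻¹ * (A β)ᴴ * H)).trace)
      = ∑ i, ∑ j, star (y i j) ⬝ᵥ (G⁻¹ *ᵥ y i j) := by
    simp only [contract, trace_mul_adjoint hLM hML hLH, dotProduct, Matrix.mulVec, hy,
      Pi.star_apply, Complex.star_def, Complex.conj_conj, smul_eq_mul, Finset.mul_sum]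
    rw [Finset.sum_congr rfl fun α _ => Finset.sum_comm, Finset.sum_comm]
    refine Finset.sum_congr rfl fun i _ => ?_
    rw [Finset.sum_congr rfl fun α _ => Finset.sum_comm, Finset.sum_comm]
    refine Finset.sum_congr rfl fun j _ => Finset.sum_congr rfl fun α _ =>
      Finset.sum_congr rfl fun β _ => ?_
    ring
  have hpos : ∀ i j, 0 ≤ (star (y i j) ⬝ᵥ (G⁻¹ *ᵥ y i j)).re := fun i j =>
    (Complex.le_def.1 (hG.inv.posSemidef.dotProduct_mulVec_nonneg (y i j))).1
  rw [h1]
  simp only [Complex.re_sum]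
  refine ⟨Finset.sum_nonneg fun i _ => Finset.sum_nonneg fun j _ => hpos i j, fun h0 α => ?_⟩
  rw [Finset.sum_eq_zero_iff_of_nonneg fun i _ => Finset.sum_nonneg fun j _ => hpos i j] at h0
  have hy0 : ∀ i j, y i j = 0 := by
    intro i j
    have h2 := h0 i (Finset.mem_univ i)
    rw [Finset.sum_eq_zero_iff_of_nonneg fun j _ => hpos i j] at h2
    by_contra hne
    have h3 := (Complex.lt_def.1 (hG.inv.dotProduct_mulVec_pos hne)).1
    rw [h2 j (Finset.mem_univ j)] at h3
    exact lt_irrefl _ h3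
  have h4 : L * A α * M = 0 := by
    ext i j
    have := congrFun (hy0 i j) α
    simpa [hy] using this
  calc A α = (M * L) * A α * (M * L) := by rw [hML, Matrix.one_mul, Matrix.mul_one]
    _ = M * (L * A α * M) * L := by simp only [Matrix.mul_assoc]
    _ = 0 := by rw [h4, Matrix.mul_zero, Matrix.zero_mul]

/-- The quadratic form of an endomorphism is bounded by its Hilbert–Schmidt norm. -/
theorem norm_dotProduct_mul_mulVec_le {H : Matrix ι ι ℂ} (hH : H.PosDef) (A : Matrix ι ι ℂ)
    (u : ι → ℂ) : ‖star u ⬝ᵥ ((H * A) *ᵥ u)‖ ^ 2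
      ≤ (A * (H⁻¹ * Aᴴ * H)).trace.re * (star u ⬝ᵥ (H *ᵥ u)).re ^ 2 := by
  obtain ⟨L, M, hLM, hML, hLH⟩ := exists_eq_conjTranspose_mul_self hH
  set w := L *ᵥ u with hw
  set N := L * A * M with hN
  have h1 : star u ⬝ᵥ ((H * A) *ᵥ u) = ∑ i, ∑ j, conj (w i) * N i j * w j := by
    have h2 : (H * A) *ᵥ u = Lᴴ *ᵥ (N *ᵥ w) := by
      have h3 : H * A = Lᴴ * (N * L) := by
        rw [hN, Matrix.mul_assoc (L * A), hML, Matrix.mul_one, hLH, Matrix.mul_assoc]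
      rw [h3, hw, Matrix.mulVec_mulVec, Matrix.mulVec_mulVec, Matrix.mul_assoc Lᴴ]
    rw [h2, Matrix.dotProduct_mulVec, ← Matrix.star_mulVec, ← hw]
    simp only [dotProduct, Matrix.mulVec, Finset.mul_sum, Pi.star_apply, Complex.star_def,
      mul_assoc]
  have h2 : (star u ⬝ᵥ (H *ᵥ u)).re = ∑ i, ‖w i‖ ^ 2 := by
    rw [hLH, ← Matrix.mulVec_mulVec, Matrix.dotProduct_mulVec, ← Matrix.star_mulVec, ← hw]
    simp only [dotProduct, Pi.star_apply, Complex.star_def, Complex.conj_mul', Complex.re_sum]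
    exact Finset.sum_congr rfl fun i _ => by norm_cast
  have h3 : (A * (H⁻¹ * Aᴴ * H)).trace.re = ∑ i, ∑ j, ‖N i j‖ ^ 2 := by
    rw [trace_mul_adjoint hLM hML hLH]
    simp only [Complex.mul_conj', Complex.re_sum]
    exact Finset.sum_congr rfl fun i _ => Finset.sum_congr rfl fun j _ => by norm_cast
  rw [h1, h2, h3]
  have h4 : ‖∑ i, ∑ j, conj (w i) * N i j * w j‖
      ≤ ∑ p : ι × ι, ‖N p.1 p.2‖ * (‖w p.1‖ * ‖w p.2‖) := by
    rw [← Finset.sum_product', Finset.univ_product_univ]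
    refine (norm_sum_le _ _).trans (Finset.sum_le_sum fun p _ => ?_)
    rw [norm_mul, norm_mul, RCLike.norm_conj]
    apply le_of_eq; ring
  refine (pow_le_pow_left₀ (norm_nonneg _) h4 2).trans
    ((Finset.sum_mul_sq_le_sq_mul_sq _ _ _).trans (le_of_eq ?_))
  simp only [Fintype.sum_prod_type, mul_pow]
  congr 1
  rw [sq, Finset.sum_mul_sum]

end Positivity

/-! ### Linear families of metrics -/

section LinearFamilies

open MatAlg
open scoped ComplexOrder

variable {n : ℕ} {X : Type*} [TopologicalSpace X] [ChartedSpace (Cn n) X]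
  [IsManifold 𝓘(ℂ, Cn n) ω X]
variable {r : ℕ} {V : X → Type*} [TopologicalSpace (TotalSpace (Cn r) V)]
  [∀ x, AddCommGroup (V x)] [∀ x, Module ℂ (V x)] [∀ x, TopologicalSpace (V x)]
  [FiberBundle (Cn r) V] [VectorBundle ℂ (Cn r) V]

/-- A Hermitian metric is determined by its values: smoothness and positivity are properties. -/
theorem HermitianMetric.ext_form {h h' : HermitianMetric n r V}
    (H : ∀ x u v, h.form x u v = h'.form x u v) : h = h' := by
  obtain ⟨⟨f, _, _⟩, _⟩ := h
  obtain ⟨⟨f', _, _⟩, _⟩ := h'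
  obtain rfl : f = f' := funext fun x => LinearMap.ext fun u => LinearMap.ext fun v => H x u v
  rfl

theorem IsLinearFamily.mat_eq {h : HermitianMetric n r V} {k : HermitianForm n r V} {ε : ℝ}
    {ht : ℝ → HermitianMetric n r V} (hl : IsLinearFamily h k ε ht) {t : ℝ} (ht' : t ∈ Ioo (-ε) ε)
    (x₀ : X) (z : Cn n) : (ht t).mat x₀ z = h.mat x₀ z + (t : ℂ) • k.mat x₀ z := by
  ext i j
  exact hl.2 t ht' _ _ _

theorem IsLinearFamily.isFamilyThrough {h : HermitianMetric n r V} {k : HermitianForm n r V}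
    {ε : ℝ} {ht : ℝ → HermitianMetric n r V} (hl : IsLinearFamily h k ε ht) :
    IsFamilyThrough h ε ht where
  pos := hl.1
  zero := HermitianMetric.ext_form fun x u v => by
    rw [hl.2 0 ⟨neg_lt_zero.2 hl.1, hl.1⟩]; simp
  smooth x₀ i j := by
    have h1 : MapsTo (Prod.snd : ℝ × Cn n → Cn n) (Ioo (-ε) ε ×ˢ coordDomain n r V x₀)
      (coordDomain n r V x₀) := fun p hp => hp.2
    have h2 : ContDiffOn ℝ ∞ (fun p : ℝ × Cn n => h.mat x₀ p.2 i j + (p.1 : ℂ) * k.mat x₀ p.2 i j)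
        (Ioo (-ε) ε ×ˢ coordDomain n r V x₀) :=
      ((h.smooth x₀ i j).comp contDiff_snd.contDiffOn h1).add
        ((Complex.ofRealCLM.contDiff.comp contDiff_fst).contDiffOn.mul
          ((k.smooth x₀ i j).comp contDiff_snd.contDiffOn h1))
    exact h2.congr fun p hp => by rw [hl.mat_eq hp.1]; rfl

theorem IsLinearFamily.velocity_eq {h : HermitianMetric n r V} {k : HermitianForm n r V} {ε : ℝ}
    {ht : ℝ → HermitianMetric n r V} (hl : IsLinearFamily h k ε ht) {x₀ : X} {z : Cn n}
    (hz : z ∈ coordDomain n r V x₀) : velocity ht x₀ z = h.algInv x₀ z * k.alg x₀ z := by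
  have hf := hl.isFamilyThrough
  have h1 := hf.hasDerivAt_alg hz
  have h2 : HasDerivAt (fun t : ℝ => h.alg x₀ z + (t : ℂ) • k.alg x₀ z)
      ((1 : ℂ) • k.alg x₀ z) 0 :=
    (Complex.ofRealCLM.hasDerivAt.smul_const _).const_add _
  have h3 : (fun t => (ht t).alg x₀ z) =ᶠ[𝓝 0] fun t : ℝ => h.alg x₀ z + (t : ℂ) • k.alg x₀ z := by
    filter_upwards [Ioo_mem_nhds hf.zero_mem.1 hf.zero_mem.2] with t ht'
    exact congrArg toAlg (hl.mat_eq ht' x₀ z)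
  rw [velocity, h1.unique (h2.congr_of_eventuallyEq h3), one_smul, hf.zero]

/-- The Hermitian form `h + t k` with real `t`. -/
def HermitianForm.addSmul (h k : HermitianForm n r V) (t : ℝ) : HermitianForm n r V where
  form x := h.form x + (t : ℂ) • k.form x
  conj_symm x u v := by
    simp only [LinearMap.add_apply, LinearMap.smul_apply, smul_eq_mul, map_add, map_mul,
      h.conj_symm, k.conj_symm, Complex.conj_ofReal]
  smooth x₀ i j := (h.smooth x₀ i j).add (contDiffOn_const.mul (k.smooth x₀ i j))

/-- If `|k(u, u)| ≤ C h(u, u)`, then `h + t k` is a metric for small `t`. -/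
theorem exists_isLinearFamily (h : HermitianMetric n r V) (k : HermitianForm n r V) {C : ℝ}
    (hC : 0 ≤ C) (hk : ∀ x (u : V x), ‖k.form x u u‖ ≤ C * (h.form x u u).re) :
    ∃ (ε : ℝ) (ht : ℝ → HermitianMetric n r V), IsLinearFamily h k ε ht := by
  classical
  have hpos : ∀ t ∈ Ioo (-(1 / (C + 1))) (1 / (C + 1)), ∀ x (u : V x), u ≠ 0 →
      0 < (((h.toHermitianForm.addSmul k t).form x u u).re) := by
    intro t ht x u hu
    have h1 := h.pos x u hu
    have h2 : |t| * (C + 1) < 1 := by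
      rw [← lt_div_iff₀ (by linarith)]; exact abs_lt.2 ht
    have h3 : |t * (k.form x u u).re| ≤ |t| * (C * (h.form x u u).re) := by
      rw [abs_mul]
      exact mul_le_mul_of_nonneg_left ((Complex.abs_re_le_norm _).trans (hk x u)) (abs_nonneg t)
    have h4 : ((h.toHermitianForm.addSmul k t).form x u u).re
        = (h.form x u u).re + t * (k.form x u u).re := by
      simp [HermitianForm.addSmul]
    rw [h4]
    have h5 := (abs_le.1 h3).1
    have h6 : |t| * (C * (h.form x u u).re) ≤ |t| * (C + 1) * (h.form x u u).re := by
      have := mul_nonneg (abs_nonneg t) h1.le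
      linarith
    have h7 : |t| * (C + 1) * (h.form x u u).re < 1 * (h.form x u u).re :=
      mul_lt_mul_of_pos_right h2 h1
    linarith
  refine ⟨1 / (C + 1), fun t => if ht : t ∈ Ioo (-(1 / (C + 1))) (1 / (C + 1)) then
    ⟨h.toHermitianForm.addSmul k t, hpos t ht⟩ else h, by positivity, fun t ht x u v => ?_⟩
  simp only [dif_pos ht]
  rfl

end LinearFamilies

/-! ### Critical metrics have parallel mean curvature -/

section EulerLagrange

open MatAlg
open scoped ComplexOrder

variable {n : ℕ} {X : Type*} [TopologicalSpace X] [ChartedSpace (Cn n) X]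
  [IsManifold 𝓘(ℂ, Cn n) ω X]
variable {r : ℕ} {V : X → Type*} [TopologicalSpace (TotalSpace (Cn r) V)]
  [∀ x, AddCommGroup (V x)] [∀ x, Module ℂ (V x)] [∀ x, TopologicalSpace (V x)]
  [FiberBundle (Cn r) V] [VectorBundle ℂ (Cn r) V]

theorem SmoothInCharts.continuous {E : Type*} [NormedAddCommGroup E] [NormedSpace ℝ E] {f : X → E}
    (hf : SmoothInCharts n f) : Continuous f := by
  refine continuous_iff_continuousAt.2 fun x => ?_
  have h1 : ContinuousAt (fun z => f (pt n X x z)) (chartAt (Cn n) x x) :=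
    (hf x).continuousOn.continuousAt
      ((chartAt (Cn n) x).open_target.mem_nhds (mem_chart_target _ x))
  have h2 : ContinuousAt (fun y => f (pt n X x (chartAt (Cn n) x y))) x :=
    ContinuousAt.comp (g := fun z => f (pt n X x z)) h1
      ((chartAt (Cn n) x).continuousAt (mem_chart_source _ x))
  refine h2.congr ?_
  filter_upwards [(chartAt (Cn n) x).open_source.mem_nhds (mem_chart_source _ x)] with y hy
  rw [pt_chartAt hy]

/-- `h(u, A v)` in the frame around `x₀`. -/
theorem form_apply_end (h : HermitianForm n r V) {x₀ : X} {z : Cn n}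
    (hz : z ∈ coordDomain n r V x₀) (A : Module.End ℂ (V (pt n X x₀ z))) (u v : Cn r) :
    h.form (pt n X x₀ z) (frameMap r V x₀ _ u) (A (frameMap r V x₀ _ v))
      = star u ⬝ᵥ ((h.mat x₀ z * endMatrix r x₀ _ A) *ᵥ v) := by
  rw [← Matrix.mulVec_mulVec, ← h.form_frameMap, endMatrix_mulVec, frameMap_coframeMap r V hz.2]

theorem covDel_eq_sum (H B W : Cn n → MatAlg r) (a z : Cn n) :
    covDel H B W a z = ∑ γ, a γ • covDel H B W (Pi.single γ 1) z := by
  simp only [covDel]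
  rw [del_eq_sum W a, del_eq_sum H a]
  simp only [smul_add, smul_sub, Finset.sum_add_distrib, Finset.sum_sub_distrib, Finset.mul_sum,
    Finset.sum_mul, mul_smul_comm, smul_mul_assoc]

variable [ContMDiffVectorBundle ω (Cn r) V 𝓘(ℂ, Cn n)]

/-- The matrix `H K` of the form `h(u, 𝒦 v)` is Hermitian. -/
theorem isHermitian_mat_mul_meanCurvature (g : KahlerMetric n X) (φ : HiggsField n r V)
    (h : HermitianMetric n r V) {x₀ : X} {z : Cn n} (hz : z ∈ coordDomain n r V x₀) :
    (h.mat x₀ z * endMatrix r x₀ (pt n X x₀ z)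
      (hsMeanCurvature g φ h (pt n X x₀ z))).IsHermitian := by
  have h1 := (frameData φ h x₀).star_mul_H hz (meanCurv_adj g φ h hz)
  rw [← toAlg_endMatrix_hsMeanCurvature g φ h hz] at h1
  rw [Matrix.IsHermitian, Matrix.conjTranspose_mul, (h.isHermitian x₀ z).eq]
  exact h1

/-- The Hermitian form `k(u, v) = h(u, 𝒦 v)`, whose direction is the one in which the functional is
varied to see that a critical metric has parallel mean curvature. -/
def curvatureForm (g : KahlerMetric n X) (φ : HiggsField n r V) (h : HermitianMetric n r V) :
    HermitianForm n r V where
  form x := (h.form x).compl₂ (hsMeanCurvature g φ h x)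
  conj_symm x := by
    have key : ∀ y, y = pt n X x (chartAt (Cn n) x x) → ∀ u v : V y,
        conj (h.form y u (hsMeanCurvature g φ h y v))
          = h.form y v (hsMeanCurvature g φ h y u) := by
      rintro y rfl u v
      have hz := chartAt_mem_coordDomain (n := n) (r := r) (V := V) x
      rw [← frameMap_coframeMap r V hz.2 u, ← frameMap_coframeMap r V hz.2 v,
        form_apply_end h.toHermitianForm hz, form_apply_end h.toHermitianForm hz]
      have h1 := (isHermitian_mat_mul_meanCurvature g φ h hz).eq
      rw [← Complex.star_def, ← Matrix.star_dotProduct, Matrix.star_mulVec,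
        ← Matrix.dotProduct_mulVec, h1]
    intro u v
    exact key x (pt_chartAt (mem_chart_source _ _)).symm u v
  smooth x₀ i j := by
    have h1 := (h.contDiffOn_alg x₀).mul (contDiffOn_meanCurv g φ h x₀)
    have h2 := ((entry i j).restrictScalars ℝ).contDiff.comp_contDiffOn h1
    refine h2.congr fun z hz => ?_
    simp only [LinearMap.compl₂_apply, frameVec]
    rw [form_apply_end h.toHermitianForm hz, Function.comp_apply,
      ← toAlg_endMatrix_hsMeanCurvature g φ h hz]
    change _ = (h.mat x₀ z * endMatrix r x₀ (pt n X x₀ z)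
      (hsMeanCurvature g φ h (pt n X x₀ z))) i j
    simp [dotProduct, Pi.single_apply, Matrix.mulVec_single]

theorem curvatureForm_alg (g : KahlerMetric n X) (φ : HiggsField n r V)
    (h : HermitianMetric n r V) {x₀ : X} {z : Cn n} (hz : z ∈ coordDomain n r V x₀) :
    (curvatureForm g φ h).alg x₀ z = h.alg x₀ z * meanCurv g φ h x₀ z := by
  refine ext_entry fun i j => ?_
  rw [← toAlg_endMatrix_hsMeanCurvature g φ h hz]
  change h.form _ (frameVec r V x₀ _ i) (hsMeanCurvature g φ h _ (frameVec r V x₀ _ j))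
    = (h.mat x₀ z * endMatrix r x₀ (pt n X x₀ z) (hsMeanCurvature g φ h (pt n X x₀ z))) i j
  rw [frameVec, frameVec, form_apply_end h.toHermitianForm hz]
  simp [dotProduct, Pi.single_apply, Matrix.mulVec_single]

/-- By Cauchy–Schwarz, `|h(u, 𝒦 u)| ≤ |𝒦| h(u, u)`. -/
theorem norm_curvatureForm_sq_le (g : KahlerMetric n X) (φ : HiggsField n r V)
    (h : HermitianMetric n r V) (x : X) (u : V x) :
    ‖(curvatureForm g φ h).form x u u‖ ^ 2
      ≤ endNormSq h x (hsMeanCurvature g φ h x) * (h.form x u u).re ^ 2 := by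
  have hz := chartAt_mem_coordDomain (n := n) (r := r) (V := V) x
  have key : ∀ y, y = pt n X x (chartAt (Cn n) x x) → ∀ u : V y,
      ‖h.form y u (hsMeanCurvature g φ h y u)‖ ^ 2
        ≤ (endMatrix r x y (hsMeanCurvature g φ h y) * matAdjoint (h.mat x (chartAt (Cn n) x x))
          (endMatrix r x y (hsMeanCurvature g φ h y))).trace.re * (h.form y u u).re ^ 2 := by
    rintro y rfl u
    rw [← frameMap_coframeMap r V hz.2 u, form_apply_end h.toHermitianForm hz, h.form_frameMap]
    exact norm_dotProduct_mul_mulVec_le (h.posDef hz) _ _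
  exact key x (pt_chartAt (mem_chart_source _ _)).symm u

theorem smoothInCharts_normSq (g : KahlerMetric n X) (φ : HiggsField n r V)
    (h : HermitianMetric n r V) :
    SmoothInCharts n fun x => endNormSq h x (hsMeanCurvature g φ h x) :=
  smoothInCharts_of_local fun x => ⟨coordDomain n r V x, isOpen_coordDomain x,
    chartAt_mem_coordDomain x, (Complex.reCLM.contDiff.comp_contDiffOn
      (((tr r).restrictScalars ℝ).contDiff.comp_contDiffOn
        ((contDiffOn_meanCurv g φ h x).mul (contDiffOn_meanCurv g φ h x)))).congr fun _ hz =>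
          endNormSq_hsMeanCurvature g φ h hz⟩

/-- On a compact manifold `|𝒦|` is bounded, so that `h + t k`, with `k(u, v) = h(u, 𝒦 v)`, is a
family of metrics for small `t`. -/
theorem exists_linearFamily_curvatureForm [CompactSpace X] (g : KahlerMetric n X)
    (φ : HiggsField n r V) (h : HermitianMetric n r V) :
    ∃ (ε : ℝ) (ht : ℝ → HermitianMetric n r V), IsLinearFamily h (curvatureForm g φ h) ε ht := by
  obtain ⟨C, hC⟩ := isCompact_univ.exists_bound_of_continuousOn
    (smoothInCharts_normSq g φ h).continuous.continuousOn
  refine exists_isLinearFamily h _ (C := √|C|) (Real.sqrt_nonneg _) fun x u => ?_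
  have h0 : 0 ≤ (h.form x u u).re := by
    by_cases hu : u = 0
    · simp [hu]
    · exact (h.pos x u hu).le
  refine abs_le_of_sq_le_sq' ?_ (mul_nonneg (Real.sqrt_nonneg _) h0) |>.2
  rw [mul_pow, Real.sq_sqrt (abs_nonneg _)]
  refine (norm_curvatureForm_sq_le g φ h x u).trans (mul_le_mul_of_nonneg_right ?_ (sq_nonneg _))
  exact (le_abs_self _).trans ((hC x (mem_univ x)).trans (le_abs_self _))

variable [T2Space X] [CompactSpace X]

/-- If the first variation vanishes in the direction of the curvature form, the mean curvature is
parallel: up to a divergence, this variation is the integral of `|D'𝒦|² + |[φ, 𝒦]|²`. -/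
theorem parallel_of_firstVariationVanishes (g : KahlerMetric n X) (φ : HiggsField n r V)
    (h : HermitianMetric n r V) (hv : FirstVariationVanishes (kobayashiFunctional g φ) h) :
    IsHSParallel φ h (hsMeanCurvature g φ h) := by
  obtain ⟨ε, ht, hl⟩ := exists_linearFamily_curvatureForm g φ h
  have hf := hl.isFamilyThrough
  have hz : ∀ x : X, chartAt (Cn n) x x ∈ coordDomain n r V x := chartAt_mem_coordDomain
  -- in the direction of the curvature form the velocity is the mean curvature itself
  have hvel : ∀ x : X, ∀ z ∈ coordDomain n r V x, velocity ht x z = meanCurv g φ h x z := by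
    intro x z hz
    rw [hl.velocity_eq hz, curvatureForm_alg g φ h hz, (frameData φ h x).BHx hz]
  have hJ := (hf.hasDerivAt_kobayashiFunctional g φ).unique (hv _ _ _ hl)
  have hsm := hf.smoothInCharts_variation g φ
  simp only [hf.zero] at hJ hsm
  set f : X → ℂ := fun x => ((endNormSq h x (hsMeanCurvature g φ h x) : ℝ) : ℂ) with hfdef
  have hfs : SmoothInCharts n f := fun x₀ =>
    Complex.ofRealCLM.contDiff.comp_contDiffOn (smoothInCharts_normSq g φ h x₀)
  -- the trace of the square of a self-adjoint endomorphism is real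
  have hfr : ∀ x₀ : X, ∀ z ∈ coordDomain n r V x₀, f (pt n X x₀ z)
      = tr r (meanCurv g φ h x₀ z * meanCurv g φ h x₀ z) := by
    intro x₀ z hz
    rw [hfdef]
    simp only
    rw [endNormSq_hsMeanCurvature g φ h hz]
    refine Complex.ext rfl ?_
    obtain ⟨L, M, hLM, hML, hLH⟩ := exists_eq_conjTranspose_mul_self (h.posDef hz)
    have h1 : tr r (meanCurv g φ h x₀ z * meanCurv g φ h x₀ z)
        = tr r (meanCurv g φ h x₀ z
          * (h.algInv x₀ z * star (meanCurv g φ h x₀ z) * h.alg x₀ z)) := by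
      rw [meanCurv_adj g φ h hz]
    rw [h1, ← toAlg_endMatrix_hsMeanCurvature g φ h hz]
    have h2 := trace_mul_adjoint hLM hML hLH
      (endMatrix r x₀ (pt n X x₀ z) (hsMeanCurvature g φ h (pt n X x₀ z)))
      (endMatrix r x₀ (pt n X x₀ z) (hsMeanCurvature g φ h (pt n X x₀ z)))
    refine Eq.trans ?_ (congrArg Complex.im h2).symm
    simp only [Complex.mul_conj, Complex.im_sum, Complex.ofReal_im, Finset.sum_const_zero]
  -- the densities `|D'𝒦|²` and `|[φ, 𝒦]|²`
  set N : X → ℝ := fun x =>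
    (contract (g.mat x (chartAt (Cn n) x x)) fun α β => tr r
      (covDel (h.alg x) (h.algInv x) (meanCurv g φ h x) (Pi.single α 1) (chartAt (Cn n) x x)
        * (h.algInv x (chartAt (Cn n) x x) * star (covDel (h.alg x) (h.algInv x)
          (meanCurv g φ h x) (Pi.single β 1) (chartAt (Cn n) x x))
          * h.alg x (chartAt (Cn n) x x)))).re with hNdef
  set N' : X → ℝ := fun x =>
    (contract (g.mat x (chartAt (Cn n) x x)) fun α β => tr r
      ((φ.alg x (chartAt (Cn n) x x) (Pi.single α 1) * meanCurv g φ h x (chartAt (Cn n) x x)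
          - meanCurv g φ h x (chartAt (Cn n) x x) * φ.alg x (chartAt (Cn n) x x) (Pi.single α 1))
        * (h.algInv x (chartAt (Cn n) x x) * star (φ.alg x (chartAt (Cn n) x x) (Pi.single β 1)
            * meanCurv g φ h x (chartAt (Cn n) x x) - meanCurv g φ h x (chartAt (Cn n) x x)
            * φ.alg x (chartAt (Cn n) x x) (Pi.single β 1)) * h.alg x (chartAt (Cn n) x x)))).re
    with hN'def
  have key : ∀ x, (tr r (meanCurv g φ h x (chartAt (Cn n) x x)
      * meanCurvVar g φ h x (velocity ht x) (chartAt (Cn n) x x))).re + 1 / 2 * (box g f x).re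
      = N x + N' x := by
    intro x
    have D := frameData φ h x
    rw [meanCurvVar_congr g φ h x (W' := meanCurv g φ h x)
      (by filter_upwards [D.isOpen.mem_nhds (hz x)] with z hz' using hvel x z hz')]
    have h2 : ∀ a, del (fun z => f (pt n X x z)) a =ᶠ[𝓝 (chartAt (Cn n) x x)]
        del (fun z => tr r (meanCurv g φ h x z * meanCurv g φ h x z)) a := by
      intro a
      filter_upwards [D.isOpen.mem_nhds (hz x)] with z hz'
      refine del_congr ?_ a
      filter_upwards [D.isOpen.mem_nhds hz'] with w hw using hfr x w hw
    have h1 : ∀ α β : Fin n, _ := fun α β => trace_mul_higgsCurvVar_self D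
      (contDiffOn_meanCurv g φ h x) (fun z hz => meanCurv_adj g φ h hz) (tr r) tr_mul_comm (hz x)
      (Pi.single α 1) (Pi.single β 1)
    have h3 : tr r (meanCurv g φ h x (chartAt (Cn n) x x)
        * meanCurvVar g φ h x (meanCurv g φ h x) (chartAt (Cn n) x x))
        = contract (g.mat x (chartAt (Cn n) x x)) fun α β => tr r
          (meanCurv g φ h x (chartAt (Cn n) x x) * higgsCurvVar (h.alg x) (h.algInv x) (φ.alg x)
            (meanCurv g φ h x) (Pi.single α 1) (Pi.single β 1) (chartAt (Cn n) x x)) := by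
      simp only [meanCurvVar, contract, Finset.mul_sum, map_sum, mul_smul_comm, map_smul]
    simp only [h1, contract_add] at h3
    have h4 := contract_smul (g.mat x (chartAt (Cn n) x x)) (-(1 / 2) : ℂ) fun α β =>
      delbar (del (fun z => tr r (meanCurv g φ h x z * meanCurv g φ h x z)) (Pi.single α 1))
        (Pi.single β 1) (chartAt (Cn n) x x)
    simp only [smul_eq_mul] at h4
    have h5 : box g f x = contract (g.mat x (chartAt (Cn n) x x)) fun α β =>
      delbar (del (fun z => tr r (meanCurv g φ h x z * meanCurv g φ h x z)) (Pi.single α 1))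
        (Pi.single β 1) (chartAt (Cn n) x x) := by
      simp only [box, boxIn, delbar_congr (h2 _)]
    rw [h4, ← h5] at h3
    rw [h3, hNdef, hN'def]
    have h6 : (-(1 / 2) * box g f x).re = -(1 / 2) * (box g f x).re := by
      rw [show (-(1 / 2) : ℂ) = ((-(1 / 2) : ℝ) : ℂ) by push_cast; ring, Complex.re_ofReal_mul]
    rw [Complex.add_re, Complex.add_re, h6]
    ring
  have hN : ∀ x, 0 ≤ N x ∧ (N x = 0 → ∀ α, covDel (h.alg x) (h.algInv x) (meanCurv g φ h x)
      (Pi.single α 1) (chartAt (Cn n) x x) = 0) := fun x =>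
    contract_trace_mul_adjoint (g.posDef (mem_chart_target _ x)) (h.posDef (hz x)) fun α =>
      (toAlgL r).symm (covDel (h.alg x) (h.algInv x) (meanCurv g φ h x) (Pi.single α 1)
        (chartAt (Cn n) x x))
  have hN' : ∀ x, 0 ≤ N' x ∧ (N' x = 0 → ∀ α, φ.alg x (chartAt (Cn n) x x) (Pi.single α 1)
      * meanCurv g φ h x (chartAt (Cn n) x x) - meanCurv g φ h x (chartAt (Cn n) x x)
      * φ.alg x (chartAt (Cn n) x x) (Pi.single α 1) = 0) := fun x =>
    contract_trace_mul_adjoint (g.posDef (mem_chart_target _ x)) (h.posDef (hz x)) fun α =>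
      (toAlgL r).symm (φ.alg x (chartAt (Cn n) x x) (Pi.single α 1)
        * meanCurv g φ h x (chartAt (Cn n) x x) - meanCurv g φ h x (chartAt (Cn n) x x)
        * φ.alg x (chartAt (Cn n) x x) (Pi.single α 1))
  have hbox : SmoothInCharts n fun x => 1 / 2 * (box g f x).re := fun x₀ =>
    contDiffOn_const.mul (Complex.reCLM.contDiff.comp_contDiffOn (smoothInCharts_box g hfs x₀))
  -- the sum of the densities is smooth, being the variation plus `□ |𝒦|² / 2`
  have hsum : SmoothInCharts n fun x => N x + N' x := by
    rw [← funext key]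
    exact fun x₀ => (hsm x₀).add (hbox x₀)
  have hint : kahlerIntegral g (fun x => N x + N' x) = 0 := by
    rw [← funext key, kahlerIntegral_add g hsm hbox, hJ, kahlerIntegral_const_mul,
      kahlerIntegral_box g hfs]
    simp
  have hzero := eq_zero_of_kahlerIntegral_eq_zero g hsum
    (fun x => add_nonneg (hN x).1 (hN' x).1) hint
  intro x
  refine (hsCovDeriv_eq_zero_iff g φ h x).2 fun u => ?_
  have h0 := hzero x
  have e1 := (hN x).2 (by linarith [(hN x).1, (hN' x).1])
  have e2 := (hN' x).2 (by linarith [(hN x).1, (hN' x).1])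
  constructor
  · rw [covDel_eq_sum]
    simp [e1]
  · rw [(frameData φ h x).eq_sum _ u, Finset.sum_mul, Finset.mul_sum, ← Finset.sum_sub_distrib]
    refine Finset.sum_eq_zero fun γ _ => ?_
    rw [smul_mul_assoc, mul_smul_comm, ← smul_sub, e2, smul_zero]

end EulerLagrange

end HiggsKobayashi

end

theorem mainTheorem2 {n r : ℕ} {X : Type*} [TopologicalSpace X] [T2Space X] [CompactSpace X]
    [ChartedSpace (Cn n) X] [IsManifold 𝓘(ℂ, Cn n) ω X]
    {V : X → Type*} [TopologicalSpace (TotalSpace (Cn r) V)]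
    [∀ x, AddCommGroup (V x)] [∀ x, Module ℂ (V x)] [∀ x, TopologicalSpace (V x)]
    [FiberBundle (Cn r) V] [VectorBundle ℂ (Cn r) V]
    [ContMDiffVectorBundle ω (Cn r) V 𝓘(ℂ, Cn n)]
    (g : HiggsKobayashi.KahlerMetric n X) (φ : HiggsKobayashi.HiggsField n r V)
    (h : HiggsKobayashi.HermitianMetric n r V) :
    (∀ (ε : ℝ) (ht : ℝ → HiggsKobayashi.HermitianMetric n r V),
      HiggsKobayashi.IsFamilyThrough h ε ht →
      DifferentiableAt ℝ (fun t => HiggsKobayashi.kobayashiFunctional g φ (ht t)) 0) ∧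
    (HiggsKobayashi.FirstVariationVanishes (HiggsKobayashi.kobayashiFunctional g φ) h ↔
      ∀ (x : X) (u : TangentSpace 𝓘(ℂ, Cn n) x),
        HiggsKobayashi.hsCovDeriv φ h (HiggsKobayashi.hsMeanCurvature g φ h) x u = 0) ∧
    (HiggsKobayashi.IsCriticalPoint (HiggsKobayashi.kobayashiFunctional g φ) h ↔
      HiggsKobayashi.IsHSParallel φ h (HiggsKobayashi.hsMeanCurvature g φ h)) := by
  -- for every family, a parallel mean curvature forces the first variation to vanish
  have hpar : HiggsKobayashi.IsHSParallel φ h (HiggsKobayashi.hsMeanCurvature g φ h) →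
      HiggsKobayashi.IsCriticalPoint (HiggsKobayashi.kobayashiFunctional g φ) h :=
    fun hp _ _ hf => hf.hasDerivAt_zero_of_parallel g φ hp
  -- linear families are among the smooth families through `h`
  have hlin : HiggsKobayashi.IsCriticalPoint (HiggsKobayashi.kobayashiFunctional g φ) h →
      HiggsKobayashi.FirstVariationVanishes (HiggsKobayashi.kobayashiFunctional g φ) h :=
    fun hc _ ε ht hl => hc ε ht hl.isFamilyThrough
  have hel := HiggsKobayashi.parallel_of_firstVariationVanishes g φ h
  exact ⟨fun _ _ hf => (hf.hasDerivAt_kobayashiFunctional g φ).differentiableAt,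
    ⟨hel, fun hp => hlin (hpar hp)⟩, ⟨fun hc => hel (hlin hc), hpar⟩⟩
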